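/- Let $\Omega\subset\mathbb{R}^d$ be a uniformly $C^2$ open set (connectedness is not needed): there are constants $\alpha,\beta,K>0$ such that for every $x_0\in\partial\Omega$, in suitable orthonormal coordinates $(w,s)\in\mathbb{R}^{d-1}\times\mathbb{R}$ centred at $x_0$, there is a $C^2$ function $h$ on $\{|w|<\alpha\}$ with $h(0)=0$, $\nabla h(0)=0$ and all derivatives of order at most $2$ bounded by $K$, such that for $|w|<\alpha$ and $|s-h(w)|<\beta$ the point with coordinates $(w,s)$ belongs to $\Omega$ if and only if $s>h(w)$, and to $\partial\Omega$ if and only if $s=h(w)$. Let $d(x)=\operatorname{dist}(x,\partial\Omega)$ and, for $t>0$, let $\Gamma_t=\{x\in\Omega : d(x)<t\}$. Let $R_0\in[0,\infty]$ be the reach, i.e. the largest number such that for all $0<t<R_0$ every $x\in\Gamma_t$ has exactly one nearest point $\pi(x)\in\partial\Omega$, $|x-\pi(x)|=d(x)$. Let $\kappa_1,\dots,\kappa_{d-1}$ be the principal curvatures of $\partial\Omega$ with respect to the inward normal (at $y\in\partial\Omega$, the eigenvalues of the Hessian at $0$ of the function whose graph over the tangent hyperplane at $y$, in the direction of the inward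 normal, is $\partial\Omega$ near $y$; they are positive for a ball). Let $f,g\in BV(\Omega)$, that is, $f,g\in L^1(\Omega)$ and their distributional gradients $\nabla f,\nabla g$ are finite $\mathbb{R}^d$-valued Radon measures on $\Omega$. On $\Gamma_t$ let $\nabla_\nu f=\nabla d\cdot\nabla f$, a signed measure with total variation measure $|\nabla_\nu f|$, and similarly for $g$. Then for every $t\in(0,R_0)$ the following holds. The functions $f$ and $g$ have traces on $\partial\Omega$, denoted again by $f$ and $g$: for $\mathcal{H}^{d-1}$-a.e. $y\in\partial\Omega$ the averages of $f$ over $\Omega\cap B(y,r)$ converge as $r\downarrow0$ to a number $f(y)$, and the averages of $|f-f(y)|$ over $\Omega\cap B(y,r)$ tend to $0$; likewise for $g$. These traces satisfy, as an inequality in $[0,\infty]$, $$\int_{\partial\Omega}|f-g|\,d\mathcal{H}^{d-1}\le\int_{\Gamma_t}\prod_{i=1}^{d-1}\frac{1}{1-(\kappa_i\circ\pi)\,d}\,|\nabla_\nu f|+\int_{\Gamma_t}\prod_{i=1}^{d-1}\frac{1}{1-(\kappa_i\circ\pi)\,d}\,|\nabla_\nu g|+\frac1t\int_{\Gamma_t}\prod_{i=1}^{d-1}\frac{1}{1-(\kappa_i\circ\pi)\,d}\,|f-g|\,dx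 .$$ -/

import Mathlib

open MeasureTheory Set Filter Topology
open scoped ENNReal Gradient RealInnerProductSpace

noncomputable section

namespace CurvedTrace

variable {d : ℕ}

/-- The Euclidean space of dimension `d`. -/
abbrev Space (d : ℕ) : Type := EuclideanSpace ℝ (Fin d)

/-! ### Uniformly `C²` open sets -/

/-- `Ω` is open and there are constants `α, β, K > 0` such that around every boundary point `x₀`, in
orthonormal coordinates `x₀ + w + s n` (with `n` a unit vector and `w ⟂ n`), the set `Ω` is the part
`s > h w` lying above the graph of a `C²` function `h` on the ball `|w| < α`, inside the
neighbourhood `|w| < α`, `|s - h w| < β`; moreover `h 0 = 0`, `∇h 0 = 0`, and the derivatives of `h`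
up to order two are bounded by `K`. -/
def IsUniformlyC2 (Ω : Set (Space d)) : Prop :=
  IsOpen Ω ∧ ∃ α β K : ℝ, 0 < α ∧ 0 < β ∧ 0 < K ∧
    ∀ x₀ ∈ frontier Ω, ∃ (n : Space d) (h : (ℝ ∙ n)ᗮ → ℝ),
      ‖n‖ = 1 ∧ ContDiffOn ℝ 2 h (Metric.ball 0 α) ∧ h 0 = 0 ∧ fderiv ℝ h 0 = 0 ∧
      (∀ k ≤ 2, ∀ w ∈ Metric.ball (0 : (ℝ ∙ n)ᗮ) α, ‖iteratedFDeriv ℝ k h w‖ ≤ K) ∧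
      ∀ w ∈ Metric.ball (0 : (ℝ ∙ n)ᗮ) α, ∀ s : ℝ, |s - h w| < β →
        (x₀ + (w : Space d) + s • n ∈ Ω ↔ h w < s) ∧
        (x₀ + (w : Space d) + s • n ∈ frontier Ω ↔ s = h w)

/-! ### Distance to the boundary, boundary layer, reach, projection -/

/-- The distance to the boundary `∂Ω`. -/
def bdryDist (Ω : Set (Space d)) (x : Space d) : ℝ :=
  Metric.infDist x (frontier Ω)

/-- The boundary layer `Γ_t = {x ∈ Ω | dist (x, ∂Ω) < t}`. -/
def layer (Ω : Set (Space d)) (t : ℝ) : Set (Space d) :=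
  {x | x ∈ Ω ∧ bdryDist Ω x < t}

/-- `y` is a point of `∂Ω` nearest to `x`. -/
def IsNearestBdryPoint (Ω : Set (Space d)) (x y : Space d) : Prop :=
  y ∈ frontier Ω ∧ dist x y = bdryDist Ω x

/-- The reach of `∂Ω` from inside `Ω`: the largest `R₀ ∈ [0, ∞]` such that for every `0 < t < R₀`
each point of `Γ_t` has exactly one nearest point on `∂Ω`. -/
def reach (Ω : Set (Space d)) : ℝ≥0∞ :=
  sSup {R | ∀ t : ℝ, 0 < t → ENNReal.ofReal t < R →
    ∀ x ∈ layer Ω t, ∃! y, IsNearestBdryPoint Ω x y}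

/-- The projection `π` onto `∂Ω` (meaningful where the nearest boundary point is unique). -/
def bdryProj (Ω : Set (Space d)) (x : Space d) : Space d :=
  Classical.epsilon (IsNearestBdryPoint Ω x)

/-! ### Principal curvatures -/

/-- `k` lists, with multiplicity, the principal curvatures of `∂Ω` at `y` with respect to the inward
normal: writing `Ω` near `y` as the region above the graph, over the tangent hyperplane at `y` and in
the direction of the inward unit normal `n`, of a function `h` which is `C²` at `0` with `h 0 = 0`
and `∇h 0 = 0`, the `k i` are the eigenvalues of the Hessian of `h` at `0`. (They are positive for
a ball.) -/
def IsPrincipalCurvatures (Ω : Set (Space d)) (y : Space d) (k : Fin (d - 1) → ℝ) : Prop :=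
  ∃ (n : Space d) (h : (ℝ ∙ n)ᗮ → ℝ),
    ‖n‖ = 1 ∧ ContDiffAt ℝ 2 h 0 ∧ h 0 = 0 ∧ fderiv ℝ h 0 = 0 ∧
    (∀ᶠ p : (ℝ ∙ n)ᗮ × ℝ in 𝓝 0, (y + (p.1 : Space d) + p.2 • n ∈ Ω ↔ h p.1 < p.2)) ∧
    ∃ b : OrthonormalBasis (Fin (d - 1)) ℝ (ℝ ∙ n)ᗮ,
      ∀ i w, fderiv ℝ (fderiv ℝ h) 0 (b i) w = k i * inner ℝ (b i) w

/-- The inward principal curvatures `κ₁, …, κ_{d-1}` of `∂Ω` at `y`, in some order. -/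
def principalCurvatures (Ω : Set (Space d)) (y : Space d) : Fin (d - 1) → ℝ :=
  Classical.epsilon (IsPrincipalCurvatures Ω y)

/-- The weight `∏ i, 1 / (1 - κ_i (π x) d(x))`. -/
def weight (Ω : Set (Space d)) (x : Space d) : ℝ :=
  ∏ i : Fin (d - 1), 1 / (1 - principalCurvatures Ω (bdryProj Ω x) i * bdryDist Ω x)

/-! ### Functions of bounded variation -/

/-- On `Ω`, the vector measure `μ` is the distributional gradient of `f`:
`∫_Ω f ∇φ dx = - ∫ φ dμ` for all `φ ∈ C¹_c(Ω)`. -/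
def IsBVGradient (Ω : Set (Space d)) (f : Space d → ℝ) (μ : VectorMeasure (Space d) (Space d)) :
    Prop :=
  ∀ φ : Space d → ℝ, ContDiff ℝ 1 φ → HasCompactSupport φ → tsupport φ ⊆ Ω →
    ∫ x in Ω, f x • ∇ φ x = - ∫ᵛ x, φ x ∂•μ

/-- `f ∈ BV(Ω)`: `f` is integrable on `Ω` and its distributional gradient on `Ω` is a (finite)
vector measure. -/
def MemBV (Ω : Set (Space d)) (f : Space d → ℝ) : Prop :=
  IntegrableOn f Ω ∧ ∃ μ, IsBVGradient Ω f μ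

/-- The gradient measure of `f ∈ BV(Ω)`; only its values on subsets of `Ω` are meaningful. -/
def bvGradient (Ω : Set (Space d)) (f : Space d → ℝ) : VectorMeasure (Space d) (Space d) :=
  Classical.epsilon (IsBVGradient Ω f)

/-- The real inner product as a continuous bilinear map. -/
def innerBilin (d : ℕ) : Space d →L[ℝ] Space d →L[ℝ] ℝ :=
  (isBoundedBilinearMap_inner (𝕜 := ℝ) (E := Space d)).toContinuousLinearMap

/-- The signed measure `∇_ν f = ∇d · ∇f` on the boundary layer `Γ_t`, where `d` is the distance to
`∂Ω` and `∇f` is the gradient measure of `f ∈ BV(Ω)`. -/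
def normalDeriv (Ω : Set (Space d)) (f : Space d → ℝ) (t : ℝ) : SignedMeasure (Space d) :=
  ((bvGradient Ω f).restrict (layer Ω t)).withDensity (fun x ↦ ∇ (bdryDist Ω) x) (innerBilin d)

/-- The boundary trace of `f`: the limit of the averages of `f` over `Ω ∩ B(y, r)` as `r → 0`. -/
def bvTrace (Ω : Set (Space d)) (f : Space d → ℝ) (y : Space d) : ℝ :=
  limUnder (𝓝[>] (0 : ℝ)) fun r ↦ ⨍ x in Ω ∩ Metric.ball y r, f x

/-- The trace of `f` exists: for almost every `y ∈ ∂Ω` with respect to `(d-1)`-dimensional Hausdorff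
measure, the averages over `Ω ∩ B(y, r)` of `|f - bvTrace Ω f y|` tend to `0` as `r → 0`. -/
def HasBVTrace (Ω : Set (Space d)) (f : Space d → ℝ) : Prop :=
  ∀ᵐ y ∂(μHE[d - 1] : Measure (Space d)).restrict (frontier Ω),
    Tendsto (fun r : ℝ ↦ ⨍ x in Ω ∩ Metric.ball y r, |f x - bvTrace Ω f y|) (𝓝[>] 0) (𝓝 0)

end CurvedTrace

end

/-!
# A trace inequality with curvature weights

Near a boundary point, `∂Ω` is a graph `w ↦ graphPoint w` with inward unit normal `graphNormal`, and
`normalChart (w, s) = graphPoint w + s • graphNormal w` are normal coordinates. In these coordinates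
the inequality becomes the fundamental theorem of calculus along the normals.

*Geometry.* Up to the reach, nearest boundary points are unique. This forces every inward normal ray
to realize the distance to the boundary (`HasUniqueProj.bdryDist_normal`): a short ray does so by
the interior ball condition, and a ray can be prolonged since the distance grows with slope one away
from a unique nearest point (`HasUniqueProj.bdryDist_prolong`). Hence `normalChart` is injective,
`s` is the distance to the boundary, `graphPoint w` is the nearest boundary point, and `∇d` is the
unit normal `∂_s normalChart` (`IsNormalChart.gradient_bdryDist`). By the Weingarten equation the
Jacobian is `J (w, s) = J (w, 0) ∏ (1 - κ_i s)` (`IsGraphOn.chartJac_eq`), so that the weight of the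
inequality is `J (w, 0) / J (w, s)`. It is finite because balls of radius below the reach touch the
boundary from inside, whence `κ_i s < 1` (`HasUniqueProj.curvature_mul_lt_one`).

*Analysis.* If `η` is a test function in normal coordinates, then the field `(η / J) ∇d` has
divergence `(∂_s η) / J`. It is merely continuous, but by mollification such fields may be tested
against the gradient measure of a function of bounded variation (`integral_mul_weakDivergence`).
Therefore the distributional `s`-derivative of `f ∘ normalChart` is dominated by `|∇_ν f|`, moved to
normal coordinates and divided by `J` (`IsNormalChart.verticalDerivBound`). A function `F` on a slab
`B × (0, t)` whose vertical derivative is dominated by a finite measure `m` has a bottom trace `T`,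
and over every measurable part `A` of the base the `L¹` distance between `F` and `T` on `A × (0, r)`
is at most `r m (A × (0, r))` (`lintegral_sub_trace_le`). The trace is attained at almost every
point in the sense of averages over cylinders, hence over half balls
(`ae_tendsto_average_sub_trace`, `IsNormalChart.tendsto_setAverage`). Applying the estimate
with `r = t` to `f` and `g`, the triangle inequality `|T_f - T_g| ≤ |T_f - f| + |f - g| + |g - T_g|`,
averaged over the height, is the inequality in normal coordinates (`lintegral_trace_sub_trace_le`).

*Localization.* On a small enough chart the area element `J (w, 0)` and the Lipschitz constant of
`graphPoint` differ from `1` by little, so that the weighted inequality holds there up to a factor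
`(1 + ε) ^ d` (`IsFineChart.isTracePatch`). It localizes to all measurable pieces of the boundary,
with the fibres of the projection on the right-hand side; summing over countably many disjoint
pieces (`lintegral_frontier_le`) and letting `ε → 0` yields the theorem.
-/

noncomputable section

namespace CurvedTrace

variable {d : ℕ}

/-! ### Integration against vector measures -/

theorem isFiniteMeasure_variation {X : Type*} [MeasurableSpace X]
    (μ : VectorMeasure X (Space d)) : IsFiniteMeasure μ.variation := by
  let c : Fin d → SignedMeasure X := fun i ↦
    μ.mapRange ((EuclideanSpace.proj i : Space d →L[ℝ] ℝ) : Space d →+ ℝ)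
      (EuclideanSpace.proj i : Space d →L[ℝ] ℝ).continuous
  have h : μ.variation ≤ ∑ i, (c i).totalVariation := by
    refine VectorMeasure.variation_le_of_forall_enorm_le fun E hE ↦ ?_
    have h1 : ‖μ E‖ₑ ≤ ∑ i, ‖(μ E) i‖ₑ := by
      have : μ E = ∑ i, EuclideanSpace.single i ((μ E) i) := by
        ext j; simp
      conv_lhs => rw [this]
      refine (enorm_sum_le _ _).trans (Finset.sum_le_sum fun i _ ↦ ?_)
      simp [enorm_eq_nnnorm]
    rw [Measure.finsetSum_apply]
    refine h1.trans (Finset.sum_le_sum fun i _ ↦ ?_)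
    exact (c i).enorm_le_totalVariation E
  exact isFiniteMeasure_of_le _ h

/-- Integrating against the measure `B (ν ·) dμ` is integrating `θ • ν` against `μ`. -/
theorem integral_withDensity_eq {X E F : Type*} [MeasurableSpace X]
    [NormedAddCommGroup E] [NormedSpace ℝ E] [NormedAddCommGroup F] [NormedSpace ℝ F]
    (μ : VectorMeasure X F) [IsFiniteMeasure μ.variation] (B : E →L[ℝ] F →L[ℝ] ℝ) (ν : X → E)
    (hν : AEStronglyMeasurable ν μ.variation) {C : ℝ} (hC : ∀ x, ‖ν x‖ ≤ C) (θ : X → ℝ)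
    (hθ : Integrable θ μ.variation) :
    ∫ᵛ x, θ x ∂•(μ.withDensity ν B) = ∫ᵛ x, θ x • ν x ∂[B; μ] := by
  have hνi : μ.Integrable ν := Integrable.of_bound hν C (Eventually.of_forall hC)
  have hvar : (μ.withDensity ν B).variation ≤ (‖B‖₊ * C.toNNReal) • μ.variation := by
    refine VectorMeasure.variation_le_of_forall_enorm_le fun s hs ↦ ?_
    rw [VectorMeasure.withDensity_apply hνi]
    have := VectorMeasure.enorm_setIntegral_le_of_enorm_le_const (μ := μ) (B := B) (s := s) (f := ν)
      (C := ENNReal.ofReal C) (fun x _ ↦ by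
        rw [← ofReal_norm]; exact ENNReal.ofReal_le_ofReal (hC x))
    refine this.trans (le_of_eq ?_)
    rw [Measure.smul_apply, ENNReal.smul_def, smul_eq_mul, ENNReal.coe_mul,
      mul_comm (‖B‖₊ : ℝ≥0∞)]
    rfl
  have hfin : IsFiniteMeasure (μ.withDensity ν B).variation := isFiniteMeasure_of_le _ hvar
  have hint1 : ∀ {g : X → ℝ}, Integrable g μ.variation →
      (μ.withDensity ν B).Integrable g := fun hg ↦
    (hg.smul_measure_nnreal (c := ‖B‖₊ * C.toNNReal)).mono_measure hvar
  have hint2 : ∀ {g : X → ℝ}, Integrable g μ.variation →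
      μ.Integrable (fun x ↦ g x • ν x) := fun hg ↦
    hg.smul_bdd C hν (Eventually.of_forall hC)
  -- both sides are linear and continuous in `θ` for the `L¹` norm of the variation, so that it
  -- suffices to treat indicator functions
  refine hθ.induction (P := fun θ ↦
    ∫ᵛ x, θ x ∂•(μ.withDensity ν B) = ∫ᵛ x, θ x • ν x ∂[B; μ]) ?_ ?_ ?_ ?_
  · intro c s hs _
    rw [VectorMeasure.integral_indicator_const _ hs, VectorMeasure.withDensity_apply hνi]
    have : (fun x ↦ s.indicator (fun _ ↦ c) x • ν x) = s.indicator (fun x ↦ c • ν x) := by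
      ext x; by_cases hx : x ∈ s <;> simp [hx]
    rw [this, VectorMeasure.integral_indicator hs, VectorMeasure.integral_fun_smul]
    simp
  · intro f g _ hf hg h1 h2
    have : (fun x ↦ (f + g) x • ν x) = fun x ↦ f x • ν x + g x • ν x := by
      ext x; simp [add_smul]
    rw [this, VectorMeasure.integral_fun_add (hint2 hf) (hint2 hg), ← h1, ← h2]
    exact VectorMeasure.integral_fun_add (hint1 hf) (hint1 hg)
  · have key : ∀ f g : X →₁[μ.variation] ℝ, ∫ x, ‖f x - g x‖ ∂μ.variation = dist f g := by
      intro f g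
      rw [dist_eq_norm, L1.norm_eq_integral_norm]
      exact integral_congr_ae (by filter_upwards [Lp.coeFn_sub f g] with x hx; rw [hx]; rfl)
    refine isClosed_eq ?_ ?_
    · refine (LipschitzWith.of_dist_le_mul
        (K := ‖ContinuousLinearMap.lsmul ℝ ℝ (E := ℝ)‖₊ * (‖B‖₊ * C.toNNReal))
        fun f g ↦ ?_).continuous
      have hf := L1.integrable_coeFn f
      have hg := L1.integrable_coeFn g
      rw [dist_eq_norm, ← VectorMeasure.integral_fun_sub (hint1 hf) (hint1 hg), ← key]
      refine VectorMeasure.norm_integral_le_integral_norm.trans ?_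
      rw [NNReal.coe_mul, mul_assoc, coe_nnnorm]
      gcongr
      refine (integral_mono_measure hvar (Eventually.of_forall fun _ ↦ norm_nonneg _)
        ((hf.sub hg).norm.smul_measure_nnreal)).trans (le_of_eq ?_)
      rw [integral_smul_nnreal_measure]
      rfl
    · refine (LipschitzWith.of_dist_le_mul (K := ‖B‖₊ * C.toNNReal) fun f g ↦ ?_).continuous
      have hf := L1.integrable_coeFn f
      have hg := L1.integrable_coeFn g
      rw [dist_eq_norm, ← VectorMeasure.integral_fun_sub (hint2 hf) (hint2 hg), ← key]
      refine VectorMeasure.norm_integral_le_integral_norm.trans ?_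
      rw [NNReal.coe_mul, mul_assoc, coe_nnnorm]
      gcongr
      rw [← integral_const_mul]
      refine integral_mono_of_nonneg (Eventually.of_forall fun _ ↦ norm_nonneg _)
        ((hf.sub hg).norm.const_mul _) (Eventually.of_forall fun x ↦ ?_)
      simp only
      rw [← sub_smul, norm_smul, mul_comm]
      gcongr
      exact (hC x).trans (Real.le_coe_toNNReal C)
  · intro f g hfg _ h
    have h1 : ∫ᵛ x, f x ∂•(μ.withDensity ν B) = ∫ᵛ x, g x ∂•(μ.withDensity ν B) :=
      VectorMeasure.integral_congr_ae
        ((Measure.absolutelyContinuous_of_le_smul hvar).ae_le hfg)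
    rw [← h1, h]
    refine VectorMeasure.integral_congr_ae ?_
    filter_upwards [hfg] with x hx
    rw [hx]

theorem lipschitzWith_bdryDist (Ω : Set (Space d)) : LipschitzWith 1 (bdryDist Ω) :=
  Metric.lipschitz_infDist_pt _

theorem continuous_bdryDist (Ω : Set (Space d)) : Continuous (bdryDist Ω) :=
  Metric.continuous_infDist_pt _

theorem isOpen_layer {Ω : Set (Space d)} (hΩ : IsOpen Ω) (t : ℝ) : IsOpen (layer Ω t) :=
  hΩ.inter (isOpen_lt (continuous_bdryDist Ω) continuous_const)

theorem norm_gradient_bdryDist_le (Ω : Set (Space d)) (x : Space d) : ‖∇ (bdryDist Ω) x‖ ≤ 1 := by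
  rw [gradient, LinearIsometryEquiv.norm_map]
  simpa using norm_fderiv_le_of_lipschitz ℝ (lipschitzWith_bdryDist Ω) (x₀ := x)

theorem measurable_gradient (f : Space d → ℝ) : Measurable (∇ f) :=
  (InnerProductSpace.toDual ℝ (Space d)).symm.continuous.measurable.comp (measurable_fderiv ℝ f)

theorem isFiniteMeasure_variation_normalDeriv (Ω : Set (Space d)) (f : Space d → ℝ) (t : ℝ) :
    IsFiniteMeasure (normalDeriv Ω f t).variation := by
  rw [← SignedMeasure.totalVariation_eq_variation]
  infer_instance

/-- Pairing the gradient measure with a field `θ ∇d` supported in the boundary layer is bounded by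
the integral of `|θ|` against the variation of the normal derivative. -/
theorem enorm_integral_innerBilin_le {Ω : Set (Space d)} (hΩ : IsOpen Ω) (f : Space d → ℝ) (t : ℝ)
    (θ : Space d → ℝ) (hθ : Integrable θ (bvGradient Ω f).variation) (Y : Space d → Space d)
    (h0 : ∀ x ∉ layer Ω t, Y x = 0) (hY : ∀ x ∈ layer Ω t, Y x = θ x • ∇ (bdryDist Ω) x) :
    ‖∫ᵛ x, Y x ∂[innerBilin d; bvGradient Ω f]‖ₑ ≤
      ∫⁻ x, ‖θ x‖ₑ ∂(normalDeriv Ω f t).variation := by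
  set μ := bvGradient Ω f
  have := isFiniteMeasure_variation μ
  have hm := (isOpen_layer hΩ t).measurableSet
  have h1 : ∫ᵛ x, Y x ∂[innerBilin d; μ] =
      ∫ᵛ x, θ x ∂•(normalDeriv Ω f t) := by
    rw [normalDeriv, integral_withDensity_eq _ _ _ (measurable_gradient _).aestronglyMeasurable
      (norm_gradient_bdryDist_le Ω) _ (VectorMeasure.Integrable.restrict hθ),
      ← VectorMeasure.setIntegral_eq_integral_of_forall_compl_eq_zero hm h0]
    exact VectorMeasure.setIntegral_congr_fun hY
  rw [h1]
  refine VectorMeasure.enorm_integral_le_lintegral_enorm_transpose.trans ?_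
  rw [VectorMeasure.variation_transpose_lsmul]

end CurvedTrace

end

noncomputable section

namespace CurvedTrace

variable {d : ℕ}

/-! ### Integration by parts for functions of bounded variation -/

theorem gradient_apply_eq_fderiv (φ : Space d → ℝ) (x : Space d) (i : Fin d) :
    (∇ φ x) i = fderiv ℝ φ x (EuclideanSpace.single i 1) := by
  have h : ⟪∇ φ x, EuclideanSpace.single i (1 : ℝ)⟫ = fderiv ℝ φ x (EuclideanSpace.single i 1) := by
    rw [gradient, InnerProductSpace.toDual_symm_apply]
  rw [← h, EuclideanSpace.inner_single_right]
  simp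

theorem inner_gradient_right_eq_fderiv {E : Type*} [NormedAddCommGroup E] [InnerProductSpace ℝ E]
    [CompleteSpace E] (φ : E → ℝ) (x v : E) : ⟪v, ∇ φ x⟫ = fderiv ℝ φ x v := by
  rw [real_inner_comm, gradient, InnerProductSpace.toDual_symm_apply]

/-- The defining identity of the gradient measure, for `C¹` vector fields. -/
theorem integral_mul_divergence {Ω : Set (Space d)} {f : Space d → ℝ} (hf : IntegrableOn f Ω)
    {μ : VectorMeasure (Space d) (Space d)} (hμ : IsBVGradient Ω f μ) {Y : Space d → Space d}
    (hY : ContDiff ℝ 1 Y) (hYc : HasCompactSupport Y) (hYΩ : tsupport Y ⊆ Ω) :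
    ∫ x in Ω, f x * ∑ i, (fderiv ℝ Y x (EuclideanSpace.single i 1)) i =
      - ∫ᵛ x, Y x ∂[innerBilin d; μ] := by
  have := isFiniteMeasure_variation μ
  have hφ : ∀ i, ContDiff ℝ 1 fun x ↦ Y x i := fun i ↦
    (EuclideanSpace.proj i : Space d →L[ℝ] ℝ).contDiff.comp hY
  have hφs : ∀ i, tsupport (fun x ↦ Y x i) ⊆ tsupport Y := fun i ↦
    closure_mono fun x hx h ↦ hx (by simp [h])
  have hφc : ∀ i, HasCompactSupport fun x ↦ Y x i := fun i ↦
    hYc.of_isClosed_subset (isClosed_tsupport _) (hφs i)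
  have hfd : ∀ i x, fderiv ℝ (fun x ↦ Y x i) x (EuclideanSpace.single i 1) =
      (fderiv ℝ Y x (EuclideanSpace.single i 1)) i := by
    intro i x
    have h := ((EuclideanSpace.proj i : Space d →L[ℝ] ℝ).hasFDerivAt.comp x
      (hY.differentiable one_ne_zero x).hasFDerivAt).fderiv
    have h' : fderiv ℝ (fun x ↦ Y x i) x =
      (EuclideanSpace.proj i : Space d →L[ℝ] ℝ) ∘L fderiv ℝ Y x := h
    rw [h']; rfl
  have hgi : ∀ i, IntegrableOn (fun x ↦ f x • ∇ (fun x ↦ Y x i) x) Ω := by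
    intro i
    have hc : Continuous (∇ (fun x ↦ Y x i)) :=
      (InnerProductSpace.toDual ℝ (Space d)).symm.continuous.comp
        ((hφ i).continuous_fderiv one_ne_zero)
    have hcs : HasCompactSupport (∇ (fun x ↦ Y x i)) :=
      ((hφc i).fderiv (𝕜 := ℝ)).comp_left (map_zero _)
    obtain ⟨C, hC⟩ := hcs.exists_bound_of_continuous hc
    exact hf.smul_bdd C hc.aestronglyMeasurable (Eventually.of_forall hC)
  have hYi : ∀ i, Integrable (fun x ↦ Y x i) μ.variation := fun i ↦
    (hφ i).continuous.integrable_of_hasCompactSupport (hφc i)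
  -- the `i`-th coordinate of the defining identity tested with `Y i`
  have h1 : ∀ i, ∫ x in Ω, f x * (fderiv ℝ Y x (EuclideanSpace.single i 1)) i =
      - ∫ᵛ x, Y x i • EuclideanSpace.single i (1 : ℝ) ∂[innerBilin d; μ] := by
    intro i
    have h := congrArg (EuclideanSpace.proj i : Space d →L[ℝ] ℝ)
      (hμ _ (hφ i) (hφc i) ((hφs i).trans hYΩ))
    rw [← ContinuousLinearMap.integral_comp_comm _ (hgi i), map_neg,
      VectorMeasure.continuousLinearMap_apply_integral (hYi i)] at h
    have h2 : ∫ᵛ x, Y x i • EuclideanSpace.single i (1 : ℝ) ∂[innerBilin d; μ] =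
        ∫ᵛ x, Y x i ∂[innerBilin d ∘L
          ContinuousLinearMap.toSpanSingleton ℝ (EuclideanSpace.single i (1 : ℝ)); μ] := by
      rw [← VectorMeasure.integral_continuousLinearMap_comp (hYi i)]
      rfl
    have h3 : innerBilin d ∘L
          ContinuousLinearMap.toSpanSingleton ℝ (EuclideanSpace.single i (1 : ℝ)) =
        (ContinuousLinearMap.compL ℝ (Space d) (Space d) ℝ) (EuclideanSpace.proj i) ∘L
          ContinuousLinearMap.lsmul ℝ ℝ := by
      refine ContinuousLinearMap.ext fun r ↦ ContinuousLinearMap.ext fun v ↦ ?_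
      change ⟪r • EuclideanSpace.single i (1 : ℝ), v⟫ = r * v i
      rw [real_inner_smul_left, EuclideanSpace.inner_single_left]
      simp
    rw [h2, h3]
    refine Eq.trans (integral_congr_ae (Eventually.of_forall fun x ↦ ?_)) h
    change _ = f x * (∇ (fun x ↦ Y x i) x) i
    rw [gradient_apply_eq_fderiv, hfd]
  have hsum : (fun x ↦ Y x) = fun x ↦ ∑ i, Y x i • EuclideanSpace.single i (1 : ℝ) := by
    ext x j; simp [Pi.single_apply]
  conv_rhs => rw [hsum]
  rw [VectorMeasure.integral_finsetSum, ← Finset.sum_neg_distrib]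
  · simp_rw [Finset.mul_sum]
    rw [integral_finsetSum]
    · exact Finset.sum_congr rfl fun i _ ↦ h1 i
    · intro i _
      have := ContinuousLinearMap.integrable_comp (EuclideanSpace.proj i : Space d →L[ℝ] ℝ) (hgi i)
      refine this.congr (Eventually.of_forall fun x ↦ ?_)
      change f x * (∇ (fun x ↦ Y x i) x) i = _
      rw [gradient_apply_eq_fderiv, hfd]
  · exact fun i _ ↦ (hYi i).smul_const _

/-- A radial mollification of a field with weak divergence `b` has divergence the mollified `b`. -/
theorem divergence_convolution (ρ : ContDiffBump (0 : Space d)) {Y : Space d → Space d}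
    {b : Space d → ℝ} (hY : Continuous Y)
    (hdiv : ∀ ζ : Space d → ℝ, ContDiff ℝ 1 ζ → HasCompactSupport ζ →
      ∫ x, ⟪Y x, ∇ ζ x⟫ = - ∫ x, b x * ζ x) (x : Space d) :
    ∑ i, (fderiv ℝ (convolution (ρ.normed volume) Y (ContinuousLinearMap.lsmul ℝ ℝ) volume) x
      (EuclideanSpace.single i 1)) i =
    convolution (ρ.normed volume) b (ContinuousLinearMap.lsmul ℝ ℝ) volume x := by
  set r : Space d → ℝ := ρ.normed volume with hr
  have hr1 : ContDiff ℝ 1 r := ρ.contDiff_normed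
  have hrc : HasCompactSupport r := ρ.hasCompactSupport_normed
  have hfd := (hrc.hasFDerivAt_convolution_left (ContinuousLinearMap.lsmul ℝ ℝ (E := Space d))
    (μ := volume) hr1 hY.locallyIntegrable x).fderiv
  have hcc : Continuous fun z ↦ fderiv ℝ r z := hr1.continuous_fderiv one_ne_zero
  have hexi : Integrable (fun t ↦ (ContinuousLinearMap.precompL (Space d)
      (ContinuousLinearMap.lsmul ℝ ℝ (E := Space d))) (fderiv ℝ r t) (Y (x - t))) := by
    refine Continuous.integrable_of_hasCompactSupport ?_ ?_
    · exact ((ContinuousLinearMap.precompL (Space d)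
        (ContinuousLinearMap.lsmul ℝ ℝ (E := Space d))).continuous.comp hcc).clm_apply
          (hY.comp (continuous_const.sub continuous_id))
    · refine (hrc.fderiv (𝕜 := ℝ)).mono fun t ht h ↦ ht ?_
      simp [h]
  have h1 : ∀ i, (fderiv ℝ (convolution r Y (ContinuousLinearMap.lsmul ℝ ℝ) volume) x
      (EuclideanSpace.single i 1)) i =
      ∫ t, fderiv ℝ r t (EuclideanSpace.single i 1) * Y (x - t) i := by
    intro i
    rw [hfd, convolution_def, ContinuousLinearMap.integral_apply hexi]
    have h2 := (EuclideanSpace.proj i : Space d →L[ℝ] ℝ).integral_comp_comm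
      (hexi.apply_continuousLinearMap (EuclideanSpace.single i (1 : ℝ)))
    refine h2.symm.trans (integral_congr_ae (Eventually.of_forall fun t ↦ ?_))
    simp [ContinuousLinearMap.precompL_apply]
  have hint : ∀ i, Integrable fun t ↦ fderiv ℝ r t (EuclideanSpace.single i 1) * Y (x - t) i := by
    intro i
    refine Continuous.integrable_of_hasCompactSupport ?_ ?_
    · exact (hcc.clm_apply continuous_const).mul ((EuclideanSpace.proj i).continuous.comp
        (hY.comp (continuous_const.sub continuous_id)))
    · refine (hrc.fderiv (𝕜 := ℝ)).mono fun t ht h ↦ ht ?_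
      simp [h]
  simp_rw [h1]
  rw [← integral_finsetSum _ fun i _ ↦ hint i]
  have h3 : ∀ t, ∑ i, fderiv ℝ r t (EuclideanSpace.single i 1) * Y (x - t) i =
      fderiv ℝ r t (Y (x - t)) := by
    intro t
    conv_rhs => rw [show Y (x - t) = ∑ i, Y (x - t) i • EuclideanSpace.single i (1 : ℝ) by
      ext j; simp [Pi.single_apply]]
    simp [mul_comm]
  simp_rw [h3]
  -- the weak divergence is tested with the reflected translate of the mollifier
  set ζ : Space d → ℝ := fun z ↦ r (x - z) with hζ
  have hζ1 : ContDiff ℝ 1 ζ := hr1.comp (contDiff_const.sub contDiff_id)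
  have hζc : HasCompactSupport ζ := hrc.comp_homeomorph (Homeomorph.subLeft x)
  have h4 := hdiv ζ hζ1 hζc
  have h5 : ∀ z, ⟪Y z, ∇ ζ z⟫ = - fderiv ℝ r (x - z) (Y z) := by
    intro z
    rw [inner_gradient_right_eq_fderiv]
    have : HasFDerivAt ζ (fderiv ℝ r (x - z) ∘L (-ContinuousLinearMap.id ℝ (Space d))) z :=
      ((hr1.differentiable one_ne_zero (x - z)).hasFDerivAt).comp z
        ((hasFDerivAt_id z).const_sub x)
    rw [this.fderiv]; simp
  simp_rw [h5, integral_neg, neg_inj] at h4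
  have h6 := integral_sub_left_eq_self (fun z ↦ fderiv ℝ r (x - z) (Y z)) volume x
  simp only [sub_sub_cancel] at h6
  rw [h6, h4, convolution_lsmul_swap]
  simp [hζ, mul_comm]

/-- For `f ∈ BV(Ω)` the integration by parts formula holds for continuous compactly supported
fields whose distributional divergence is a continuous function; it follows from the smooth case by
mollifying the field. -/
theorem integral_mul_weakDivergence {Ω : Set (Space d)} (hΩ : IsOpen Ω) {f : Space d → ℝ}
    (hf : IntegrableOn f Ω) {μ : VectorMeasure (Space d) (Space d)} (hμ : IsBVGradient Ω f μ)
    {Y : Space d → Space d} {b : Space d → ℝ} (hY : Continuous Y) (hYc : HasCompactSupport Y)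
    (hYΩ : tsupport Y ⊆ Ω) (hb : Continuous b) (hbc : HasCompactSupport b)
    (hdiv : ∀ ζ : Space d → ℝ, ContDiff ℝ 1 ζ → HasCompactSupport ζ →
      ∫ x, ⟪Y x, ∇ ζ x⟫ = - ∫ x, b x * ζ x) :
    ∫ x in Ω, f x * b x = - ∫ᵛ x, Y x ∂[innerBilin d; μ] := by
  have := isFiniteMeasure_variation μ
  let ρ : ℕ → ContDiffBump (0 : Space d) := fun k ↦
    ⟨1 / ((k : ℝ) + 1) / 2, 1 / ((k : ℝ) + 1), by positivity, by
      have : (0 : ℝ) < 1 / ((k : ℝ) + 1) := by positivity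
      linarith⟩
  have hρ : Tendsto (fun k ↦ (ρ k).rOut) atTop (𝓝 0) := tendsto_one_div_add_atTop_nhds_zero_nat
  let Yk : ℕ → Space d → Space d := fun k ↦
    convolution ((ρ k).normed volume) Y (ContinuousLinearMap.lsmul ℝ ℝ) volume
  let bk : ℕ → Space d → ℝ := fun k ↦
    convolution ((ρ k).normed volume) b (ContinuousLinearMap.lsmul ℝ ℝ) volume
  have hYk : ∀ k, ContDiff ℝ 1 (Yk k) := fun k ↦
    (ρ k).hasCompactSupport_normed.contDiff_convolution_left _ (ρ k).contDiff_normed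
      hY.locallyIntegrable
  obtain ⟨δ, hδ, hδΩ⟩ := hYc.isCompact.exists_cthickening_subset_open hΩ hYΩ
  have hsupp : ∀ᶠ k in atTop, tsupport (Yk k) ⊆ Metric.cthickening δ (tsupport Y) := by
    filter_upwards [hρ.eventually (gt_mem_nhds hδ)] with k hk
    refine closure_minimal ?_ Metric.isClosed_cthickening
    refine (support_convolution_subset _).trans ?_
    rintro _ ⟨a, ha, c, hc, rfl⟩
    rw [(ρ k).support_normed_eq] at ha
    refine Metric.mem_cthickening_of_dist_le _ c _ _ (subset_tsupport _ hc) ?_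
    rw [mem_ball_zero_iff] at ha
    simpa [dist_eq_norm] using (ha.trans hk).le
  have hmain : ∀ᶠ k in atTop, ∫ x in Ω, f x * bk k x = - ∫ᵛ x, Yk k x ∂[innerBilin d; μ] := by
    filter_upwards [hsupp] with k hk
    rw [← integral_mul_divergence hf hμ (hYk k)
      (hYc.isCompact.cthickening.of_isClosed_subset (isClosed_tsupport _) hk) (hk.trans hδΩ)]
    simp_rw [Yk, divergence_convolution (ρ k) hY hdiv]
    rfl
  obtain ⟨C, hC⟩ := hYc.exists_bound_of_continuous hY
  obtain ⟨D, hD⟩ := hbc.exists_bound_of_continuous hb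
  -- mollification at most triples a uniform bound
  have hbd : ∀ {E : Type} [NormedAddCommGroup E] [NormedSpace ℝ E] [CompleteSpace E]
      {g : Space d → E} (hg : Continuous g)
      {C : ℝ} (hC : ∀ x, ‖g x‖ ≤ C) (k : ℕ) (x : Space d),
      ‖convolution ((ρ k).normed volume) g (ContinuousLinearMap.lsmul ℝ ℝ) volume x‖ ≤ 3 * C := by
    intro E _ _ _ g hg C hC k x
    have h1 := (ρ k).dist_normed_convolution_le (μ := volume) (x₀ := x) (g := g) (ε := 2 * C)
      hg.aestronglyMeasurable fun y _ ↦ by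
        rw [dist_eq_norm]
        exact (norm_sub_le _ _).trans (by linarith [hC y, hC x])
    rw [dist_eq_norm] at h1
    have h2 := norm_add_le (convolution ((ρ k).normed volume) g
      (ContinuousLinearMap.lsmul ℝ ℝ) volume x - g x) (g x)
    rw [sub_add_cancel] at h2
    linarith [hC x]
  have hl1 : Tendsto (fun k ↦ ∫ x in Ω, f x * bk k x) atTop (𝓝 (∫ x in Ω, f x * b x)) := by
    refine tendsto_integral_of_dominated_convergence (fun x ↦ ‖f x‖ * (3 * D)) (fun k ↦ ?_)
      (hf.norm.mul_const _) (fun k ↦ ?_) ?_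
    · refine hf.aestronglyMeasurable.mul (Continuous.aestronglyMeasurable ?_)
      exact (ρ k).hasCompactSupport_normed.continuous_convolution_left _ (ρ k).continuous_normed
        hb.locallyIntegrable
    · refine Eventually.of_forall fun x ↦ ?_
      rw [norm_mul]
      gcongr
      exact hbd hb hD k x
    · exact Eventually.of_forall fun x ↦
        (ContDiffBump.convolution_tendsto_right_of_continuous hρ hb x).const_mul _
  have hl2 : Tendsto (fun k ↦ ∫ᵛ x, Yk k x ∂[innerBilin d; μ]) atTop
      (𝓝 (∫ᵛ x, Y x ∂[innerBilin d; μ])) := by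
    refine VectorMeasure.tendsto_integral_filter_of_norm_le_const
      (Eventually.of_forall fun k ↦ (hYk k).continuous.aestronglyMeasurable)
      ⟨3 * C, Eventually.of_forall fun k ↦ Eventually.of_forall fun x ↦ hbd hY hC k x⟩
      (Eventually.of_forall fun x ↦
        ContDiffBump.convolution_tendsto_right_of_continuous hρ hY x)
  exact tendsto_nhds_unique (hl1.congr' hmain) hl2.neg

end CurvedTrace

end

noncomputable section

namespace CurvedTrace

/-! ### Duality between integrable densities and test functions -/

theorem enorm_le_one_of_norm_le {E : Type*} [SeminormedAddCommGroup E] {x : E} (h : ‖x‖ ≤ 1) :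
    ‖x‖ₑ ≤ 1 := by
  rw [← ofReal_norm]; exact ENNReal.ofReal_le_one.2 h

/-- If a density `G` is dominated by a finite measure `ν` when tested against continuous functions
supported in an open set `O`, then `|G|` is dominated by `ν` as a measure on `O`: the sign of `G` on a
compact set is approximated in `L¹` by test functions. -/
theorem lintegral_enorm_le_of_forall_test {X : Type*} [MetricSpace X] [LocallyCompactSpace X]
    [SecondCountableTopology X] [MeasurableSpace X] [BorelSpace X] {l ν : Measure X}
    [IsFiniteMeasure ν] {G : X → ℝ} (hG : Integrable G l) {O : Set X} (hO : IsOpen O)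
    (h : ∀ ψ : X → ℝ, Continuous ψ → HasCompactSupport ψ → tsupport ψ ⊆ O →
      ‖∫ x, G x * ψ x ∂l‖ₑ ≤ ∫⁻ x, ‖ψ x‖ₑ ∂ν) {A : Set X} (hA : MeasurableSet A) (hAO : A ⊆ O) :
    ∫⁻ x in A, ‖G x‖ₑ ∂l ≤ ν A := by
  have hfinG : IsFiniteMeasure (l.withDensity fun x ↦ ‖G x‖ₑ) :=
    isFiniteMeasure_withDensity hG.2.ne
  set ρ : Measure X := (l.withDensity fun x ↦ ‖G x‖ₑ) + ν with hρ
  rw [← withDensity_apply _ hA, hA.measure_eq_iSup_isCompact_of_ne_top (measure_ne_top _ _)]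
  refine iSup_le fun K ↦ iSup_le fun hKA ↦ iSup_le fun hK ↦ ?_
  refine le_trans ?_ (measure_mono hKA)
  rw [withDensity_apply _ hK.measurableSet]
  obtain ⟨κ, hκ1, hκc, hκO, hκ01⟩ : ∃ κ : X → ℝ, EqOn κ 1 K ∧ HasCompactSupport κ ∧
      tsupport κ ⊆ O ∧ (Continuous κ ∧ ∀ x, κ x ∈ Icc (0 : ℝ) 1) := by
    obtain ⟨f, hf1, hfc, hfO, hf⟩ :=
      exists_continuousMap_one_of_isCompact_subset_isOpen hK hO (hKA.trans hAO)
    exact ⟨f, hf1, hfc, hfO, f.continuous, hf⟩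
  obtain ⟨hκcont, hκ01⟩ := hκ01
  have hGm := hG.aestronglyMeasurable
  -- the sign of `G` on `K`, approximated by `ψ` in `L¹(|G| l + ν)`; the cutoff `κ` keeps the support
  -- of the test function `κ ψ` inside `O`
  set G' := hGm.mk G with hG'
  have hG'm : Measurable G' := hGm.stronglyMeasurable_mk.measurable
  set S : X → ℝ := K.indicator fun x ↦ if 0 ≤ G' x then 1 else -1 with hS
  have hSm : Measurable S :=
    (Measurable.ite (measurableSet_le measurable_const hG'm) measurable_const
      measurable_const).indicator hK.measurableSet
  have hSb : ∀ x, ‖S x‖ ≤ 1 := by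
    intro x
    by_cases hx : x ∈ K
    · simp only [hS, indicator_of_mem hx]; split_ifs <;> simp
    · simp [hS, hx]
  have hSi : Integrable S ρ := Integrable.of_bound hSm.aestronglyMeasurable 1
    (Eventually.of_forall hSb)
  refine ENNReal.le_of_forall_pos_le_add fun ε hε _ ↦ ?_
  obtain ⟨ψ, hψc, hψε, hψ, -⟩ := hSi.exists_hasCompactSupport_lintegral_sub_le
    (ε := ε) (by simpa using hε.ne')
  have htest := h (fun x ↦ κ x * ψ x) (hκcont.mul hψ) hκc.mul_right
    ((tsupport_mul_subset_left (f := κ) (g := ψ)).trans hκO)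
  have hi1 : Integrable (fun x ↦ G x * (κ x * ψ x)) l := by
    obtain ⟨C, hC⟩ := (hκc.mul_right (f' := ψ)).exists_bound_of_continuous (hκcont.mul hψ)
    exact hG.mul_bdd (hκcont.mul hψ).aestronglyMeasurable (Eventually.of_forall hC)
  have hi2 : Integrable (fun x ↦ G x * S x) l :=
    hG.mul_bdd hSm.aestronglyMeasurable (Eventually.of_forall hSb)
  have hGS : ∀ᵐ x ∂l, ‖K.indicator G x‖ = G x * S x := by
    filter_upwards [hGm.ae_eq_mk] with x hx
    by_cases hxK : x ∈ K
    · simp only [hS, indicator_of_mem hxK, ← hx, hG', Real.norm_eq_abs]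
      split_ifs with h0
      · simp [abs_of_nonneg h0]
      · simp [abs_of_neg (not_le.1 h0)]
    · simp [hS, hxK]
  have hlhs : ∫⁻ x in K, ‖G x‖ₑ ∂l = ‖∫ x, G x * S x ∂l‖ₑ := by
    rw [← integral_congr_ae hGS, integral_norm_eq_lintegral_enorm
      (hGm.indicator hK.measurableSet), ← lintegral_indicator hK.measurableSet]
    rw [Real.enorm_of_nonneg ENNReal.toReal_nonneg, ENNReal.ofReal_toReal]
    · exact lintegral_congr fun x ↦ by by_cases hx : x ∈ K <;> simp [hx]
    · exact (hG.indicator hK.measurableSet).2.ne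
  have hSκ : ∀ x, κ x * S x = S x := by
    intro x
    by_cases hx : x ∈ K
    · simp [hκ1 hx]
    · simp [hS, hx]
  have hκe : ∀ x, ‖κ x‖ₑ ≤ 1 := fun x ↦ enorm_le_one_of_norm_le <| by
    rw [Real.norm_of_nonneg (hκ01 x).1]; exact (hκ01 x).2
  have h1 : ‖∫ x, G x * S x ∂l‖ₑ ≤
      ‖∫ x, G x * (κ x * ψ x) ∂l‖ₑ + ∫⁻ x, ‖S x - ψ x‖ₑ ∂(l.withDensity fun x ↦ ‖G x‖ₑ) := by
    have : ∫ x, G x * S x ∂l =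
        ∫ x, G x * (κ x * ψ x) ∂l + ∫ x, (G x * S x - G x * (κ x * ψ x)) ∂l := by
      rw [integral_sub hi2 hi1]; ring
    rw [this]
    refine (enorm_add_le _ _).trans (add_le_add le_rfl ?_)
    refine (enorm_integral_le_lintegral_enorm _).trans ?_
    rw [lintegral_withDensity_eq_lintegral_mul₀ (g := fun x ↦ ‖S x - ψ x‖ₑ) hGm.enorm
      (hSm.sub hψ.measurable).enorm.aemeasurable]
    refine lintegral_mono fun x ↦ ?_
    rw [← hSκ x, ← mul_sub, ← mul_sub, enorm_mul, enorm_mul, Pi.mul_apply]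
    simp only
    gcongr
    exact mul_le_of_le_one_left zero_le (hκe x)
  have h2 : ∫⁻ x, ‖κ x * ψ x‖ₑ ∂ν ≤ ν K + ∫⁻ x, ‖S x - ψ x‖ₑ ∂ν := by
    have h3 : ∫⁻ x, ‖S x‖ₑ ∂ν ≤ ν K := by
      rw [← lintegral_indicator_one hK.measurableSet]
      refine lintegral_mono fun x ↦ ?_
      by_cases hx : x ∈ K
      · simpa only [indicator_of_mem hx, Pi.one_apply] using enorm_le_one_of_norm_le (hSb x)
      · simp [hS, hx]
    refine le_trans ?_ (add_le_add h3 le_rfl)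
    rw [← lintegral_add_left hSm.enorm]
    refine lintegral_mono fun x ↦ ?_
    rw [enorm_mul]
    refine (mul_le_of_le_one_left zero_le (hκe x)).trans ?_
    have := enorm_sub_le (E := ℝ) (a := S x) (b := S x - ψ x)
    simpa using this
  rw [hlhs]
  refine h1.trans ((add_le_add (htest.trans h2) le_rfl).trans ?_)
  rw [add_assoc, add_comm (∫⁻ x, ‖S x - ψ x‖ₑ ∂ν), ← lintegral_add_measure]
  exact add_le_add le_rfl hψε

end CurvedTrace

end

noncomputable section

namespace CurvedTrace

set_option linter.unusedSectionVars false

/-! ### Functions on a slab with controlled vertical derivative -/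

/-- `κ` is a `C¹` step from `0` to `1` with derivative `τ`, rising between `ε/4` and `ε/2`. -/
structure IsStep (ε : ℝ) (κ τ : ℝ → ℝ) : Prop where
  pos : 0 < ε
  continuous : Continuous τ
  hasDerivAt : ∀ s, HasDerivAt κ (τ s) s
  mem_Icc : ∀ s, κ s ∈ Icc (0 : ℝ) 1
  eq_zero : ∀ s ≤ ε / 4, κ s = 0
  eq_one : ∀ s, ε / 2 ≤ s → κ s = 1

theorem IsStep.deriv_eq_zero {ε : ℝ} {κ τ : ℝ → ℝ} (h : IsStep ε κ τ) {s : ℝ}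
    (hs : s ∉ Icc (ε / 4) (ε / 2)) : τ s = 0 := by
  refine (h.hasDerivAt s).unique ?_
  rcases lt_or_ge s (ε / 4) with h1 | h1
  · refine (hasDerivAt_const s (0 : ℝ)).congr_of_eventuallyEq ?_
    filter_upwards [gt_mem_nhds h1] with u hu using h.eq_zero u hu.le
  · have h2 : ε / 2 < s := by
      by_contra h3; exact hs ⟨h1, not_lt.1 h3⟩
    refine (hasDerivAt_const s (1 : ℝ)).congr_of_eventuallyEq ?_
    filter_upwards [lt_mem_nhds h2] with u hu using h.eq_one u hu.le

theorem IsStep.exists_bound {ε : ℝ} {κ τ : ℝ → ℝ} (h : IsStep ε κ τ) : ∃ C, ∀ s, ‖τ s‖ ≤ C :=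
  (HasCompactSupport.intro isCompact_Icc fun _ hs ↦ h.deriv_eq_zero hs).exists_bound_of_continuous
    h.continuous

theorem IsStep.continuous_step {ε : ℝ} {κ τ : ℝ → ℝ} (h : IsStep ε κ τ) : Continuous κ :=
  continuous_iff_continuousAt.2 fun s ↦ (h.hasDerivAt s).continuousAt

theorem exists_isStep {ε : ℝ} (hε : 0 < ε) : ∃ κ τ : ℝ → ℝ, IsStep ε κ τ := by
  have hc : ContDiff ℝ 1 fun s ↦ Real.smoothTransition ((s - ε / 4) / (ε / 4)) :=
    Real.smoothTransition.contDiff.comp ((contDiff_id.sub contDiff_const).div_const _)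
  refine ⟨fun s ↦ Real.smoothTransition ((s - ε / 4) / (ε / 4)), _, hε,
    hc.continuous_deriv le_rfl, fun s ↦ (hc.differentiable one_ne_zero s).hasDerivAt,
    fun s ↦ ⟨Real.smoothTransition.nonneg _, Real.smoothTransition.le_one _⟩, fun s hs ↦ ?_,
    fun s hs ↦ ?_⟩
  · exact Real.smoothTransition.zero_of_nonpos
      (div_nonpos_of_nonpos_of_nonneg (by linarith) (by linarith))
  · refine Real.smoothTransition.one_of_one_le ?_
    rw [le_div_iff₀ (by linarith)]; linarith

variable {V : Type*} [NormedAddCommGroup V] [NormedSpace ℝ V] [FiniteDimensional ℝ V]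
  [MeasurableSpace V] [BorelSpace V]

/-- The distributional derivative of `F` in the last variable is, on the open set `O`, dominated by
the measure `m`. The test functions `η` need only be differentiable in that variable, with
continuous derivative `g`. -/
def VerticalDerivBound (l : Measure V) (O : Set (V × ℝ)) (F : V × ℝ → ℝ) (m : Measure (V × ℝ)) :
    Prop :=
  ∀ η g : V × ℝ → ℝ, Continuous η → Continuous g →
    (∀ w s, HasDerivAt (fun u ↦ η (w, u)) (g (w, s)) s) → HasCompactSupport η → tsupport η ⊆ O →
    ‖∫ p in O, F p * g p ∂(l.prod volume)‖ₑ ≤ ∫⁻ p in O, ‖η p‖ₑ ∂m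

variable {l : Measure V} [l.IsAddHaarMeasure] {B : Set V} {t : ℝ} {F : V × ℝ → ℝ}
  {m : Measure (V × ℝ)}

theorem compactSupport_of_eq_zero_off {X E : Type*} [TopologicalSpace X] [T2Space X] [Zero E]
    {η : X → E} {K O : Set X} (hK : IsCompact K) (hKO : K ⊆ O) (h : ∀ p ∉ K, η p = 0) :
    HasCompactSupport η ∧ tsupport η ⊆ O :=
  ⟨HasCompactSupport.intro hK h, (closure_minimal (fun p hp ↦ by
    by_contra h'; exact hp (h p h')) hK.isClosed).trans hKO⟩

/-- The average of `F (w, ·)` on `(0, t)` against the weight `τ`. -/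
def slabMean (F : V × ℝ → ℝ) (t : ℝ) (τ : ℝ → ℝ) (w : V) : ℝ := ∫ s in Ioo 0 t, F (w, s) * τ s

theorem integrable_prod_of_slab
    (hF : IntegrableOn F (B ×ˢ Ioo 0 t) (l.prod volume)) :
    Integrable F ((l.restrict B).prod (volume.restrict (Ioo 0 t))) := by
  rw [Measure.prod_restrict]; exact hF

theorem integrable_slabMean (hF : IntegrableOn F (B ×ˢ Ioo 0 t) (l.prod volume))
    {ε : ℝ} {κ τ : ℝ → ℝ} (h : IsStep ε κ τ) : IntegrableOn (slabMean F t τ) B l := by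
  obtain ⟨C, hC⟩ := h.exists_bound
  exact ((integrable_prod_of_slab hF).mul_bdd
    (h.continuous.comp continuous_snd).aestronglyMeasurable
    (Eventually.of_forall fun p ↦ hC p.2)).integral_prod_left

theorem integral_mul_slabMean (hF : IntegrableOn F (B ×ˢ Ioo 0 t) (l.prod volume))
    {ε : ℝ} {κ τ : ℝ → ℝ} (h : IsStep ε κ τ) {ψ : V → ℝ} (hψ : Continuous ψ) {D : ℝ}
    (hψb : ∀ w, ‖ψ w‖ ≤ D) :
    IntegrableOn (fun p : V × ℝ ↦ F p * (ψ p.1 * τ p.2)) (B ×ˢ Ioo 0 t) (l.prod volume) ∧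
    ∫ p in B ×ˢ Ioo 0 t, F p * (ψ p.1 * τ p.2) ∂(l.prod volume) =
      ∫ w in B, slabMean F t τ w * ψ w ∂l := by
  obtain ⟨C, hC⟩ := h.exists_bound
  have hi : IntegrableOn (fun p : V × ℝ ↦ F p * (ψ p.1 * τ p.2)) (B ×ˢ Ioo 0 t)
      (l.prod volume) := by
    refine Integrable.mul_bdd (c := D * C) hF ?_ (Eventually.of_forall fun p ↦ ?_)
    · exact ((hψ.comp continuous_fst).mul
        (h.continuous.comp continuous_snd)).aestronglyMeasurable
    · rw [norm_mul]
      exact mul_le_mul (hψb _) (hC _) (norm_nonneg _) ((norm_nonneg _).trans (hψb p.1))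
  refine ⟨hi, ?_⟩
  rw [setIntegral_prod _ hi]
  refine integral_congr_ae (Eventually.of_forall fun w ↦ ?_)
  simp only [slabMean]
  rw [← integral_mul_const]
  exact integral_congr_ae (Eventually.of_forall fun s ↦ by simp only; ring)

/-- The base measure `A ↦ m (A × (0, r))` obtained from the part of `m` lying below height `r`. -/
def baseMeasure (m : Measure (V × ℝ)) (B : Set V) (r : ℝ) : Measure V :=
  (m.restrict (B ×ˢ Ioo 0 r)).map Prod.fst

instance [IsFiniteMeasure m] (r : ℝ) : IsFiniteMeasure (baseMeasure m B r) := by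
  rw [baseMeasure]; infer_instance

theorem baseMeasure_apply {r : ℝ} {A : Set V} (hA : MeasurableSet A)
    (hAB : A ⊆ B) : baseMeasure m B r A = m (A ×ˢ Ioo 0 r) := by
  rw [baseMeasure, Measure.map_apply measurable_fst hA, Measure.restrict_apply (measurable_fst hA)]
  congr 1
  ext p
  simp only [mem_inter_iff, mem_preimage, mem_prod]
  exact ⟨fun h ↦ ⟨h.1, h.2.2⟩, fun h ↦ ⟨h.1, hAB h.1, h.2⟩⟩

/-- A function below height `r` is integrated by the base measure once it is bounded by a function
of the base point. -/
theorem setLIntegral_le_lintegral_baseMeasure (hB : MeasurableSet B) {r : ℝ} (hrt : r ≤ t)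
    {η : V × ℝ → ℝ} {Ψ : V → ℝ≥0∞} (hΨ : Measurable Ψ) (hη : ∀ p, ‖η p‖ₑ ≤ Ψ p.1)
    (h0 : ∀ p : V × ℝ, r ≤ p.2 → η p = 0) :
    ∫⁻ p in B ×ˢ Ioo 0 t, ‖η p‖ₑ ∂m ≤ ∫⁻ w, Ψ w ∂(baseMeasure m B r) := by
  have hm : MeasurableSet (B ×ˢ Ioo 0 r) := hB.prod measurableSet_Ioo
  rw [baseMeasure, lintegral_map hΨ measurable_fst, ← lintegral_indicator hm,
    ← lintegral_indicator (hB.prod measurableSet_Ioo)]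
  refine lintegral_mono fun p ↦ ?_
  by_cases hp : p ∈ B ×ˢ Ioo 0 r
  · rw [indicator_of_mem hp, indicator_of_mem (show p ∈ B ×ˢ Ioo 0 t from
      ⟨hp.1, hp.2.1, hp.2.2.trans_le hrt⟩)]
    exact hη p
  · by_cases hp' : p ∈ B ×ˢ Ioo 0 t
    · rw [indicator_of_mem hp', h0 p]
      · simp
      · by_contra h; exact hp ⟨hp'.1, hp'.2.1, not_le.1 h⟩
    · rw [indicator_of_notMem hp']; exact zero_le

/-- Means of `F` near the bottom differ in `L¹` by at most the mass of the derivative there. -/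
theorem lintegral_slabMean_sub_le [IsFiniteMeasure m] (hB : IsOpen B)
    (hF : IntegrableOn F (B ×ˢ Ioo 0 t) (l.prod volume))
    (h : VerticalDerivBound l (B ×ˢ Ioo 0 t) F m) {ε ε₁ ε₂ : ℝ} {κ₁ τ₁ κ₂ τ₂ : ℝ → ℝ}
    (h₁ : IsStep ε₁ κ₁ τ₁) (h₂ : IsStep ε₂ κ₂ τ₂) (hε₁ : ε₁ ≤ ε) (hε₂ : ε₂ ≤ ε) (hεt : ε ≤ t) :
    ∫⁻ w in B, ‖slabMean F t τ₁ w - slabMean F t τ₂ w‖ₑ ∂l ≤ m (B ×ˢ Ioo 0 ε) := by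
  have hp₁ := h₁.pos
  have hp₂ := h₂.pos
  rw [← baseMeasure_apply hB.measurableSet subset_rfl]
  have key := lintegral_enorm_le_of_forall_test (l := l.restrict B) (ν := baseMeasure m B ε)
    ((integrable_slabMean hF h₁).sub (integrable_slabMean hF h₂)) hB ?_ hB.measurableSet subset_rfl
  · rwa [Measure.restrict_restrict hB.measurableSet, inter_self] at key
  intro ψ hψ hψc hψB
  obtain ⟨D, hD⟩ := hψc.exists_bound_of_continuous hψ
  obtain ⟨i1, e1⟩ := integral_mul_slabMean hF h₁ hψ hD
  obtain ⟨i2, e2⟩ := integral_mul_slabMean hF h₂ hψ hD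
  -- `ψ (τ₁ - τ₂)` is the vertical derivative of `ψ (κ₁ - κ₂)`, which vanishes above height `ε / 2`
  set η : V × ℝ → ℝ := fun p ↦ ψ p.1 * (κ₁ p.2 - κ₂ p.2) with hη
  set g : V × ℝ → ℝ := fun p ↦ ψ p.1 * (τ₁ p.2 - τ₂ p.2) with hg
  obtain ⟨hc1, hc2⟩ := compactSupport_of_eq_zero_off (η := η) (O := B ×ˢ Ioo 0 t)
    (hψc.isCompact.prod (isCompact_Icc (a := min (ε₁ / 4) (ε₂ / 4)) (b := ε / 2)))
    (prod_mono hψB fun s hs ↦ ⟨lt_of_lt_of_le (lt_min (by linarith) (by linarith)) hs.1,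
      by linarith [hs.2]⟩) (by
    rintro ⟨w, s⟩ hp
    simp only [hη]
    by_cases hw : w ∈ tsupport ψ
    · have hs : s ∉ Icc (min (ε₁ / 4) (ε₂ / 4)) (ε / 2) := fun hs ↦ hp ⟨hw, hs⟩
      rcases lt_or_ge s (min (ε₁ / 4) (ε₂ / 4)) with h3 | h3
      · rw [h₁.eq_zero s (h3.le.trans (min_le_left _ _)),
          h₂.eq_zero s (h3.le.trans (min_le_right _ _))]; simp
      · have h4 : ε / 2 < s := by by_contra h5; exact hs ⟨h3, not_lt.1 h5⟩
        rw [h₁.eq_one s (by linarith), h₂.eq_one s (by linarith)]; simp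
    · rw [image_eq_zero_of_notMem_tsupport hw, zero_mul])
  have h3 := h η g
    ((hψ.comp continuous_fst).mul
      ((h₁.continuous_step.comp continuous_snd).sub (h₂.continuous_step.comp continuous_snd)))
    ((hψ.comp continuous_fst).mul
      ((h₁.continuous.comp continuous_snd).sub (h₂.continuous.comp continuous_snd)))
    (fun w s ↦ ((h₁.hasDerivAt s).sub (h₂.hasDerivAt s)).const_mul (ψ w)) hc1 hc2
  have e3 : ∫ w, (slabMean F t τ₁ - slabMean F t τ₂) w * ψ w ∂(l.restrict B) =
      ∫ p in B ×ˢ Ioo 0 t, F p * g p ∂(l.prod volume) := by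
    have : ∀ p : V × ℝ, F p * g p = F p * (ψ p.1 * τ₁ p.2) - F p * (ψ p.1 * τ₂ p.2) := fun p ↦ by
      simp only [hg]; ring
    simp_rw [this]
    rw [integral_sub i1 i2, e1, e2, ← integral_sub]
    · simp [sub_mul]
    · exact (integrable_slabMean hF h₁).mul_bdd hψ.aestronglyMeasurable (Eventually.of_forall hD)
    · exact (integrable_slabMean hF h₂).mul_bdd hψ.aestronglyMeasurable (Eventually.of_forall hD)
  rw [e3]
  refine h3.trans (setLIntegral_le_lintegral_baseMeasure hB.measurableSet hεt
    (hψ.enorm).measurable (fun p ↦ ?_) fun p hp ↦ ?_)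
  · simp only [hη, enorm_mul]
    refine mul_le_of_le_one_right zero_le (enorm_le_one_of_norm_le ?_)
    rw [Real.norm_eq_abs, abs_le]
    have a1 := h₁.mem_Icc p.2
    have a2 := h₂.mem_Icc p.2
    constructor <;> linarith [a1.1, a1.2, a2.1, a2.2]
  · have : 0 < ε := hp₁.trans_le hε₁
    simp only [hη]
    rw [h₁.eq_one _ (by linarith), h₂.eq_one _ (by linarith)]; simp

end CurvedTrace

end

noncomputable section

namespace CurvedTrace

set_option linter.unusedSectionVars false
variable {V : Type*} [NormedAddCommGroup V] [NormedSpace ℝ V] [FiniteDimensional ℝ V]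
  [MeasurableSpace V] [BorelSpace V]
variable {l : Measure V} [l.IsAddHaarMeasure] {B : Set V} {t : ℝ} {F : V × ℝ → ℝ}
  {m : Measure (V × ℝ)}

/-! ### The bottom trace of a function on a slab -/

theorem tendsto_measure_slab [IsFiniteMeasure m] (hB : MeasurableSet B) {e : ℕ → ℝ}
    (he : Antitone e) (he0 : Tendsto e atTop (𝓝 0)) :
    Tendsto (fun k ↦ m (B ×ˢ Ioo 0 (e k))) atTop (𝓝 0) := by
  have h := tendsto_measure_iInter_atTop (μ := m) (s := fun k ↦ B ×ˢ Ioo 0 (e k))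
    (fun k ↦ (hB.prod measurableSet_Ioo).nullMeasurableSet)
    (fun i j hij ↦ prod_mono subset_rfl (Ioo_subset_Ioo_right (he hij))) ⟨0, measure_ne_top _ _⟩
  have h0 : ⋂ k, B ×ˢ Ioo 0 (e k) = (∅ : Set (V × ℝ)) := by
    refine eq_empty_of_forall_notMem fun p hp ↦ ?_
    have hp' := mem_iInter.1 hp
    have h1 : p.2 ≤ 0 := ge_of_tendsto' he0 fun k ↦ (hp' k).2.2.le
    exact absurd (hp' 0).2.1 (not_lt.2 h1)
  rwa [h0, measure_empty] at h

/-- `T` is the bottom trace of `F` on `B × {0}`: the `L¹` limit of means of `F` over ever lower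
layers. -/
def IsSlabTrace (l : Measure V) (B : Set V) (t : ℝ) (F : V × ℝ → ℝ) (T : V → ℝ) : Prop :=
  ∃ (ε : ℕ → ℝ) (κ τ : ℕ → ℝ → ℝ), (∀ k, IsStep (ε k) (κ k) (τ k)) ∧ Tendsto ε atTop (𝓝 0) ∧
    Tendsto (fun k ↦ ∫⁻ w in B, ‖slabMean F t (τ k) w - T w‖ₑ ∂l) atTop (𝓝 0)

/-- The means over layers whose heights shrink fast enough form a Cauchy sequence in `L¹`, because
the mass of the derivative in low layers tends to zero. -/
theorem exists_isSlabTrace [IsFiniteMeasure m] (hB : IsOpen B) (ht : 0 < t)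
    (hF : IntegrableOn F (B ×ˢ Ioo 0 t) (l.prod volume))
    (h : VerticalDerivBound l (B ×ˢ Ioo 0 t) F m) :
    ∃ T : V → ℝ, Measurable T ∧ IntegrableOn T B l ∧ IsSlabTrace l B t F T := by
  set e : ℕ → ℝ := fun k ↦ t / (k + 1) with he
  have hea : Antitone e := fun i j hij ↦ by
    simp only [he]; gcongr
  have he0 : Tendsto e atTop (𝓝 0) := by
    have := tendsto_one_div_add_atTop_nhds_zero_nat (𝕜 := ℝ) |>.const_mul t
    simpa [he, div_eq_mul_inv] using this
  have hepos : ∀ k, 0 < e k := fun k ↦ by positivity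
  have het : ∀ k, e k ≤ t := fun k ↦ div_le_self ht.le (by linarith [Nat.cast_nonneg (α := ℝ) k])
  -- a subsequence along which the mass of the layers decays geometrically
  obtain ⟨φ, hφ, hφm⟩ := extraction_forall_of_eventually'
    (P := fun n k ↦ m (B ×ˢ Ioo 0 (e k)) < (2⁻¹ : ℝ≥0∞) ^ n) fun n ↦
      eventually_atTop.1 ((tendsto_measure_slab hB.measurableSet hea he0).eventually
        (gt_mem_nhds (ENNReal.pow_pos (ENNReal.inv_pos.2 (by simp)) n)))
  choose κ τ hs using fun k ↦ exists_isStep (hepos (φ k))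
  obtain ⟨T₀, hT₀, hlim⟩ := Lp.cauchy_complete_eLpNorm (p := 1) (μ := l.restrict B) le_rfl
    (f := fun k ↦ slabMean F t (τ k)) (fun k ↦ memLp_one_iff_integrable.2
      (integrable_slabMean hF (hs k))) (B := fun n ↦ (2⁻¹ : ℝ≥0∞) ^ n)
    (by rw [ENNReal.tsum_geometric]; simp) (fun N n k hn hk ↦ by
      rw [eLpNorm_one_eq_lintegral_enorm]
      exact (lintegral_slabMean_sub_le hB hF h (hs n) (hs k) (hea (hφ.monotone hn))
        (hea (hφ.monotone hk)) (het _)).trans_lt (hφm N))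
  have hmk := hT₀.1.ae_eq_mk
  refine ⟨hT₀.1.mk T₀, hT₀.1.stronglyMeasurable_mk.measurable,
    (memLp_one_iff_integrable.1 hT₀).congr hmk, _, κ, τ, hs,
    he0.comp hφ.tendsto_atTop, hlim.congr fun k ↦ ?_⟩
  rw [eLpNorm_one_eq_lintegral_enorm]
  refine lintegral_congr_ae ?_
  filter_upwards [hmk] with w hw
  rw [Pi.sub_apply, ← hw]

/-- The distance in `L¹` from `F` to its bottom trace over a layer of height `r` is at most `r` times
the mass of the vertical derivative. Testing `F` against `ξ` amounts to testing the derivative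
against a vertical primitive of `ξ`, corrected near the bottom so as to have compact support. -/
theorem lintegral_sub_trace_le [IsFiniteMeasure m] (hB : IsOpen B)
    (hF : IntegrableOn F (B ×ˢ Ioo 0 t) (l.prod volume))
    (h : VerticalDerivBound l (B ×ˢ Ioo 0 t) F m) {T : V → ℝ} (hT : IntegrableOn T B l)
    (hTr : IsSlabTrace l B t F T) {r : ℝ} (hr : 0 < r) (hrt : r ≤ t) {A : Set V}
    (hA : MeasurableSet A) (hAB : A ⊆ B) :
    ∫⁻ p in A ×ˢ Ioo 0 r, ‖F p - T p.1‖ₑ ∂(l.prod volume) ≤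
      ENNReal.ofReal r * m (A ×ˢ Ioo 0 r) := by
  obtain ⟨ε, κ, τ, hs, hε, hlim⟩ := hTr
  have hOo : IsOpen (B ×ˢ Ioo (0 : ℝ) r) := hB.prod isOpen_Ioo
  have hOt : B ×ˢ Ioo (0 : ℝ) r ⊆ B ×ˢ Ioo 0 t := prod_mono subset_rfl (Ioo_subset_Ioo_right hrt)
  have hAO : A ×ˢ Ioo (0 : ℝ) r ⊆ B ×ˢ Ioo 0 r := prod_mono hAB subset_rfl
  have hFr : IntegrableOn F (B ×ˢ Ioo 0 r) (l.prod volume) := hF.mono_set hOt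
  have hTr : IntegrableOn (fun p : V × ℝ ↦ T p.1) (B ×ˢ Ioo 0 r) (l.prod volume) := by
    rw [IntegrableOn, ← Measure.prod_restrict]
    exact hT.comp_fst _
  have key := lintegral_enorm_le_of_forall_test (l := (l.prod volume).restrict (B ×ˢ Ioo 0 r))
    (ν := (baseMeasure m B r).prod (volume.restrict (Ioo 0 r))) (G := fun p ↦ F p - T p.1)
    (hFr.sub hTr) hOo ?_ (hA.prod measurableSet_Ioo) hAO
  · rw [Measure.restrict_restrict (hA.prod measurableSet_Ioo), inter_eq_left.2 hAO,
      Measure.prod_prod, baseMeasure_apply hA hAB] at key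
    refine key.trans (le_of_eq ?_)
    rw [Measure.restrict_apply measurableSet_Ioo, inter_self, Real.volume_Ioo, sub_zero, mul_comm]
  intro ξ hξ hξc hξO
  obtain ⟨D, hD⟩ := hξc.exists_bound_of_continuous hξ
  -- the projections of the support of `ξ`
  set K₁ : Set V := Prod.fst '' tsupport ξ with hK₁
  have hK₁c : IsCompact K₁ := hξc.isCompact.image continuous_fst
  have hK₁B : K₁ ⊆ B := by rintro _ ⟨p, hp, rfl⟩; exact (hξO hp).1
  obtain ⟨a, b, ha, hb, hab⟩ : ∃ a b : ℝ, 0 < a ∧ b < r ∧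
      ∀ p : V × ℝ, ξ p ≠ 0 → a ≤ p.2 ∧ p.2 ≤ b := by
    have hK₂ : IsCompact (Prod.snd '' tsupport ξ) := hξc.isCompact.image continuous_snd
    rcases (Prod.snd '' tsupport ξ).eq_empty_or_nonempty with h0 | h0
    · refine ⟨r, 0, hr, hr, fun p hp ↦ ?_⟩
      exact absurd (mem_image_of_mem Prod.snd (subset_tsupport ξ hp)) (by rw [h0]; simp)
    · obtain ⟨p, hp, hpa⟩ := hK₂.sInf_mem h0
      obtain ⟨q, hq, hqb⟩ := hK₂.sSup_mem h0
      refine ⟨_, _, hpa ▸ (hξO hp).2.1, hqb ▸ (hξO hq).2.2, fun p hp ↦ ⟨?_, ?_⟩⟩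
      · exact csInf_le hK₂.bddBelow (mem_image_of_mem _ (subset_tsupport ξ hp))
      · exact le_csSup hK₂.bddAbove (mem_image_of_mem _ (subset_tsupport ξ hp))
  have hξ0 : ∀ w s, s < a ∨ b < s → ξ (w, s) = 0 := by
    intro w s hs
    by_contra h0
    rcases hs with h1 | h1
    · exact absurd (hab _ h0).1 (not_le.2 h1)
    · exact absurd (hab _ h0).2 (not_le.2 h1)
  have hξw : ∀ w ∉ K₁, ∀ s, ξ (w, s) = 0 := by
    intro w hw s
    by_contra h0
    exact hw ⟨(w, s), subset_tsupport ξ h0, rfl⟩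
  have hξcw : ∀ w, Continuous fun s ↦ ξ (w, s) := fun w ↦ hξ.comp (by fun_prop)
  -- the vertical primitive `P` of `ξ`, with total increment `X`
  set P : V × ℝ → ℝ := fun p ↦ ∫ u in (0 : ℝ)..p.2, ξ (p.1, u) with hP
  have hPc : Continuous P :=
    intervalIntegral.continuous_parametric_intervalIntegral_of_continuous
      (f := fun p : V × ℝ ↦ fun u ↦ ξ (p.1, u)) (by fun_prop) continuous_snd
  set X : V → ℝ := fun w ↦ P (w, r) with hX
  have hXc : Continuous X := hPc.comp (by fun_prop)
  have hP0 : ∀ w s, s < a → P (w, s) = 0 := by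
    intro w s hs
    simp only [hP]
    refine intervalIntegral.integral_zero_ae (Eventually.of_forall fun u hu ↦ ?_)
    refine hξ0 w u (Or.inl ?_)
    rcases le_total 0 s with h0 | h0
    · rw [uIoc_of_le h0] at hu; exact hu.2.trans_lt hs
    · rw [uIoc_of_ge h0] at hu; exact hu.2.trans_lt ha
  have hP1 : ∀ w s, b ≤ s → P (w, s) = X w := by
    intro w s hs
    have hadd : P (w, s) + ∫ u in s..r, ξ (w, u) = P (w, r) :=
      intervalIntegral.integral_add_adjacent_intervals ((hξcw w).intervalIntegrable _ _)
        ((hξcw w).intervalIntegrable _ _)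
    have h0 : ∫ u in s..r, ξ (w, u) = 0 := by
      refine intervalIntegral.integral_zero_ae (Eventually.of_forall fun u hu ↦ ?_)
      refine hξ0 w u (Or.inr ?_)
      rcases le_total s r with h0 | h0
      · rw [uIoc_of_le h0] at hu; exact hs.trans_lt hu.1
      · rw [uIoc_of_ge h0] at hu; exact hb.trans hu.1
    rw [h0, add_zero] at hadd
    exact hadd
  have hPw : ∀ w ∉ K₁, ∀ s, P (w, s) = 0 := by
    intro w hw s
    simp only [hP, hξw w hw, intervalIntegral.integral_zero]
  have hXb : ∀ w, ‖X w‖ ≤ D * r := by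
    intro w
    have := intervalIntegral.norm_integral_le_of_norm_le_const (a := 0) (b := r)
      (f := fun u ↦ ξ (w, u)) (C := D) fun u _ ↦ hD _
    simpa [hX, hP, abs_of_pos hr] using this
  -- the absolute vertical integral bounds all the test functions
  set M : V → ℝ≥0∞ := fun w ↦ ∫⁻ u in Ioo 0 r, ‖ξ (w, u)‖ₑ with hM
  have hMm : Measurable M :=
    (hξ.enorm.measurable).lintegral_prod_right' (ν := volume.restrict (Ioo 0 r))
  have hηM : ∀ w s (c : ℝ), c ∈ Icc (0 : ℝ) 1 → ‖P (w, s) - X w * c‖ₑ ≤ M w := by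
    intro w s c hc
    wlog hs : s ∈ Icc 0 r generalizing s
    · rcases lt_or_ge s 0 with h0 | h0
      · rw [hP0 w s (h0.trans ha), ← hP0 w 0 ha]
        exact this 0 ⟨le_rfl, hr.le⟩
      · have h1 : r < s := by by_contra h1; exact hs ⟨h0, not_lt.1 h1⟩
        rw [hP1 w s (hb.trans h1).le, ← hP1 w r hb.le]
        have := this r ⟨hr.le, le_rfl⟩
        rwa [hP1 w r hb.le] at this ⊢
    have hint : ∀ p q, IntervalIntegrable (fun u ↦ ξ (w, u)) volume p q := fun p q ↦
      (hξcw w).intervalIntegrable _ _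
    have hintn : ∀ p q, IntervalIntegrable (fun u ↦ ‖ξ (w, u)‖) volume p q := fun p q ↦
      (hξcw w).norm.intervalIntegrable _ _
    have hsplit : P (w, s) - X w * c =
        (1 - c) * (∫ u in (0 : ℝ)..s, ξ (w, u)) - c * ∫ u in s..r, ξ (w, u) := by
      have : X w = (∫ u in (0 : ℝ)..s, ξ (w, u)) + ∫ u in s..r, ξ (w, u) :=
        (intervalIntegral.integral_add_adjacent_intervals (hint _ _) (hint _ _)).symm
      rw [this]; simp only [hP]; ring
    have hbd : ‖P (w, s) - X w * c‖ ≤ ∫ u in (0 : ℝ)..r, ‖ξ (w, u)‖ := by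
      rw [hsplit, ← intervalIntegral.integral_add_adjacent_intervals (hintn 0 s) (hintn s r)]
      refine (norm_sub_le _ _).trans (add_le_add ?_ ?_)
      · rw [norm_mul, Real.norm_of_nonneg (by linarith [hc.2])]
        refine (mul_le_of_le_one_left (norm_nonneg _) (by linarith [hc.1])).trans ?_
        exact intervalIntegral.norm_integral_le_integral_norm hs.1
      · rw [norm_mul, Real.norm_of_nonneg hc.1]
        refine (mul_le_of_le_one_left (norm_nonneg _) hc.2).trans ?_
        exact intervalIntegral.norm_integral_le_integral_norm hs.2
    have hMw : M w = ENNReal.ofReal (∫ u in (0 : ℝ)..r, ‖ξ (w, u)‖) := by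
      rw [intervalIntegral.integral_of_le hr.le, integral_Ioc_eq_integral_Ioo,
        ofReal_integral_norm_eq_lintegral_enorm]
      exact ((hξcw w).integrableOn_Icc).mono_set Ioo_subset_Icc_self
    rw [hMw, ← ofReal_norm]
    exact ENNReal.ofReal_le_ofReal hbd
  have hν : ∫⁻ p, ‖ξ p‖ₑ ∂((baseMeasure m B r).prod (volume.restrict (Ioo 0 r))) =
      ∫⁻ w, M w ∂(baseMeasure m B r) := lintegral_prod _ hξ.enorm.measurable.aemeasurable
  rw [hν]
  have hFξ : IntegrableOn (fun p ↦ F p * ξ p) (B ×ˢ Ioo 0 t) (l.prod volume) :=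
    hF.mul_bdd hξ.aestronglyMeasurable (Eventually.of_forall hD)
  have hstep : ∀ᶠ k in atTop, ‖(∫ p in B ×ˢ Ioo 0 t, F p * ξ p ∂(l.prod volume)) -
      ∫ w in B, slabMean F t (τ k) w * X w ∂l‖ₑ ≤ ∫⁻ w, M w ∂(baseMeasure m B r) := by
    filter_upwards [hε.eventually (gt_mem_nhds hr)] with k hk
    have hp := (hs k).pos
    obtain ⟨i1, e1⟩ := integral_mul_slabMean hF (hs k) hXc hXb
    -- subtracting `X κ` makes the primitive vanish near the top of the slab
    set η : V × ℝ → ℝ := fun p ↦ P p - X p.1 * κ k p.2 with hη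
    set g : V × ℝ → ℝ := fun p ↦ ξ p - X p.1 * τ k p.2 with hg
    have hη0 : ∀ w s, max b (ε k / 2) ≤ s → η (w, s) = 0 := by
      intro w s hsb
      simp only [hη]
      rw [hP1 w s (le_of_max_le_left hsb), (hs k).eq_one s (le_of_max_le_right hsb)]; ring
    obtain ⟨hc1, hc2⟩ := compactSupport_of_eq_zero_off (η := η) (O := B ×ˢ Ioo 0 t)
      (hK₁c.prod (isCompact_Icc (a := min a (ε k / 4)) (b := max b (ε k / 2))))
      (prod_mono hK₁B fun s hs ↦ ⟨(lt_min ha (by linarith)).trans_le hs.1,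
        hs.2.trans_lt ((max_lt hb (by linarith)).trans_le hrt)⟩) (by
      rintro ⟨w, s⟩ hp
      by_cases hw : w ∈ K₁
      · have hs' : s ∉ Icc (min a (ε k / 4)) (max b (ε k / 2)) := fun hs ↦ hp ⟨hw, hs⟩
        rcases lt_or_ge s (min a (ε k / 4)) with h3 | h3
        · simp only [hη]
          rw [hP0 w s (h3.trans_le (min_le_left _ _)),
            (hs k).eq_zero s (h3.le.trans (min_le_right _ _))]; simp
        · exact hη0 w s (le_of_lt (by by_contra h5; exact hs' ⟨h3, not_lt.1 h5⟩))
      · simp only [hη, hX]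
        rw [hPw w hw, hPw w hw]; simp)
    have h3 := h η g (hPc.sub ((hXc.comp continuous_fst).mul
        ((hs k).continuous_step.comp continuous_snd)))
      (hξ.sub ((hXc.comp continuous_fst).mul ((hs k).continuous.comp continuous_snd)))
      (fun w s ↦ (intervalIntegral.integral_hasDerivAt_right ((hξcw w).intervalIntegrable _ _)
        ((hξcw w).stronglyMeasurableAtFilter _ _) (hξcw w).continuousAt).sub
          (((hs k).hasDerivAt s).const_mul (X w))) hc1 hc2
    have e3 : (∫ p in B ×ˢ Ioo 0 t, F p * ξ p ∂(l.prod volume)) -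
        ∫ w in B, slabMean F t (τ k) w * X w ∂l =
        ∫ p in B ×ˢ Ioo 0 t, F p * g p ∂(l.prod volume) := by
      rw [← e1, ← integral_sub hFξ i1]
      exact integral_congr_ae (Eventually.of_forall fun p ↦ by simp only [hg]; ring)
    rw [e3]
    refine h3.trans (setLIntegral_le_lintegral_baseMeasure hB.measurableSet hrt hMm
      (fun p ↦ hηM p.1 p.2 _ ((hs k).mem_Icc _)) fun p hp ↦ ?_)
    exact hη0 p.1 p.2 (max_le (hb.le.trans hp) (by linarith))
  have hlim2 : Tendsto (fun k ↦ ∫ w in B, slabMean F t (τ k) w * X w ∂l) atTop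
      (𝓝 (∫ w in B, T w * X w ∂l)) := by
    refine tendsto_integral_of_L1 _ (hT.mul_bdd hXc.aestronglyMeasurable
      (Eventually.of_forall hXb)).aestronglyMeasurable (Eventually.of_forall fun k ↦
        (integrable_slabMean hF (hs k)).mul_bdd hXc.aestronglyMeasurable
          (Eventually.of_forall hXb)) ?_
    have h5 := ENNReal.Tendsto.mul_const (b := ENNReal.ofReal (D * r)) hlim (Or.inr (by simp))
    rw [zero_mul] at h5
    refine tendsto_of_tendsto_of_tendsto_of_le_of_le tendsto_const_nhds h5 (fun _ ↦ zero_le)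
      fun k ↦ ?_
    rw [← lintegral_mul_const' _ _ (by simp)]
    refine lintegral_mono fun w ↦ ?_
    rw [← sub_mul, enorm_mul]
    gcongr
    rw [← ofReal_norm]
    exact ENNReal.ofReal_le_ofReal (hXb w)
  have hfinal : ∫ p in B ×ˢ Ioo 0 r, (F p - T p.1) * ξ p ∂(l.prod volume) =
      (∫ p in B ×ˢ Ioo 0 t, F p * ξ p ∂(l.prod volume)) - ∫ w in B, T w * X w ∂l := by
    have hTξ : IntegrableOn (fun p ↦ T p.1 * ξ p) (B ×ˢ Ioo 0 r) (l.prod volume) :=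
      hTr.mul_bdd hξ.aestronglyMeasurable (Eventually.of_forall hD)
    have e1 : ∫ p in B ×ˢ Ioo 0 r, T p.1 * ξ p ∂(l.prod volume) = ∫ w in B, T w * X w ∂l := by
      rw [setIntegral_prod _ hTξ]
      refine integral_congr_ae (Eventually.of_forall fun w ↦ ?_)
      simp only
      rw [integral_const_mul]
      simp only [hX, hP]
      rw [intervalIntegral.integral_of_le hr.le, integral_Ioc_eq_integral_Ioo]
    have e2 : ∫ p in B ×ˢ Ioo 0 t, F p * ξ p ∂(l.prod volume) =
        ∫ p in B ×ˢ Ioo 0 r, F p * ξ p ∂(l.prod volume) := by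
      refine (setIntegral_eq_of_subset_of_forall_sdiff_eq_zero
        (hB.measurableSet.prod measurableSet_Ioo) hOt fun p hp ↦ ?_)
      rw [show ξ p = 0 from image_eq_zero_of_notMem_tsupport fun h' ↦ hp.2 (hξO h'), mul_zero]
    rw [e2, ← e1, ← integral_sub (hFξ.mono_set hOt) hTξ]
    exact integral_congr_ae (Eventually.of_forall fun p ↦ by simp only; ring)
  rw [hfinal]
  exact le_of_tendsto ((tendsto_const_nhds.sub hlim2).enorm) hstep

/-- At almost every point the mass of `m` in small cylinders resting on the base is negligible with
respect to the measure of their bases. -/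
theorem ae_tendsto_cylinder_mass [IsFiniteMeasure m] (hB : IsOpen B) (ht : 0 < t) :
    ∀ᵐ w ∂l, Tendsto (fun r ↦ baseMeasure m B r (Metric.closedBall w r) / l (Metric.closedBall w r))
      (𝓝[>] 0) (𝓝 0) := by
  set e : ℕ → ℝ := fun k ↦ t / (k + 1) with he
  have hea : Antitone e := fun i j hij ↦ by
    simp only [he]; gcongr
  have he0 : Tendsto e atTop (𝓝 0) := by
    have := tendsto_one_div_add_atTop_nhds_zero_nat (𝕜 := ℝ) |>.const_mul t
    simpa [he, div_eq_mul_inv] using this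
  have hepos : ∀ k, 0 < e k := fun k ↦ by positivity
  -- the densities `D k` of the absolutely continuous parts decrease to zero almost everywhere
  set D : ℕ → V → ℝ≥0∞ := fun k ↦ (baseMeasure m B (e k)).rnDeriv l with hD
  have hD0 : ∀ᵐ w ∂l, ⨅ k, D k w = 0 := by
    have hm : Measurable fun w ↦ ⨅ k, D k w := Measurable.iInf fun k ↦ Measure.measurable_rnDeriv _ _
    have h0 : ∫⁻ w, ⨅ k, D k w ∂l = 0 := by
      refine le_antisymm (ge_of_tendsto' (tendsto_measure_slab (m := m) hB.measurableSet hea he0)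
        fun k ↦ ?_) zero_le
      calc ∫⁻ w, ⨅ k, D k w ∂l ≤ ∫⁻ w, D k w ∂l := lintegral_mono fun w ↦ iInf_le _ k
        _ ≤ baseMeasure m B (e k) univ := Measure.lintegral_rnDeriv_le
        _ = m (B ×ˢ Ioo 0 (e k)) := by
          rw [baseMeasure, Measure.map_apply measurable_fst MeasurableSet.univ]; simp
    exact (lintegral_eq_zero_iff hm).1 h0
  have hr : ∀ᵐ w ∂l, ∀ k, Tendsto (fun r ↦ baseMeasure m B (e k) (Metric.closedBall w r) /
      l (Metric.closedBall w r)) (𝓝[>] 0) (𝓝 (D k w)) :=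
    ae_all_iff.2 fun k ↦ Besicovitch.ae_tendsto_rnDeriv _ _
  filter_upwards [hD0, hr] with w hw0 hw
  rw [ENNReal.tendsto_nhds_zero]
  intro δ hδ
  obtain ⟨k, hk⟩ := iInf_lt_iff.1 (hw0.trans_lt hδ)
  filter_upwards [(hw k).eventually (gt_mem_nhds hk), Ioo_mem_nhdsGT (hepos k)] with r hr1 hr2
  refine le_trans ?_ hr1.le
  gcongr ?_ / _
  have : baseMeasure m B r ≤ baseMeasure m B (e k) :=
    Measure.map_mono (Measure.restrict_mono
      (prod_mono subset_rfl (Ioo_subset_Ioo_right hr2.2.le)) le_rfl) measurable_fst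
  exact this _

/-- The bottom trace is attained in the sense of Lebesgue points, over cylinders resting on the
base. -/
theorem ae_tendsto_average_sub_trace [IsFiniteMeasure m] (hB : IsOpen B) (ht : 0 < t)
    (hF : IntegrableOn F (B ×ˢ Ioo 0 t) (l.prod volume))
    (h : VerticalDerivBound l (B ×ˢ Ioo 0 t) F m) {T : V → ℝ} (hTm : Measurable T)
    (hT : IntegrableOn T B l) (hTr : IsSlabTrace l B t F T) :
    ∀ᵐ w ∂l, w ∈ B → Tendsto (fun r ↦ (∫⁻ p in Metric.closedBall w r ×ˢ Ioo 0 r,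
      ‖F p - T w‖ₑ ∂(l.prod volume)) / (ENNReal.ofReal r * l (Metric.closedBall w r)))
      (𝓝[>] 0) (𝓝 0) := by
  have hTi : LocallyIntegrable (B.indicator T) l :=
    (hT.integrable_indicator hB.measurableSet).locallyIntegrable
  filter_upwards [ae_tendsto_cylinder_mass (l := l) (m := m) hB ht,
    (Besicovitch.vitaliFamily l).ae_tendsto_lintegral_enorm_sub_div hTi] with w h1 h2 hw
  have h2' := h2.comp (Besicovitch.tendsto_filterAt l w)
  have h3 := h1.add h2'
  rw [add_zero] at h3
  obtain ⟨δ, hδ, hδB⟩ := Metric.nhds_basis_closedBall.mem_iff.1 (hB.mem_nhds hw)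
  refine tendsto_of_tendsto_of_tendsto_of_le_of_le' tendsto_const_nhds h3
    (Eventually.of_forall fun _ ↦ zero_le) ?_
  filter_upwards [Ioo_mem_nhdsGT (lt_min hδ ht)] with r hr
  have hr0 : 0 < r := hr.1
  have hrB : Metric.closedBall w r ⊆ B :=
    (Metric.closedBall_subset_closedBall (hr.2.le.trans (min_le_left _ _))).trans hδB
  have hCm : MeasurableSet (Metric.closedBall w r) := Metric.isClosed_closedBall.measurableSet
  have i1 := lintegral_sub_trace_le hB hF h hT hTr hr0 (hr.2.le.trans (min_le_right _ _)) hCm hrB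
  rw [← baseMeasure_apply (m := m) hCm hrB] at i1
  have i2 : ∫⁻ p in Metric.closedBall w r ×ˢ Ioo 0 r, ‖T p.1 - T w‖ₑ ∂(l.prod volume) =
      ENNReal.ofReal r * ∫⁻ y in Metric.closedBall w r, ‖B.indicator T y - B.indicator T w‖ₑ ∂l := by
    rw [← Measure.prod_restrict, lintegral_prod _ (by fun_prop)]
    simp only [lintegral_const]
    rw [lintegral_mul_const _ (by fun_prop), Measure.restrict_apply_univ, Real.volume_Ioo, sub_zero,
      mul_comm]
    congr 1
    refine setLIntegral_congr_fun hCm fun y hy ↦ ?_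
    simp only [indicator_of_mem (hrB hy), indicator_of_mem hw]
  have i3 : ∫⁻ p in Metric.closedBall w r ×ˢ Ioo 0 r, ‖F p - T w‖ₑ ∂(l.prod volume) ≤
      ENNReal.ofReal r * (baseMeasure m B r (Metric.closedBall w r) +
        ∫⁻ y in Metric.closedBall w r, ‖B.indicator T y - B.indicator T w‖ₑ ∂l) := by
    rw [mul_add, ← i2]
    refine le_trans ?_ (add_le_add i1 le_rfl)
    rw [← lintegral_add_right _ (by fun_prop)]
    refine lintegral_mono fun p ↦ ?_
    calc ‖F p - T w‖ₑ = ‖(F p - T p.1) + (T p.1 - T w)‖ₑ := by congr 1; ring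
      _ ≤ _ := enorm_add_le _ _
  refine (ENNReal.div_le_div_right i3 _).trans (le_of_eq ?_)
  rw [ENNReal.mul_div_mul_left _ _ (by simpa using hr0) (by simp), ENNReal.add_div]
  rfl

end CurvedTrace

end

noncomputable section

namespace CurvedTrace

variable {d : ℕ}

/-! ### Inward normals and local graphs -/

/-- `ν` is the inward unit normal of `Ω` at `y`: directions making an acute angle with `ν` enter `Ω`,
those making an obtuse angle leave it. -/
structure IsInwardNormal (Ω : Set (Space d)) (y ν : Space d) : Prop where
  norm_eq : ‖ν‖ = 1
  enters : ∀ v, 0 < ⟪v, ν⟫ → ∀ᶠ ε in 𝓝[>] (0 : ℝ), y + ε • v ∈ Ω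
  leaves : ∀ v, ⟪v, ν⟫ < 0 → ∀ᶠ ε in 𝓝[>] (0 : ℝ), y + ε • v ∉ Ω

theorem IsInwardNormal.eq_of_enters {Ω : Set (Space d)} {y ν ν' : Space d} (h : IsInwardNormal Ω y ν)
    (h1 : ‖ν'‖ = 1) (h' : ∀ v, 0 < ⟪v, ν'⟫ → ∀ᶠ ε in 𝓝[>] (0 : ℝ), y + ε • v ∈ Ω) : ν' = ν := by
  -- the direction `ν' - ν` would both enter and leave the set
  by_contra hne
  have hlt : ⟪ν', ν⟫ < 1 := by
    refine lt_of_le_of_ne ?_ fun h2 ↦ hne ((inner_eq_one_iff_of_norm_eq_one h1 h.norm_eq).1 h2)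
    simpa [h1, h.norm_eq] using real_inner_le_norm ν' ν
  have e1 : 0 < ⟪ν' - ν, ν'⟫ := by
    rw [inner_sub_left, real_inner_self_eq_norm_sq, h1, real_inner_comm]; linarith
  have e2 : ⟪ν' - ν, ν⟫ < 0 := by
    rw [inner_sub_left, real_inner_self_eq_norm_sq, h.norm_eq]; linarith
  obtain ⟨ε, h3, h4⟩ := ((h' _ e1).and (h.leaves _ e2)).exists
  exact h4 h3

theorem IsInwardNormal.eq {Ω : Set (Space d)} {y ν ν' : Space d} (h : IsInwardNormal Ω y ν)
    (h' : IsInwardNormal Ω y ν') : ν' = ν :=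
  h.eq_of_enters h'.norm_eq h'.enters

/-- The hyperplane orthogonal to `n`. -/
abbrev Hyperplane (n : Space d) : Submodule ℝ (Space d) := (ℝ ∙ n)ᗮ

theorem inner_hyperplane (n : Space d) (w : Hyperplane n) : ⟪(w : Space d), n⟫ = 0 := by
  rw [real_inner_comm]
  exact Submodule.mem_orthogonal_singleton_iff_inner_right.1 w.2

/-- Orthonormal coordinates `(w, s) ↦ w + s n` with respect to a unit vector `n`. -/
def graphCoord (n : Space d) (hn : ‖n‖ = 1) : (Hyperplane n × ℝ) ≃L[ℝ] Space d :=
  ContinuousLinearEquiv.equivOfInverse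
    ((Hyperplane n).subtypeL.comp (ContinuousLinearMap.fst ℝ _ _) +
      (ContinuousLinearMap.snd ℝ _ _).smulRight n)
    (((Hyperplane n).orthogonalProjectionOnto).prod (innerSL ℝ n))
    (fun p ↦ by
      refine Prod.ext ?_ ?_
      · have : (Hyperplane n).orthogonalProjectionOnto n = 0 := by
          rw [Submodule.orthogonalProjectionOnto_eq_zero_iff]
          exact Submodule.le_orthogonal_orthogonal _ (Submodule.mem_span_singleton_self n)
        simp [this]
      · have := inner_hyperplane n p.1
        rw [real_inner_comm] at this
        simp [inner_add_right, this, inner_smul_right, hn])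
    (fun x ↦ by
      have h := Submodule.starProjection_add_starProjection_orthogonal (K := ℝ ∙ n) x
      rw [Submodule.starProjection_unit_singleton ℝ hn, add_comm] at h
      simpa using h)

@[simp] theorem graphCoord_apply (n : Space d) (hn : ‖n‖ = 1) (p : Hyperplane n × ℝ) :
    graphCoord n hn p = p.1 + p.2 • n := rfl

@[simp] theorem graphCoord_symm_apply (n : Space d) (hn : ‖n‖ = 1) (x : Space d) :
    (graphCoord n hn).symm x = ((Hyperplane n).orthogonalProjectionOnto x, ⟪n, x⟫) := rfl

/-- The coordinates are volume preserving. -/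
theorem measurePreserving_graphCoord (n : Space d) (hn : ‖n‖ = 1) :
    MeasurePreserving (graphCoord n hn) (volume.prod volume) volume := by
  have h1 := (Submodule.measurePreserving_measurableEquivProd (ℝ ∙ n) (0 : Space d)).symm
  rw [InnerProductSpace.euclideanHausdorffMeasure_eq_volume] at h1
  have h2 : MeasurePreserving (Prod.map (LinearIsometryEquiv.toSpanUnitSingleton (𝕜 := ℝ) n hn)
      (id : Hyperplane n → Hyperplane n)) (volume.prod volume) (volume.prod volume) :=
    (LinearIsometryEquiv.measurePreserving _).prod (MeasurePreserving.id _)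
  have h3 : MeasurePreserving (Prod.swap : Hyperplane n × ℝ → ℝ × Hyperplane n)
    (volume.prod volume) (volume.prod volume) := Measure.measurePreserving_swap
  have h4 := h1.comp (h2.comp h3)
  have he : ⇑(graphCoord n hn) = ⇑((ℝ ∙ n).measurableEquivProd (0 : Space d)).symm ∘
      Prod.map (LinearIsometryEquiv.toSpanUnitSingleton (𝕜 := ℝ) n hn)
        (id : Hyperplane n → Hyperplane n) ∘ Prod.swap := by
    funext p
    simp only [Function.comp_apply, Submodule.measurableEquivProd_symm_apply, graphCoord_apply,
      Prod.map, Prod.swap, id, vadd_eq_add, add_zero, LinearIsometryEquiv.toSpanUnitSingleton_apply]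
    rw [add_comm]
  rw [he]
  exact h4

/-- Near `y` the set `Ω` is the region above the graph, over the hyperplane `n^⊥` and in direction
`n`, of a function `h` of class `C²` at `0` with `h 0 = 0` and `∇h 0 = 0`. -/
structure IsLocalGraph (Ω : Set (Space d)) (y n : Space d) (h : Hyperplane n → ℝ) : Prop where
  norm_eq : ‖n‖ = 1
  contDiffAt : ContDiffAt ℝ 2 h 0
  zero : h 0 = 0
  fderiv_zero : fderiv ℝ h 0 = 0
  mem_iff : ∀ᶠ p : Hyperplane n × ℝ in 𝓝 0, (y + (p.1 : Space d) + p.2 • n ∈ Ω ↔ h p.1 < p.2)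

/-- The eigenvalue condition on the Hessian, with the graph representation gathered into one
hypothesis. -/
theorem isPrincipalCurvatures_iff {Ω : Set (Space d)} {y : Space d} {k : Fin (d - 1) → ℝ} :
    IsPrincipalCurvatures Ω y k ↔ ∃ (n : Space d) (h : Hyperplane n → ℝ), IsLocalGraph Ω y n h ∧
      ∃ b : OrthonormalBasis (Fin (d - 1)) ℝ (Hyperplane n),
        ∀ i w, fderiv ℝ (fderiv ℝ h) 0 (b i) w = k i * inner ℝ (b i) w := by
  constructor
  · rintro ⟨n, h, h1, h2, h3, h4, h5, h6⟩
    exact ⟨n, h, ⟨h1, h2, h3, h4, h5⟩, h6⟩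
  · rintro ⟨n, h, ⟨h1, h2, h3, h4, h5⟩, h6⟩
    exact ⟨n, h, h1, h2, h3, h4, h5, h6⟩

theorem finrank_hyperplane {n : Space d} (hn : ‖n‖ = 1) :
    Module.finrank ℝ (Hyperplane n) = d - 1 := by
  have h1 := Submodule.finrank_add_finrank_orthogonal (ℝ ∙ n)
  have hn0 : n ≠ 0 := by rintro rfl; simp at hn
  rw [finrank_span_singleton hn0, finrank_euclideanSpace_fin] at h1
  change Module.finrank ℝ (Hyperplane n) = d - 1
  change 1 + Module.finrank ℝ (Hyperplane n) = d at h1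
  exact (Nat.sub_eq_of_eq_add' h1.symm).symm

/-- A uniformly `C²` set is a local graph at each boundary point, and diagonalizing the Hessian
yields its principal curvatures there. -/
theorem IsUniformlyC2.exists_isPrincipalCurvatures {Ω : Set (Space d)} (hΩ : IsUniformlyC2 Ω)
    {y : Space d} (hy : y ∈ frontier Ω) : ∃ k, IsPrincipalCurvatures Ω y k := by
  obtain ⟨-, α, β, K, hα, hβ, -, hall⟩ := hΩ
  obtain ⟨n, h, hn, hC, h0, hd, -, hmem⟩ := hall y hy
  have hCat : ContDiffAt ℝ 2 h 0 := hC.contDiffAt (Metric.ball_mem_nhds _ hα)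
  have hsym : IsSymmSndFDerivAt ℝ h 0 := hCat.isSymmSndFDerivAt (by simp)
  set A : Hyperplane n →ₗ[ℝ] Hyperplane n :=
    { toFun := fun v ↦ (InnerProductSpace.toDual ℝ (Hyperplane n)).symm (fderiv ℝ (fderiv ℝ h) 0 v)
      map_add' := fun v w ↦ by simp
      map_smul' := fun c v ↦ by simp } with hA
  have hAi : ∀ v w, ⟪A v, w⟫ = fderiv ℝ (fderiv ℝ h) 0 v w := fun v w ↦
    InnerProductSpace.toDual_symm_apply
  have hAs : A.IsSymmetric := fun v w ↦ by
    rw [real_inner_comm (A w) v, hAi, hAi, hsym.eq]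
  refine ⟨hAs.eigenvalues (finrank_hyperplane hn), isPrincipalCurvatures_iff.2 ⟨n, h,
    ⟨hn, hCat, h0, hd, ?_⟩, hAs.eigenvectorBasis (finrank_hyperplane hn), fun i w ↦ ?_⟩⟩
  · have hcont : ContinuousAt (fun p : Hyperplane n × ℝ ↦ |p.2 - h p.1|) 0 :=
      (continuousAt_snd.sub
        (ContinuousAt.comp (f := Prod.fst) hCat.continuousAt continuousAt_fst)).abs
    have h1 : ∀ᶠ p : Hyperplane n × ℝ in 𝓝 0, |p.2 - h p.1| < β :=
      hcont.eventually (gt_mem_nhds (by simpa [h0] using hβ))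
    have h2 : ∀ᶠ p : Hyperplane n × ℝ in 𝓝 0, p.1 ∈ Metric.ball (0 : Hyperplane n) α :=
      continuousAt_fst.eventually (Metric.ball_mem_nhds _ hα)
    filter_upwards [h1, h2] with p hp1 hp2
    exact (hmem _ hp2 _ hp1).1
  · rw [← hAi, hAs.apply_eigenvectorBasis, real_inner_smul_left]
    rfl

/-- The boundary near a local graph: it is the graph itself. -/
theorem IsLocalGraph.exists_radius {Ω : Set (Space d)} (hΩ : IsOpen Ω) {y n : Space d}
    {h : Hyperplane n → ℝ} (hg : IsLocalGraph Ω y n h) :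
    ∃ ρ > 0, ∃ δ > 0, ContDiffOn ℝ 2 h (Metric.ball 0 δ) ∧ (∀ w ∈ Metric.ball 0 δ, |h w| < ρ) ∧
      ∀ w ∈ Metric.ball (0 : Hyperplane n) δ, ∀ s : ℝ, |s| < ρ →
        (y + (w : Space d) + s • n ∈ Ω ↔ h w < s) ∧
        (y + (w : Space d) + s • n ∈ frontier Ω ↔ s = h w) := by
  obtain ⟨δ₀, hδ₀, hC₀⟩ : ∃ δ > 0, ContDiffOn ℝ 2 h (Metric.ball 0 δ) := by
    obtain ⟨u, hu, hCu⟩ := hg.contDiffAt.contDiffOn (m := 2) le_rfl (by simp)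
    obtain ⟨δ, hδ, hδu⟩ := Metric.mem_nhds_iff.1 (by simpa using hu : u ∈ 𝓝 0)
    exact ⟨δ, hδ, hCu.mono hδu⟩
  obtain ⟨ρ, hρ, hρm⟩ := Metric.eventually_nhds_iff_ball.1 hg.mem_iff
  have hc : ∀ᶠ w in 𝓝 (0 : Hyperplane n), |h w| < ρ :=
    hg.contDiffAt.continuousAt.abs.eventually (gt_mem_nhds (by simpa [hg.zero] using hρ))
  obtain ⟨δ₁, hδ₁, hδ₁h⟩ := Metric.eventually_nhds_iff_ball.1 hc
  refine ⟨ρ, hρ, min (min δ₀ δ₁) ρ, lt_min (lt_min hδ₀ hδ₁) hρ,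
    hC₀.mono (Metric.ball_subset_ball ((min_le_left _ _).trans (min_le_left _ _))),
    fun w hw ↦ hδ₁h w (Metric.ball_subset_ball ((min_le_left _ _).trans (min_le_right _ _)) hw),
    fun w hw s hs ↦ ?_⟩
  have hwρ : w ∈ Metric.ball (0 : Hyperplane n) ρ := Metric.ball_subset_ball (min_le_right _ _) hw
  have hw₀ : w ∈ Metric.ball (0 : Hyperplane n) δ₀ :=
    Metric.ball_subset_ball ((min_le_left _ _).trans (min_le_left _ _)) hw
  have hball : ∀ p : Hyperplane n × ℝ, p ∈ Metric.ball (0 : Hyperplane n × ℝ) ρ ↔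
      p.1 ∈ Metric.ball 0 ρ ∧ |p.2| < ρ := fun p ↦ by
    rw [mem_ball_zero_iff, Prod.norm_def, max_lt_iff, mem_ball_zero_iff, Real.norm_eq_abs]
  have hmem : ∀ w ∈ Metric.ball (0 : Hyperplane n) ρ, ∀ s : ℝ, |s| < ρ →
      (y + (w : Space d) + s • n ∈ Ω ↔ h w < s) := fun w hw s hs ↦
    hρm (w, s) ((hball _).2 ⟨hw, hs⟩)
  refine ⟨hmem w hwρ s hs, ?_⟩
  rw [frontier, hΩ.interior_eq, Set.mem_sdiff, hmem w hwρ s hs]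
  have hhom : ∀ p : Hyperplane n × ℝ, y + (p.1 : Space d) + p.2 • n =
      y + graphCoord n hg.norm_eq p := fun p ↦ by rw [graphCoord_apply, add_assoc]
  constructor
  · rintro ⟨h1, h2⟩
    refine le_antisymm (not_lt.1 h2) (not_lt.1 fun h3 ↦ ?_)
    -- below the graph there is a neighbourhood free of points of the set
    have hcw : ContinuousAt (fun p : Hyperplane n × ℝ ↦ h p.1) (w, s) :=
      ContinuousAt.comp (f := Prod.fst) (x := (w, s)) (hC₀.continuousOn.continuousAt
        (Metric.isOpen_ball.mem_nhds hw₀)) continuousAt_fst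
    have e1 : ∀ᶠ p : Hyperplane n × ℝ in 𝓝 (w, s), p.2 < h p.1 :=
      continuousAt_snd.eventually_lt hcw h3
    have e2 : ∀ᶠ p : Hyperplane n × ℝ in 𝓝 (w, s), p ∈ Metric.ball 0 ρ :=
      Metric.isOpen_ball.mem_nhds ((hball _).2 ⟨hwρ, hs⟩)
    have e3 : ∀ᶠ x in 𝓝 (y + (w : Space d) + s • n), x ∉ Ω := by
      have : ∀ᶠ p in 𝓝 (w, s), y + graphCoord n hg.norm_eq p ∉ Ω := by
        filter_upwards [e1, e2] with p hp1 hp2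
        rw [← hhom, hρm p hp2]; exact not_lt.2 hp1.le
      have hmap := ((graphCoord n hg.norm_eq).toHomeomorph.trans
        (Homeomorph.addLeft y)).map_nhds_eq (w, s)
      have h5 : ((graphCoord n hg.norm_eq).toHomeomorph.trans (Homeomorph.addLeft y)) (w, s) =
        y + (w : Space d) + s • n := (hhom (w, s)).symm
      rw [h5] at hmap
      rw [← hmap, eventually_map]
      exact this
    exact (mem_closure_iff_frequently.1 h1) e3
  · rintro rfl
    refine ⟨?_, lt_irrefl _⟩
    have hlim : Tendsto (fun ε : ℝ ↦ y + (w : Space d) + (h w + ε) • n) (𝓝[>] 0)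
        (𝓝 (y + (w : Space d) + h w • n)) := by
      refine tendsto_nhdsWithin_of_tendsto_nhds ?_
      have : Continuous fun ε : ℝ ↦ y + (w : Space d) + (h w + ε) • n := by fun_prop
      simpa using this.tendsto 0
    refine mem_closure_of_tendsto hlim ?_
    have e1 : ∀ᶠ ε : ℝ in 𝓝[>] 0, |h w + ε| < ρ := by
      have : ContinuousAt (fun ε : ℝ ↦ |h w + ε|) 0 := by fun_prop
      exact (this.eventually (gt_mem_nhds (by simpa using hs))).filter_mono nhdsWithin_le_nhds
    filter_upwards [e1, self_mem_nhdsWithin] with ε h4 h5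
    rw [hmem w hwρ _ h4]
    exact lt_add_of_pos_right _ h5

/-- The upward unit normal of the graph of `h` over the hyperplane `n^⊥`. -/
def graphNormal (n : Space d) (h : Hyperplane n → ℝ) (w : Hyperplane n) : Space d :=
  (√(1 + ‖∇ h w‖ ^ 2))⁻¹ • (n - (∇ h w : Hyperplane n))

theorem isInwardNormal_graphNormal {Ω : Set (Space d)} {y n : Space d} (hn : ‖n‖ = 1)
    {h : Hyperplane n → ℝ} {w : Hyperplane n} (hd : DifferentiableAt ℝ h w)
    (hmem : ∀ᶠ p : Hyperplane n × ℝ in 𝓝 (w, h w),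
      (y + (p.1 : Space d) + p.2 • n ∈ Ω ↔ h p.1 < p.2)) :
    IsInwardNormal Ω (y + (w : Space d) + h w • n) (graphNormal n h w) := by
  have hq : 0 < √(1 + ‖∇ h w‖ ^ 2) := by positivity
  have hnorm : ‖n - ((∇ h w : Hyperplane n) : Space d)‖ = √(1 + ‖∇ h w‖ ^ 2) := by
    rw [eq_comm, Real.sqrt_eq_iff_eq_sq (by positivity) (norm_nonneg _), norm_sub_sq_real,
      real_inner_comm, inner_hyperplane, hn]
    simp
  -- the side of a direction is read off from the derivative of `h` along it
  have hside : ∀ p : Hyperplane n × ℝ, ⟪graphCoord n hn p, graphNormal n h w⟫ =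
      (√(1 + ‖∇ h w‖ ^ 2))⁻¹ * (p.2 - fderiv ℝ h w p.1) := by
    intro p
    have e1 : ⟪(p.1 : Space d), ((∇ h w : Hyperplane n) : Space d)⟫ = fderiv ℝ h w p.1 :=
      inner_gradient_right_eq_fderiv h w p.1
    have e2 := inner_hyperplane n (∇ h w)
    rw [real_inner_comm] at e2
    rw [graphNormal, inner_smul_right, graphCoord_apply, inner_sub_right, inner_add_left,
      inner_add_left, real_inner_smul_left, real_inner_smul_left, inner_hyperplane, e1, e2,
      real_inner_self_eq_norm_sq, hn]
    ring
  have hcurve : ∀ p : Hyperplane n × ℝ, ∀ ε : ℝ, (y + (w : Space d) + h w • n) +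
      ε • graphCoord n hn p = y + ((w + ε • p.1 : Hyperplane n) : Space d) +
        (h w + ε * p.2) • n := by
    intro p ε
    simp only [graphCoord_apply, Submodule.coe_add, Submodule.coe_smul, smul_add, add_smul,
      mul_smul]
    abel
  have hev : ∀ p : Hyperplane n × ℝ, ∀ᶠ ε : ℝ in 𝓝[>] 0,
      ((y + (w : Space d) + h w • n) + ε • graphCoord n hn p ∈ Ω ↔
        h (w + ε • p.1) < h w + ε * p.2) := by
    intro p
    have hc : Continuous fun ε : ℝ ↦ ((w + ε • p.1, h w + ε * p.2) : Hyperplane n × ℝ) := by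
      fun_prop
    have := (hc.tendsto 0).eventually (by simpa using hmem)
    filter_upwards [this.filter_mono nhdsWithin_le_nhds] with ε hε
    rw [hcurve]; exact hε
  have hslope : ∀ p : Hyperplane n × ℝ, Tendsto (fun ε : ℝ ↦ ε⁻¹ * (h (w + ε • p.1) - h w))
      (𝓝[>] 0) (𝓝 (fderiv ℝ h w p.1)) := by
    intro p
    have := (hd.hasFDerivAt.hasLineDerivAt p.1).tendsto_slope_zero_right
    simpa using this
  refine ⟨?_, fun v hv ↦ ?_, fun v hv ↦ ?_⟩
  · rw [graphNormal, norm_smul, hnorm, norm_inv, Real.norm_of_nonneg hq.le, inv_mul_cancel₀ hq.ne']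
  all_goals
    obtain ⟨p, rfl⟩ := (graphCoord n hn).surjective v
    rw [hside] at hv
  · have hv' : fderiv ℝ h w p.1 < p.2 := by
      have := (mul_pos_iff_of_pos_left (inv_pos.2 hq)).1 hv
      linarith
    filter_upwards [hev p, (hslope p).eventually (gt_mem_nhds hv'), self_mem_nhdsWithin]
      with ε h1 h2 h3
    rw [h1]
    have h3' : (0 : ℝ) < ε := h3
    rw [inv_mul_lt_iff₀ h3'] at h2
    linarith
  · have hv' : p.2 < fderiv ℝ h w p.1 := by
      by_contra h0
      exact absurd hv (not_lt.2 (mul_nonneg (inv_pos.2 hq).le (by linarith)))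
    filter_upwards [hev p, (hslope p).eventually (lt_mem_nhds hv'), self_mem_nhdsWithin]
      with ε h1 h2 h3
    rw [h1]
    have h3' : (0 : ℝ) < ε := h3
    rw [lt_inv_mul_iff₀ h3'] at h2
    linarith

end CurvedTrace

end

noncomputable section

namespace CurvedTrace

variable {d : ℕ}

/-! ### Normal rays and the reach -/

/-- Second-order Taylor expansion at a critical zero. -/
theorem taylor_two_isLittleO {E : Type*} [NormedAddCommGroup E] [NormedSpace ℝ E] {h : E → ℝ}
    (hC : ContDiffAt ℝ 2 h 0) (h0 : h 0 = 0) (hd : fderiv ℝ h 0 = 0) :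
    (fun w ↦ h w - 2⁻¹ * fderiv ℝ (fderiv ℝ h) 0 w w) =o[𝓝 0] fun w ↦ ‖w‖ ^ 2 := by
  set B := fderiv ℝ (fderiv ℝ h) 0 with hB
  have hsym : IsSymmSndFDerivAt ℝ h 0 := hC.isSymmSndFDerivAt (by simp)
  have hC1 : ContDiffAt ℝ 1 (fderiv ℝ h) 0 := hC.fderiv_right (by norm_num)
  have hB' : HasFDerivAt (fderiv ℝ h) B 0 := (hC1.differentiableAt (by norm_num)).hasFDerivAt
  have hlo := hB'.isLittleO
  rw [Asymptotics.isLittleO_iff]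
  intro c hc
  have h1 : ∀ᶠ w in 𝓝 (0 : E), ‖fderiv ℝ h w - B w‖ ≤ c * ‖w‖ := by
    have := (Asymptotics.isLittleO_iff.1 hlo) hc
    simpa [hd] using this
  have h2 : ∀ᶠ w in 𝓝 (0 : E), DifferentiableAt ℝ h w := by
    have := hC.eventually (by simp)
    filter_upwards [this] with w hw
    exact hw.differentiableAt (by norm_num)
  obtain ⟨r, hr, hr'⟩ := Metric.eventually_nhds_iff_ball.1 (h1.and h2)
  filter_upwards [Metric.ball_mem_nhds (0 : E) hr] with w hw
  -- mean value inequality for the remainder, whose derivative is `∇h - B` by symmetry of `B`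
  have hk : ∀ x ∈ Metric.closedBall (0 : E) ‖w‖,
      HasFDerivWithinAt (fun w ↦ h w - 2⁻¹ * B w w) (fderiv ℝ h x - B x)
        (Metric.closedBall 0 ‖w‖) x := by
    intro x hx
    have hx' : x ∈ Metric.ball (0 : E) r := by
      rw [mem_ball_zero_iff] at hw ⊢
      exact (mem_closedBall_zero_iff.1 hx).trans_lt hw
    have e1 : HasFDerivAt (fun w ↦ B w w) (B.precompR E x (ContinuousLinearMap.id ℝ E) +
        B.precompL E (ContinuousLinearMap.id ℝ E) x) x := by
      simpa using B.hasFDerivAt_of_bilinear (hasFDerivAt_id x) (hasFDerivAt_id x)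
    have e2 := (hr' x hx').2.hasFDerivAt.sub (e1.const_mul (2⁻¹ : ℝ))
    refine (e2.congr_fderiv ?_).hasFDerivWithinAt
    ext v
    have := hsym.eq v x
    simp only [sub_apply, smul_apply, add_apply, ContinuousLinearMap.precompR_apply,
      ContinuousLinearMap.precompL_apply, ContinuousLinearMap.compL_apply,
      ContinuousLinearMap.comp_apply, ContinuousLinearMap.id_apply, smul_eq_mul]
    rw [← hB] at this
    rw [this]; ring
  have hbd : ∀ x ∈ Metric.closedBall (0 : E) ‖w‖, ‖fderiv ℝ h x - B x‖ ≤ c * ‖w‖ := by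
    intro x hx
    have hx' : x ∈ Metric.ball (0 : E) r := by
      rw [mem_ball_zero_iff] at hw ⊢
      exact (mem_closedBall_zero_iff.1 hx).trans_lt hw
    exact (hr' x hx').1.trans (by gcongr; exact mem_closedBall_zero_iff.1 hx)
  have := (convex_closedBall (0 : E) ‖w‖).norm_image_sub_le_of_norm_hasFDerivWithin_le hk hbd
    (Metric.mem_closedBall_self (norm_nonneg _)) (mem_closedBall_zero_iff.2 le_rfl)
  simp only [h0, map_zero, sub_zero, mul_zero] at this
  simpa [pow_two, mul_assoc] using this

theorem exists_abs_le_mul_sq {E : Type*} [NormedAddCommGroup E] [NormedSpace ℝ E] {h : E → ℝ}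
    (hC : ContDiffAt ℝ 2 h 0) (h0 : h 0 = 0) (hd : fderiv ℝ h 0 = 0) :
    ∃ C : ℝ, ∀ᶠ w in 𝓝 (0 : E), |h w| ≤ C * ‖w‖ ^ 2 := by
  refine ⟨1 + 2⁻¹ * ‖fderiv ℝ (fderiv ℝ h) 0‖, ?_⟩
  have h1 := (Asymptotics.isLittleO_iff.1 (taylor_two_isLittleO hC h0 hd)) one_pos
  filter_upwards [h1] with w hw
  have h2 := (fderiv ℝ (fderiv ℝ h) 0).le_opNorm₂ w w
  rw [Real.norm_eq_abs] at h2 hw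
  rw [norm_pow, norm_norm] at hw
  rw [abs_le] at h2 hw ⊢
  constructor <;> nlinarith

theorem isNearestBdryPoint_of_le {Ω : Set (Space d)} {x y : Space d} (hy : y ∈ frontier Ω)
    (h : dist x y ≤ bdryDist Ω x) : IsNearestBdryPoint Ω x y :=
  ⟨hy, h.antisymm (Metric.infDist_le_dist_of_mem hy)⟩

theorem bdryDist_le_dist {Ω : Set (Space d)} {x y : Space d} (hy : y ∈ frontier Ω) :
    bdryDist Ω x ≤ dist x y := Metric.infDist_le_dist_of_mem hy

theorem exists_isNearestBdryPoint {Ω : Set (Space d)} (hne : (frontier Ω).Nonempty) (x : Space d) :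
    ∃ y, IsNearestBdryPoint Ω x y := by
  obtain ⟨y, hy, h⟩ := isClosed_frontier.exists_infDist_eq_dist hne x
  exact ⟨y, hy, h.symm⟩

/-- The ball around an interior point reaching to the boundary stays inside, being connected. -/
theorem ball_bdryDist_subset {Ω : Set (Space d)} {x : Space d} (hx : x ∈ Ω) :
    Metric.ball x (bdryDist Ω x) ⊆ Ω := by
  intro z hz
  by_contra hzΩ
  have hpc : IsPreconnected (Metric.ball x (bdryDist Ω x)) :=
    (convex_ball x _).isPreconnected
  have hxb : x ∈ Metric.ball x (bdryDist Ω x) := Metric.mem_ball_self (Metric.pos_of_mem_ball hz)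
  have hfr : ∀ q ∈ Metric.ball x (bdryDist Ω x), q ∉ frontier Ω := fun q hq hqf ↦ by
    rw [Metric.mem_ball, dist_comm] at hq
    exact absurd (bdryDist_le_dist hqf) (not_le.2 hq)
  have hcl : ∀ q ∈ Metric.ball x (bdryDist Ω x), q ∉ Ω → q ∈ (closure Ω)ᶜ := fun q hq hqΩ hqc ↦
    hfr q hq ⟨hqc, fun h ↦ hqΩ (interior_subset h)⟩
  have hxi : x ∈ interior Ω := by
    by_contra h
    exact hfr x hxb ⟨subset_closure hx, h⟩
  obtain ⟨q, -, hq1, hq2⟩ := hpc (interior Ω) (closure Ω)ᶜ isOpen_interior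
    isClosed_closure.isOpen_compl (fun q hq ↦ by
      by_cases h : q ∈ interior Ω
      · exact Or.inl h
      · exact Or.inr fun hqc ↦ hfr q hq ⟨hqc, h⟩) ⟨x, hxb, hxi⟩ ⟨z, hz, hcl z hz hzΩ⟩
  exact hq2 (subset_closure (interior_subset hq1))

theorem bdryDist_pos {Ω : Set (Space d)} (hΩ : IsOpen Ω) (hne : (frontier Ω).Nonempty)
    {x : Space d} (hx : x ∈ Ω) : 0 < bdryDist Ω x := by
  rw [bdryDist, ← isClosed_frontier.notMem_iff_infDist_pos hne]
  exact fun h ↦ (hΩ.frontier_eq ▸ h : x ∈ closure Ω \ Ω).2 hx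

/-- Every point of the layer of width `R` has a unique nearest boundary point. -/
def HasUniqueProj (Ω : Set (Space d)) (R : ℝ) : Prop :=
  ∀ x ∈ layer Ω R, ∃! y, IsNearestBdryPoint Ω x y

theorem exists_hasUniqueProj {Ω : Set (Space d)} {t : ℝ} (ht : 0 < t)
    (h : ENNReal.ofReal t < reach Ω) : ∃ R, t < R ∧ HasUniqueProj Ω R := by
  obtain ⟨S, hS, htS⟩ := lt_sSup_iff.1 h
  obtain ⟨r, h1, h2⟩ := ENNReal.lt_iff_exists_nnreal_btwn.1 htS
  rw [← ENNReal.ofReal_coe_nnreal] at h1 h2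
  have h3 : t < r := (ENNReal.ofReal_lt_ofReal_iff_of_nonneg ht.le).1 h1
  exact ⟨r, h3, hS r (ht.trans h3) h2⟩

theorem HasUniqueProj.bdryProj_spec {Ω : Set (Space d)} {R : ℝ} (h : HasUniqueProj Ω R)
    {x : Space d} (hx : x ∈ layer Ω R) : IsNearestBdryPoint Ω x (bdryProj Ω x) :=
  Classical.epsilon_spec (h x hx).exists

theorem HasUniqueProj.bdryProj_eq {Ω : Set (Space d)} {R : ℝ} (h : HasUniqueProj Ω R)
    {x y : Space d} (hx : x ∈ layer Ω R) (hy : IsNearestBdryPoint Ω x y) : bdryProj Ω x = y :=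
  (h x hx).unique (h.bdryProj_spec hx) hy

/-- Where the nearest boundary point is unique, the distance to the boundary grows with slope
arbitrarily close to one when moving away from that point. -/
theorem eventually_bdryDist_add_le {Ω : Set (Space d)} {x y v : Space d} {τ ε : ℝ} (hτ : 0 < τ)
    (hu : ∀ z, IsNearestBdryPoint Ω x z → z = y) (hy : IsNearestBdryPoint Ω x y)
    (hv : ‖v‖ = 1) (hx : x = y + τ • v) (hε : 0 < ε) (hε1 : ε < 1) :
    ∀ᶠ r in 𝓝[>] (0 : ℝ), bdryDist Ω x + (1 - ε) * r ≤ bdryDist Ω (x + r • v) := by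
  have hdx : bdryDist Ω x = τ := by
    rw [← hy.2, hx, dist_eq_norm, add_sub_cancel_left, norm_smul, hv, Real.norm_of_nonneg hτ.le,
      mul_one]
  -- boundary points seen from `x` in other directions than `y` are uniformly farther than `y`
  obtain ⟨m, hm, hfar⟩ : ∃ m, τ < m ∧ ∀ q ∈ frontier Ω, ⟪v, x - q⟫ ≤ (1 - ε) * τ → m ≤ dist x q := by
    set C := frontier Ω ∩ {q | ⟪v, x - q⟫ ≤ (1 - ε) * τ} with hC
    have hCc : IsClosed C := isClosed_frontier.inter
      (isClosed_le (by fun_prop) continuous_const)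
    rcases C.eq_empty_or_nonempty with h | h
    · refine ⟨τ + 1, by linarith, fun q hq hq' ↦ ?_⟩
      have : q ∈ C := ⟨hq, hq'⟩
      rw [h] at this
      exact this.elim
    · obtain ⟨q₀, hq₀, hq₀'⟩ := hCc.exists_infDist_eq_dist h x
      refine ⟨dist x q₀, ?_, fun q hq hq' ↦ hq₀' ▸ Metric.infDist_le_dist_of_mem ⟨hq, hq'⟩⟩
      by_contra hle
      have hq₀y := hu q₀ (isNearestBdryPoint_of_le hq₀.1 (by rw [hdx]; exact not_lt.1 hle))
      have h2 : ⟪v, x - q₀⟫ ≤ (1 - ε) * τ := hq₀.2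
      rw [hq₀y, hx, add_sub_cancel_left, real_inner_smul_right, real_inner_self_eq_norm_sq, hv] at h2
      nlinarith
  have hsmall : ∀ᶠ r in 𝓝[>] (0 : ℝ), r < (m - τ) / 2 :=
    (gt_mem_nhds (by linarith : (0 : ℝ) < (m - τ) / 2)).filter_mono nhdsWithin_le_nhds
  filter_upwards [hsmall, self_mem_nhdsWithin] with r hr hr0
  have hr0 : 0 < r := hr0
  obtain ⟨q, hq, hqd⟩ := exists_isNearestBdryPoint ⟨y, hy.1⟩ (x + r • v)
  have hnrv : ‖r • v‖ = r := by rw [norm_smul, hv, Real.norm_of_nonneg hr0.le, mul_one]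
  have h1 : bdryDist Ω (x + r • v) ≤ τ + r := by
    refine (bdryDist_le_dist hy.1).trans ?_
    rw [hx, dist_eq_norm]
    have : y + τ • v + r • v - y = (τ + r) • v := by module
    rw [this, norm_smul, hv, Real.norm_of_nonneg (by linarith), mul_one]
  have h2 : dist x q < m := by
    have : dist x q ≤ dist x (x + r • v) + dist (x + r • v) q := dist_triangle _ _ _
    rw [dist_self_add_right, hnrv, hqd] at this
    linarith
  -- so the point `q` nearest to `x + r v` is seen from `x` almost in the direction of `y`
  have h3 : (1 - ε) * τ < ⟪v, x - q⟫ := by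
    by_contra h
    exact absurd (hfar q hq (not_lt.1 h)) (not_le.2 h2)
  have h4 : τ ≤ ‖x - q‖ := by
    rw [← hdx, ← dist_eq_norm]; exact bdryDist_le_dist hq
  rw [← hqd, hdx, dist_eq_norm]
  refine le_of_sq_le_sq ?_ (norm_nonneg _)
  have h5 : x + r • v - q = (x - q) + r • v := by abel
  rw [h5, norm_add_sq_real, hnrv, real_inner_smul_right, real_inner_comm]
  have h6 : (1 - ε) ^ 2 * r ^ 2 ≤ 1 * r ^ 2 := by
    gcongr
    exact pow_le_one₀ (by linarith) (by linarith)
  have h7 := mul_lt_mul_of_pos_left h3 hr0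
  have h8 := pow_le_pow_left₀ hτ.le h4 2
  linear_combination h6 + 2 * h7 + h8

/-- Below the reach a normal segment of length `τ` on which the distance to the boundary is
realized can be prolonged to length `τ + r` for every `r < τ`. -/
theorem HasUniqueProj.bdryDist_prolong {Ω : Set (Space d)} {R : ℝ} (h : HasUniqueProj Ω R)
    {y ν : Space d} (hy : y ∈ frontier Ω) (hν : ‖ν‖ = 1) {τ r : ℝ} (hτ : 0 < τ) (hr : 0 < r)
    (hrτ : r < τ) (hR : τ + r < R) (hmem : y + τ • ν ∈ Ω) (hdist : bdryDist Ω (y + τ • ν) = τ) :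
    y + (τ + r) • ν ∈ Ω ∧ bdryDist Ω (y + (τ + r) • ν) = τ + r := by
  set x₀ := y + τ • ν with hx₀
  have hcont : Continuous (bdryDist Ω) := continuous_bdryDist Ω
  have hsub : Metric.closedBall x₀ r ⊆ Ω := fun z hz ↦ ball_bdryDist_subset hmem
    (by rw [hdist]; exact (Metric.mem_closedBall.1 hz).trans_lt hrτ)
  have hcpt : IsCompact (Metric.closedBall x₀ r) := isCompact_closedBall _ _
  have hnem : (Metric.closedBall x₀ r).Nonempty := Metric.nonempty_closedBall.2 hr.le
  obtain ⟨z, hz, hzmax⟩ := hcpt.exists_isMaxOn hnem hcont.continuousOn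
  have hlip : ∀ a b, bdryDist Ω a ≤ bdryDist Ω b + dist a b := fun a b ↦
    Metric.infDist_le_infDist_add_dist
  -- penalizing the distance to `x₀` forces the maximum onto the sphere of radius `r`
  have hkey : ∀ ε, 0 < ε → ε < 1 → τ + (1 - ε) * r ≤ bdryDist Ω z := by
    intro ε hε hε1
    obtain ⟨x, hx, hxmax⟩ := hcpt.exists_isMaxOn hnem
      (f := fun x ↦ bdryDist Ω x - (1 - ε) * dist x x₀) (by fun_prop)
    have hxr : dist x x₀ = r := by
      refine le_antisymm (Metric.mem_closedBall.1 hx) (not_lt.1 fun hlt ↦ ?_)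
      have hxl : x ∈ layer Ω R := ⟨hsub hx, by
        have := hlip x x₀
        rw [hdist] at this; linarith⟩
      obtain ⟨q, hq, hqu⟩ := h x hxl
      have hdpos : 0 < bdryDist Ω x := by
        have := hlip x₀ x
        rw [hdist, dist_comm] at this; linarith
      have hqn : ‖x - q‖ = bdryDist Ω x := by rw [← dist_eq_norm]; exact hq.2
      set v := (bdryDist Ω x)⁻¹ • (x - q) with hv
      have hv1 : ‖v‖ = 1 := by
        rw [hv, norm_smul, hqn, norm_inv, Real.norm_of_nonneg hdpos.le, inv_mul_cancel₀ hdpos.ne']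
      have hxv : x = q + bdryDist Ω x • v := by
        rw [hv, smul_smul, mul_inv_cancel₀ hdpos.ne', one_smul]; abel
      have hev := eventually_bdryDist_add_le hdpos hqu hq hv1 hxv (half_pos hε) (by linarith)
      have hsm : ∀ᶠ s in 𝓝[>] (0 : ℝ), s < r - dist x x₀ :=
        (gt_mem_nhds (by linarith)).filter_mono nhdsWithin_le_nhds
      obtain ⟨s, ⟨hs1, hs2⟩, hs0⟩ := ((hev.and hsm).and self_mem_nhdsWithin).exists
      have hs0 : 0 < s := hs0
      have hd1 : dist (x + s • v) x₀ ≤ dist x x₀ + s := by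
        refine (dist_triangle _ x _).trans ?_
        rw [dist_self_add_left, norm_smul, hv1, Real.norm_of_nonneg hs0.le]; linarith
      have := hxmax (a := x + s • v) (Metric.mem_closedBall.2 (by linarith))
      simp only [mem_ofPred_eq] at this
      nlinarith
    have h1 := hxmax (Metric.mem_closedBall_self hr.le)
    have h2 := hzmax hx
    simp only [mem_ofPred_eq, dist_self, mul_zero, sub_zero, hdist, hxr] at h1 h2
    linarith
  have hzge : τ + r ≤ bdryDist Ω z := by
    refine le_of_forall_pos_lt_add fun δ hδ ↦ ?_
    have hε : 0 < min (1 / 2) (δ / (2 * r)) := by positivity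
    have h1 := hkey _ hε ((min_le_left _ _).trans_lt (by norm_num))
    have h2 : min (1 / 2) (δ / (2 * r)) * r ≤ δ / 2 := by
      calc _ ≤ δ / (2 * r) * r := by gcongr; exact min_le_right _ _
        _ = δ / 2 := by field_simp
    nlinarith
  -- equality in the triangle inequality
  have hzy : τ + r ≤ ‖(z - x₀) + τ • ν‖ := by
    refine hzge.trans ((bdryDist_le_dist hy).trans_eq ?_)
    rw [dist_eq_norm, hx₀]; congr 1; abel
  have hzr : ‖z - x₀‖ ≤ r := by rw [← dist_eq_norm]; exact hz
  have hin : r ≤ ⟪z - x₀, ν⟫ := by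
    have h1 := pow_le_pow_left₀ (by linarith) hzy 2
    rw [norm_add_sq_real, norm_smul, hν, real_inner_smul_right, Real.norm_of_nonneg hτ.le] at h1
    have h2 := pow_le_pow_left₀ (norm_nonneg _) hzr 2
    by_contra hlt
    nlinarith
  have hzeq : z - x₀ = r • ν := by
    have : ‖(z - x₀) - r • ν‖ ^ 2 ≤ 0 := by
      rw [norm_sub_sq_real, norm_smul, hν, real_inner_smul_right, Real.norm_of_nonneg hr.le]
      have h2 := pow_le_pow_left₀ (norm_nonneg _) hzr 2
      nlinarith
    exact sub_eq_zero.1 (norm_eq_zero.1 (by nlinarith [norm_nonneg ((z - x₀) - r • ν)]))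
  have hz' : y + (τ + r) • ν = z := by
    rw [sub_eq_iff_eq_add.1 hzeq, hx₀]; module
  rw [hz']
  refine ⟨hsub hz, le_antisymm ?_ hzge⟩
  have := hlip z x₀
  rw [hdist] at this
  linarith [Metric.mem_closedBall.1 hz]

theorem bdryDist_segment {Ω : Set (Space d)} {y ν : Space d} (hy : y ∈ frontier Ω) (hν : ‖ν‖ = 1)
    {s τ : ℝ} (hs : 0 < s) (hsτ : s ≤ τ) (hmem : y + τ • ν ∈ Ω)
    (hdist : bdryDist Ω (y + τ • ν) = τ) : y + s • ν ∈ Ω ∧ bdryDist Ω (y + s • ν) = s := by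
  have h1 : dist (y + τ • ν) (y + s • ν) = τ - s := by
    rw [dist_add_left, dist_eq_norm, ← sub_smul, norm_smul, hν, Real.norm_of_nonneg (by linarith),
      mul_one]
  refine ⟨ball_bdryDist_subset hmem ?_, le_antisymm ?_ ?_⟩
  · rw [hdist, Metric.mem_ball, dist_comm, h1]; linarith
  · refine (bdryDist_le_dist hy).trans ?_
    rw [dist_self_add_left, norm_smul, hν, Real.norm_of_nonneg hs.le, mul_one]
  · have : bdryDist Ω (y + τ • ν) ≤ bdryDist Ω (y + s • ν) + dist (y + τ • ν) (y + s • ν) :=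
      Metric.infDist_le_infDist_add_dist
    linarith

/-- Below the reach, distances are realized along a whole normal ray as soon as they are on a short
initial segment. -/
theorem HasUniqueProj.bdryDist_ray {Ω : Set (Space d)} {R : ℝ} (h : HasUniqueProj Ω R)
    {y ν : Space d} (hy : y ∈ frontier Ω) (hν : ‖ν‖ = 1) {τ : ℝ} (hτ : 0 < τ)
    (hmem : y + τ • ν ∈ Ω) (hdist : bdryDist Ω (y + τ • ν) = τ) {s : ℝ} (hs : 0 < s) (hsR : s < R) :
    y + s • ν ∈ Ω ∧ bdryDist Ω (y + s • ν) = s := by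
  rcases le_or_gt s τ with hsτ | hsτ
  · exact bdryDist_segment hy hν hs hsτ hmem hdist
  -- each prolongation extends the segment by at most half its length
  have hind : ∀ k : ℕ, y + min ((3 / 2) ^ k * τ) s • ν ∈ Ω ∧
      bdryDist Ω (y + min ((3 / 2) ^ k * τ) s • ν) = min ((3 / 2) ^ k * τ) s := by
    intro k
    induction k with
    | zero => simpa [min_eq_left hsτ.le] using And.intro hmem hdist
    | succ k ih =>
      have hpos : 0 < (3 / 2 : ℝ) ^ k * τ := by positivity
      rcases le_or_gt s ((3 / 2) ^ k * τ) with hle | hlt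
      · have hle' : s ≤ (3 / 2) ^ (k + 1) * τ := by rw [pow_succ]; nlinarith
        rw [min_eq_right hle] at ih
        rwa [min_eq_right hle']
      · rw [min_eq_left hlt.le] at ih
        set a := (3 / 2 : ℝ) ^ k * τ with ha
        have hb : (3 / 2 : ℝ) ^ (k + 1) * τ = 3 / 2 * a := by rw [ha, pow_succ]; ring
        rw [hb]
        have h1 : a < min (3 / 2 * a) s := lt_min (by linarith) hlt
        have h2 : min (3 / 2 * a) s ≤ 3 / 2 * a := min_le_left _ _
        have h3 : min (3 / 2 * a) s ≤ s := min_le_right _ _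
        have := h.bdryDist_prolong hy hν hpos (r := min (3 / 2 * a) s - a) (by linarith)
          (by linarith) (by linarith) ih.1 ih.2
        rwa [add_sub_cancel] at this
  obtain ⟨k, hk⟩ := pow_unbounded_of_one_lt (s / τ) (by norm_num : (1 : ℝ) < 3 / 2)
  have := hind k
  rwa [min_eq_right ((div_lt_iff₀ hτ).1 hk).le] at this

theorem norm_coord_sq {n : Space d} (hn : ‖n‖ = 1) (w : Hyperplane n) (s : ℝ) :
    ‖(w : Space d) + s • n‖ ^ 2 = ‖w‖ ^ 2 + s ^ 2 := by
  rw [norm_add_sq_real, real_inner_smul_right, inner_hyperplane, norm_smul, hn]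
  simp

/-- Interior ball condition for local graphs. -/
theorem IsLocalGraph.exists_bdryDist_eq {Ω : Set (Space d)} (hΩ : IsOpen Ω) {y n : Space d}
    {h : Hyperplane n → ℝ} (hg : IsLocalGraph Ω y n h) :
    ∃ τ > 0, y + τ • n ∈ Ω ∧ bdryDist Ω (y + τ • n) = τ := by
  obtain ⟨ρ, hρ, δ, hδ, -, hhρ, hmem⟩ := hg.exists_radius hΩ
  obtain ⟨C, hC⟩ := exists_abs_le_mul_sq hg.contDiffAt hg.zero hg.fderiv_zero
  obtain ⟨δ', hδ', hC⟩ := Metric.eventually_nhds_iff_ball.1 hC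
  have hy : y ∈ frontier Ω := by
    have := (hmem 0 (Metric.mem_ball_self hδ) 0 (by simpa using hρ)).2.2 hg.zero.symm
    simpa using this
  set τ := min (min (δ / 2) (δ' / 2)) (min (ρ / 4) (1 / (2 * (|C| + 1)))) with hτdef
  have hτ : 0 < τ := by positivity
  have t1 : τ ≤ δ / 2 := (min_le_left _ _).trans (min_le_left _ _)
  have t2 : τ ≤ δ' / 2 := (min_le_left _ _).trans (min_le_right _ _)
  have t3 : τ ≤ ρ / 4 := (min_le_right _ _).trans (min_le_left _ _)
  have t4 : τ * (2 * (|C| + 1)) ≤ 1 := by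
    have : τ ≤ 1 / (2 * (|C| + 1)) := (min_le_right _ _).trans (min_le_right _ _)
    rwa [le_div_iff₀ (by positivity)] at this
  have hn := hg.norm_eq
  refine ⟨τ, hτ, ?_, le_antisymm ?_ ?_⟩
  · have := (hmem 0 (Metric.mem_ball_self hδ) τ (by rw [abs_of_pos hτ]; linarith)).1.2
      (by rw [hg.zero]; exact hτ)
    simpa using this
  · refine (bdryDist_le_dist hy).trans ?_
    rw [dist_self_add_left, norm_smul, hn, Real.norm_of_nonneg hτ.le, mul_one]
  · refine (Metric.le_infDist ⟨y, hy⟩).2 fun q hq ↦ not_lt.1 fun hlt ↦ ?_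
    obtain ⟨⟨w, σ⟩, hwσ⟩ := (graphCoord n hn).surjective (q - y)
    rw [graphCoord_apply] at hwσ
    have hqe : q = y + (w : Space d) + σ • n := by
      rw [add_assoc, hwσ]; abel
    have h1 : ‖w‖ ^ 2 + (σ - τ) ^ 2 < τ ^ 2 := by
      rw [← norm_coord_sq hn]
      refine pow_lt_pow_left₀ ?_ (norm_nonneg _) two_ne_zero
      rw [dist_comm, dist_eq_norm, hqe] at hlt
      have h0 : y + (w : Space d) + σ • n - (y + τ • n) = (w : Space d) + (σ - τ) • n := by module
      rwa [h0] at hlt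
    have h2 : ‖w‖ < τ := lt_of_pow_lt_pow_left₀ 2 hτ.le (by nlinarith)
    have h3 : |σ - τ| < τ := by
      refine lt_of_pow_lt_pow_left₀ 2 hτ.le ?_
      rw [sq_abs]; nlinarith [sq_nonneg ‖w‖]
    rw [abs_lt] at h3
    have h4 : σ = h w := by
      refine (hmem w (by rw [mem_ball_zero_iff]; linarith) σ ?_).2.1 (hqe ▸ hq)
      rw [abs_lt]; constructor <;> linarith
    have h5 := hC w (by rw [mem_ball_zero_iff]; linarith)
    rw [← h4] at h5
    have h6 : σ ≤ |C| * ‖w‖ ^ 2 := (le_abs_self σ).trans (h5.trans (by gcongr; exact le_abs_self C))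
    -- the choice of `τ` gives `2 τ |C| ≤ 1`, where `h w ≤ |C| ‖w‖²` near `0`
    have h7 : 2 * τ * σ ≤ ‖w‖ ^ 2 := by
      have : 2 * τ * |C| ≤ 1 := by nlinarith
      nlinarith [sq_nonneg ‖w‖]
    nlinarith [sq_nonneg σ]

theorem IsLocalGraph.mem_frontier {Ω : Set (Space d)} (hΩ : IsOpen Ω) {y n : Space d}
    {h : Hyperplane n → ℝ} (hg : IsLocalGraph Ω y n h) : y ∈ frontier Ω := by
  obtain ⟨ρ, hρ, δ, hδ, -, -, hmem⟩ := hg.exists_radius hΩ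
  have := (hmem 0 (Metric.mem_ball_self hδ) 0 (by simpa using hρ)).2.2 hg.zero.symm
  simpa using this

theorem IsLocalGraph.isInwardNormal {Ω : Set (Space d)} {y n : Space d}
    {h : Hyperplane n → ℝ} (hg : IsLocalGraph Ω y n h) : IsInwardNormal Ω y n := by
  have h1 := isInwardNormal_graphNormal (y := y) hg.norm_eq (w := 0)
    (hg.contDiffAt.differentiableAt (by norm_num)) (by rw [hg.zero]; exact hg.mem_iff)
  have h2 : ∇ h 0 = 0 := by simp [gradient, hg.fderiv_zero]
  simpa [graphNormal, h2, hg.zero] using h1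

theorem IsUniformlyC2.exists_isLocalGraph {Ω : Set (Space d)} (hΩ : IsUniformlyC2 Ω)
    {y : Space d} (hy : y ∈ frontier Ω) : ∃ n h, IsLocalGraph (d := d) Ω y n h := by
  obtain ⟨k, hk⟩ := hΩ.exists_isPrincipalCurvatures hy
  obtain ⟨n, h, hg, -⟩ := isPrincipalCurvatures_iff.1 hk
  exact ⟨n, h, hg⟩

/-- Below the reach, the points at distance `s` from the boundary along the inward normal at `y` are
at distance exactly `s` from the boundary. -/
theorem HasUniqueProj.bdryDist_normal {Ω : Set (Space d)} {R : ℝ} (h : HasUniqueProj Ω R)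
    (hΩ : IsUniformlyC2 Ω) {y ν : Space d} (hy : y ∈ frontier Ω) (hν : IsInwardNormal Ω y ν)
    {s : ℝ} (hs : 0 < s) (hsR : s < R) : y + s • ν ∈ Ω ∧ bdryDist Ω (y + s • ν) = s := by
  obtain ⟨n, k, hg⟩ := hΩ.exists_isLocalGraph hy
  obtain ⟨τ, hτ, h1, h2⟩ := hg.exists_bdryDist_eq hΩ.1
  rw [hν.eq hg.isInwardNormal] at h1 h2
  exact h.bdryDist_ray hy hν.norm_eq hτ h1 h2 hs hsR

theorem HasUniqueProj.normal_mem_layer {Ω : Set (Space d)} {R : ℝ} (h : HasUniqueProj Ω R)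
    (hΩ : IsUniformlyC2 Ω) {y ν : Space d} (hy : y ∈ frontier Ω) (hν : IsInwardNormal Ω y ν)
    {s : ℝ} (hs : 0 < s) (hsR : s < R) : y + s • ν ∈ layer Ω R :=
  have := h.bdryDist_normal hΩ hy hν hs hsR
  ⟨this.1, this.2.trans_lt hsR⟩

theorem HasUniqueProj.bdryProj_normal {Ω : Set (Space d)} {R : ℝ} (h : HasUniqueProj Ω R)
    (hΩ : IsUniformlyC2 Ω) {y ν : Space d} (hy : y ∈ frontier Ω) (hν : IsInwardNormal Ω y ν)
    {s : ℝ} (hs : 0 < s) (hsR : s < R) : bdryProj Ω (y + s • ν) = y := by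
  refine h.bdryProj_eq (h.normal_mem_layer hΩ hy hν hs hsR) ⟨hy, ?_⟩
  rw [(h.bdryDist_normal hΩ hy hν hs hsR).2, dist_self_add_left, norm_smul, hν.norm_eq,
    Real.norm_of_nonneg hs.le, mul_one]

/-- A point lies on the normal ray of any of its nearest boundary points. -/
theorem eq_add_smul_normal {Ω : Set (Space d)} (hΩ : IsOpen Ω) {x y ν : Space d} (hx : x ∈ Ω)
    (hy : IsNearestBdryPoint Ω x y) (hν : IsInwardNormal Ω y ν) : x = y + bdryDist Ω x • ν := by
  have hs := bdryDist_pos hΩ ⟨y, hy.1⟩ hx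
  set s := bdryDist Ω x with hsdef
  have hn : ‖x - y‖ = s := by rw [← dist_eq_norm]; exact hy.2
  have hxv : x - y = s • (s⁻¹ • (x - y)) := by rw [smul_smul, mul_inv_cancel₀ hs.ne', one_smul]
  set v := s⁻¹ • (x - y) with hv
  have hv1 : ‖v‖ = 1 := by
    rw [hv, norm_smul, hn, norm_inv, Real.norm_of_nonneg hs.le, inv_mul_cancel₀ hs.ne']
  -- the ball around `x` of radius `s` lies in `Ω`, so directions at an acute angle with `v` enter it
  have : v = ν := by
    refine hν.eq_of_enters hv1 fun u hu ↦ ?_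
    have hlim : ∀ᶠ ε in 𝓝[>] (0 : ℝ), ε * ‖u‖ ^ 2 < 2 * s * ⟪u, v⟫ := by
      have hc : Continuous fun ε : ℝ ↦ ε * ‖u‖ ^ 2 := by fun_prop
      have := (hc.tendsto 0).eventually
        (gt_mem_nhds (show 0 * ‖u‖ ^ 2 < 2 * s * ⟪u, v⟫ by rw [zero_mul]; positivity))
      exact this.filter_mono nhdsWithin_le_nhds
    filter_upwards [hlim, self_mem_nhdsWithin] with ε h1 h2
    have h2 : 0 < ε := h2
    refine ball_bdryDist_subset hx ?_
    rw [← hsdef, Metric.mem_ball, dist_eq_norm]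
    have h3 : y + ε • u - x = ε • u - s • v := by rw [← hxv]; abel
    rw [h3]
    refine lt_of_pow_lt_pow_left₀ 2 hs.le ?_
    rw [norm_sub_sq_real, norm_smul, norm_smul, hv1, real_inner_smul_left, real_inner_smul_right,
      Real.norm_of_nonneg h2.le, Real.norm_of_nonneg hs.le]
    nlinarith [mul_lt_mul_of_pos_left h1 h2]
  rw [← this, ← hxv]; abel

/-- Principal curvatures are smaller than the inverse of any length below the reach. -/
theorem HasUniqueProj.curvature_mul_lt_one {Ω : Set (Space d)} {R : ℝ} (h : HasUniqueProj Ω R)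
    (hΩ : IsUniformlyC2 Ω) {y : Space d} {k : Fin (d - 1) → ℝ} (hk : IsPrincipalCurvatures Ω y k)
    {s : ℝ} (hs : 0 ≤ s) (hsR : s < R) (i : Fin (d - 1)) : k i * s < 1 := by
  obtain ⟨n, g, hg, b, hb⟩ := isPrincipalCurvatures_iff.1 hk
  obtain ⟨r, hsr, hrR⟩ := exists_between hsR
  have hr : 0 < r := hs.trans_lt hsr
  have hy := hg.mem_frontier hΩ.1
  obtain ⟨hmem, hdist⟩ := h.bdryDist_normal hΩ hy hg.isInwardNormal hr hrR
  obtain ⟨ρ, hρ, δ, hδ, -, hgρ, hgr⟩ := hg.exists_radius hΩ.1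
  have hn := hg.norm_eq
  have hline : Tendsto (fun u : ℝ ↦ u • b i) (𝓝[>] 0) (𝓝 0) := by
    have : Continuous fun u : ℝ ↦ u • b i := by fun_prop
    simpa using (this.tendsto 0).mono_left nhdsWithin_le_nhds
  have hbn : ‖b i‖ = 1 := b.norm_eq_one i
  -- the graph stays outside of the ball of radius `r` touching it
  have htouch : ∀ᶠ u in 𝓝[>] (0 : ℝ), 2 * r * g (u • b i) ≤ u ^ 2 + g (u • b i) ^ 2 := by
    filter_upwards [hline.eventually (Metric.ball_mem_nhds _ hδ)] with u hu
    have h1 := (hgr _ hu _ (hgρ _ hu)).2.2 rfl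
    have h2 := bdryDist_le_dist (x := y + r • n) h1
    rw [hdist, dist_comm, dist_eq_norm] at h2
    have h3 : y + ((u • b i : Hyperplane n) : Space d) + g (u • b i) • n - (y + r • n) =
      ((u • b i : Hyperplane n) : Space d) + (g (u • b i) - r) • n := by module
    rw [h3] at h2
    have h4 := pow_le_pow_left₀ hr.le h2 2
    rw [norm_coord_sq hn, norm_smul, hbn, mul_one, Real.norm_eq_abs, sq_abs] at h4
    linarith
  -- along the principal direction `b i` the graph has height `k i / 2 * u ^ 2` to second order
  have hlim : Tendsto (fun u : ℝ ↦ g (u • b i) / u ^ 2) (𝓝[>] 0) (𝓝 (k i / 2)) := by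
    have h1 := (taylor_two_isLittleO hg.contDiffAt hg.zero hg.fderiv_zero).comp_tendsto hline
    have h2 : (fun u : ℝ ↦ g (u • b i) - k i / 2 * u ^ 2) =o[𝓝[>] 0] fun u : ℝ ↦ u ^ 2 := by
      refine (h1.congr_left fun u ↦ ?_).congr_right fun u ↦ ?_
      · simp only [Function.comp_apply, map_smul, smul_apply, hb, smul_eq_mul,
          real_inner_self_eq_norm_sq, hbn]
        ring
      · rw [Function.comp_apply, norm_smul, hbn, mul_one, Real.norm_eq_abs, sq_abs]
    have h3 := h2.tendsto_div_nhds_zero.add_const (k i / 2)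
    rw [zero_add] at h3
    refine h3.congr' ?_
    filter_upwards [self_mem_nhdsWithin] with u hu
    have hu : 0 < u := hu
    field_simp
    ring
  have hlim0 : Tendsto (fun u : ℝ ↦ g (u • b i)) (𝓝[>] 0) (𝓝 0) := by
    have := hg.contDiffAt.continuousAt.tendsto.comp hline
    rwa [hg.zero] at this
  have hle : 2 * r * (k i / 2) ≤ 1 + k i / 2 * 0 := by
    refine le_of_tendsto_of_tendsto (hlim.const_mul (2 * r))
      (tendsto_const_nhds.add (hlim.mul hlim0)) ?_
    filter_upwards [htouch, self_mem_nhdsWithin] with u h1 hu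
    have hu : 0 < u := hu
    have h2 : 2 * r * (g (u • b i) / u ^ 2) = 2 * r * g (u • b i) / u ^ 2 := by ring
    have h3 : 1 + g (u • b i) / u ^ 2 * g (u • b i) = (u ^ 2 + g (u • b i) ^ 2) / u ^ 2 := by
      field_simp
    rw [h2, h3]
    gcongr
  rcases le_or_gt (k i) 0 with h0 | h0
  · nlinarith
  · nlinarith

end CurvedTrace

end

noncomputable section

namespace CurvedTrace

variable {d : ℕ}

/-! ### Normal coordinates: derivative and Jacobian -/

/-- The Riesz isomorphism from linear forms to vectors, as a real linear map. -/
def rieszMap (E : Type*) [NormedAddCommGroup E] [InnerProductSpace ℝ E] [CompleteSpace E] :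
    (E →L[ℝ] ℝ) →L[ℝ] E :=
  LinearMap.mkContinuous
    { toFun := fun v ↦ (InnerProductSpace.toDual ℝ E).symm v
      map_add' := fun v w ↦ by simp
      map_smul' := fun c v ↦ by simp } 1 (fun v ↦ by simp)

@[simp] theorem inner_rieszMap {E : Type*} [NormedAddCommGroup E] [InnerProductSpace ℝ E]
    [CompleteSpace E] (v : E →L[ℝ] ℝ) (w : E) : ⟪rieszMap E v, w⟫ = v w :=
  InnerProductSpace.toDual_symm_apply

/-- The Hessian at `0`, as a linear operator. -/
def hessianMap {E : Type*} [NormedAddCommGroup E] [InnerProductSpace ℝ E] [CompleteSpace E]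
    (h : E → ℝ) : E →L[ℝ] E :=
  (rieszMap E).comp (fderiv ℝ (fderiv ℝ h) 0)

section Gradient

variable {E : Type*} [NormedAddCommGroup E] [InnerProductSpace ℝ E] [CompleteSpace E] {h : E → ℝ}

theorem contDiffAt_gradient {w : E} (hC : ContDiffAt ℝ 2 h w) : ContDiffAt ℝ 1 (∇ h) w :=
  (rieszMap E).contDiff.contDiffAt.comp w (hC.fderiv_right (by norm_num))

theorem hasFDerivAt_gradient_zero (hC : ContDiffAt ℝ 2 h 0) :
    HasFDerivAt (∇ h) (hessianMap h) 0 :=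
  (rieszMap E).hasFDerivAt.comp 0
    (((hC.fderiv_right (m := 1) (by norm_num)).differentiableAt (by norm_num)).hasFDerivAt)

end Gradient

theorem contDiffAt_graphNormal {n : Space d} {h : Hyperplane n → ℝ} {w : Hyperplane n}
    (hC : ContDiffAt ℝ 2 h w) : ContDiffAt ℝ 1 (graphNormal n h) w := by
  have hG := contDiffAt_gradient hC
  have h1 : ContDiffAt ℝ 1 (fun w ↦ (√(1 + ‖∇ h w‖ ^ 2))⁻¹) w :=
    ((contDiffAt_const.add (hG.norm_sq ℝ)).sqrt (by positivity)).inv (by positivity)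
  exact h1.smul (contDiffAt_const.sub ((Hyperplane n).subtypeL.contDiff.contDiffAt.comp w hG))

/-- At the centre of a local graph, the differential of the unit normal is minus the Hessian. -/
theorem hasFDerivAt_graphNormal_zero {n : Space d} {h : Hyperplane n → ℝ}
    (hC : ContDiffAt ℝ 2 h 0) (hd : fderiv ℝ h 0 = 0) :
    HasFDerivAt (graphNormal n h) (-((Hyperplane n).subtypeL.comp (hessianMap h))) 0 := by
  have hG := hasFDerivAt_gradient_zero hC
  have hG0 : ∇ h 0 = 0 := by simp [gradient, hd]
  have h1 : HasFDerivAt (fun w ↦ (√(1 + ‖∇ h w‖ ^ 2))⁻¹) (0 : Hyperplane n →L[ℝ] ℝ) 0 := by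
    have e1 : HasFDerivAt (fun w ↦ ‖∇ h w‖ ^ 2) (0 : Hyperplane n →L[ℝ] ℝ) 0 := by
      have := hG.norm_sq
      rw [hG0] at this
      refine this.congr_fderiv ?_
      ext v
      simp
    have e2 : DifferentiableAt ℝ (fun u : ℝ ↦ (√(1 + u))⁻¹) (‖∇ h 0‖ ^ 2) := by
      refine DifferentiableAt.inv ?_ (by positivity)
      exact DifferentiableAt.sqrt (by fun_prop) (by positivity)
    have := e2.hasDerivAt.comp_hasFDerivAt (0 : Hyperplane n) e1
    rw [smul_zero] at this
    exact this
  have h2 : HasFDerivAt (fun w ↦ n - ((∇ h w : Hyperplane n) : Space d))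
      (-((Hyperplane n).subtypeL.comp (hessianMap h))) 0 :=
    ((Hyperplane n).subtypeL.hasFDerivAt.comp 0 hG).const_sub n
  refine (h1.smul h2).congr_fderiv ?_
  ext v
  simp [hG0]

/-- The point of the graph of `h` above `w`. -/
def graphPoint (y n : Space d) (h : Hyperplane n → ℝ) (w : Hyperplane n) : Space d :=
  y + (w : Space d) + h w • n

theorem contDiffAt_graphPoint {y n : Space d} {h : Hyperplane n → ℝ} {w : Hyperplane n}
    {m : WithTop ℕ∞} (hC : ContDiffAt ℝ m h w) : ContDiffAt ℝ m (graphPoint y n h) w :=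
  (contDiffAt_const.add (Hyperplane n).subtypeL.contDiff.contDiffAt).add (hC.smul contDiffAt_const)

theorem hasFDerivAt_graphPoint {y n : Space d} {h : Hyperplane n → ℝ} {w : Hyperplane n}
    (hd : DifferentiableAt ℝ h w) : HasFDerivAt (graphPoint y n h)
      ((Hyperplane n).subtypeL + (fderiv ℝ h w).smulRight n) w :=
  ((Hyperplane n).subtypeL.hasFDerivAt.const_add y).add (hd.hasFDerivAt.smul_const n)

/-- Normal coordinates: `s` is the distance travelled along the unit normal from the point of the
graph above `w`. -/
def normalChart (y n : Space d) (h : Hyperplane n → ℝ) (p : Hyperplane n × ℝ) : Space d :=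
  graphPoint y n h p.1 + p.2 • graphNormal n h p.1

theorem contDiffAt_normalChart {y n : Space d} {h : Hyperplane n → ℝ} {p : Hyperplane n × ℝ}
    (hC : ContDiffAt ℝ 2 h p.1) : ContDiffAt ℝ 1 (normalChart y n h) p :=
  ((contDiffAt_graphPoint (hC.of_le (by norm_num))).comp p contDiffAt_fst).add
    (contDiffAt_snd.smul ((contDiffAt_graphNormal hC).comp p contDiffAt_fst))

theorem hasFDerivAt_normalChart {y n : Space d} {h : Hyperplane n → ℝ} {p : Hyperplane n × ℝ}
    (hC : ContDiffAt ℝ 2 h p.1) : HasFDerivAt (normalChart y n h)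
      ((fderiv ℝ (graphPoint y n h) p.1 + p.2 • fderiv ℝ (graphNormal n h) p.1).comp
        (ContinuousLinearMap.fst ℝ _ _) +
        (ContinuousLinearMap.snd ℝ _ _).smulRight (graphNormal n h p.1)) p := by
  have h1 := ((contDiffAt_graphPoint (y := y) (m := 2) hC).differentiableAt
    (by norm_num)).hasFDerivAt.comp p hasFDerivAt_fst
  have h2 := ((contDiffAt_graphNormal hC).differentiableAt (by norm_num)).hasFDerivAt.comp p
    hasFDerivAt_fst
  refine (h1.add (hasFDerivAt_snd.smul h2)).congr_fderiv ?_
  ext v <;> simp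

theorem fderiv_normalChart_apply {y n : Space d} {h : Hyperplane n → ℝ} {p : Hyperplane n × ℝ}
    (hC : ContDiffAt ℝ 2 h p.1) (v : Hyperplane n × ℝ) : fderiv ℝ (normalChart y n h) p v =
      fderiv ℝ (graphPoint y n h) p.1 v.1 + p.2 • fderiv ℝ (graphNormal n h) p.1 v.1 +
        v.2 • graphNormal n h p.1 := by
  rw [(hasFDerivAt_normalChart hC).fderiv]; simp

/-- The Jacobian determinant of the normal coordinates, computed in the volume preserving
coordinates `graphCoord`. -/
def chartJac (n : Space d) (hn : ‖n‖ = 1) (h : Hyperplane n → ℝ) (p : Hyperplane n × ℝ) : ℝ :=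
  (((graphCoord n hn).symm : Space d →L[ℝ] Hyperplane n × ℝ).comp
    (fderiv ℝ (normalChart 0 n h) p)).det

theorem fderiv_normalChart_eq (y n : Space d) (h : Hyperplane n → ℝ) (p : Hyperplane n × ℝ) :
    fderiv ℝ (normalChart y n h) p = fderiv ℝ (normalChart 0 n h) p := by
  have : normalChart y n h = fun p ↦ y + normalChart 0 n h p := by
    funext p; simp only [normalChart, graphPoint]; abel
  rw [this, fderiv_const_add]

theorem continuousAt_chartJac {n : Space d} (hn : ‖n‖ = 1) {h : Hyperplane n → ℝ}
    {p : Hyperplane n × ℝ} (hC : ContDiffAt ℝ 2 h p.1) : ContinuousAt (chartJac n hn h) p := by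
  have h1 : ContinuousAt (fderiv ℝ (normalChart 0 n h)) p :=
    ((contDiffAt_normalChart hC).fderiv_right (m := 0) (by norm_num)).continuousAt
  exact ContinuousLinearMap.continuous_det.continuousAt.comp
    (continuousAt_const.clm_comp h1)

theorem chartJac_zero {n : Space d} (hn : ‖n‖ = 1) {h : Hyperplane n → ℝ}
    (hC : ContDiffAt ℝ 2 h 0) (hd : fderiv ℝ h 0 = 0) : chartJac n hn h 0 = 1 := by
  have : ((graphCoord n hn).symm : Space d →L[ℝ] Hyperplane n × ℝ).comp
      (fderiv ℝ (normalChart 0 n h) 0) = ContinuousLinearMap.id ℝ _ := by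
    have h0 : graphNormal n h 0 = n := by
      have : ∇ h 0 = 0 := by simp [gradient, hd]
      simp [graphNormal, this]
    have h1 : fderiv ℝ (normalChart 0 n h) 0 = (graphCoord n hn : _ →L[ℝ] Space d) := by
      refine ContinuousLinearMap.ext fun v ↦ ?_
      rw [fderiv_normalChart_apply (by simpa using hC)]
      have := (hasFDerivAt_graphPoint (y := 0) (n := n) (hC.differentiableAt (by norm_num))).fderiv
      simp [this, hd, h0]
    rw [h1]
    refine ContinuousLinearMap.ext fun v ↦ ?_
    simp [-graphCoord_symm_apply, -graphCoord_apply]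
  rw [chartJac, this]
  simp [ContinuousLinearMap.det]

/-- The operator `1 - s H` on the tangent hyperplane, extended by the identity in the normal
direction, has determinant `∏ (1 - s κ_i)`. -/
theorem det_id_sub_smul_hessian {n : Space d} (hn : ‖n‖ = 1) {h : Hyperplane n → ℝ}
    {k : Fin (d - 1) → ℝ} (b : OrthonormalBasis (Fin (d - 1)) ℝ (Hyperplane n))
    (hb : ∀ i w, fderiv ℝ (fderiv ℝ h) 0 (b i) w = k i * inner ℝ (b i) w) (s : ℝ) :
    (ContinuousLinearMap.id ℝ (Space d) - s • ((Hyperplane n).subtypeL.comp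
      ((hessianMap h).comp (Hyperplane n).orthogonalProjectionOnto))).det = ∏ i, (1 - k i * s) := by
  have hHb : ∀ i, hessianMap h (b i) = k i • b i := fun i ↦ by
    refine ext_inner_right ℝ fun w ↦ ?_
    rw [hessianMap, ContinuousLinearMap.comp_apply, inner_rieszMap, hb, real_inner_smul_left]
  set M : Hyperplane n →ₗ[ℝ] Hyperplane n := LinearMap.id - s • (hessianMap h).toLinearMap with hM
  have h1 : LinearMap.det M = ∏ i, (1 - k i * s) := by
    rw [← LinearMap.det_toMatrix b.toBasis]
    have : LinearMap.toMatrix b.toBasis b.toBasis M = Matrix.diagonal fun i ↦ 1 - k i * s := by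
      ext i j
      rw [LinearMap.toMatrix_apply, Matrix.diagonal_apply]
      have : M (b.toBasis j) = (1 - k j * s) • b.toBasis j := by
        simp only [hM, OrthonormalBasis.coe_toBasis, LinearMap.sub_apply, LinearMap.id_apply,
          LinearMap.smul_apply, ContinuousLinearMap.coe_coe, hHb]
        module
      rw [this, map_smul, Module.Basis.repr_self, Finsupp.smul_apply, Finsupp.single_apply]
      by_cases hij : i = j
      · subst hij; simp
      · simp [hij, Ne.symm hij]
    rw [this, Matrix.det_diagonal]
  have h2 := LinearMap.det_conj (LinearMap.prodMap M (LinearMap.id : ℝ →ₗ[ℝ] ℝ))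
    (graphCoord n hn).toLinearEquiv
  rw [LinearMap.det_prodMap, LinearMap.det_id, mul_one, h1] at h2
  rw [← h2, ContinuousLinearMap.det]
  congr 1
  refine LinearMap.ext fun x ↦ ?_
  obtain ⟨p, rfl⟩ := (graphCoord n hn).surjective x
  have e1 : (graphCoord n hn).toLinearEquiv.symm (graphCoord n hn p) = p :=
    (graphCoord n hn).symm_apply_apply p
  have e2 : (Hyperplane n).orthogonalProjectionOnto (graphCoord n hn p) = p.1 := by
    have := congrArg Prod.fst ((graphCoord n hn).symm_apply_apply p)
    rwa [graphCoord_symm_apply] at this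
  simp only [LinearMap.comp_apply, LinearEquiv.coe_coe, e1, LinearMap.prodMap_apply,
    ContinuousLinearMap.coe_coe, sub_apply, smul_apply, ContinuousLinearMap.id_apply,
    ContinuousLinearMap.comp_apply, e2]
  change _ = graphCoord n hn (M p.1, p.2)
  simp only [graphCoord_apply, hM, LinearMap.sub_apply, LinearMap.id_apply, LinearMap.smul_apply,
    ContinuousLinearMap.coe_coe, Submodule.coe_sub, Submodule.coe_smul, Submodule.subtypeL_apply]
  abel

/-- On the ball of radius `δ` the set is the region above the graph of `h`, in a slab of height `ρ`
around the base hyperplane. -/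
structure IsGraphOn (Ω : Set (Space d)) (y n : Space d) (h : Hyperplane n → ℝ) (δ ρ : ℝ) : Prop where
  isOpen : IsOpen Ω
  norm_eq : ‖n‖ = 1
  contDiffOn : ContDiffOn ℝ 2 h (Metric.ball 0 δ)
  abs_lt : ∀ w ∈ Metric.ball (0 : Hyperplane n) δ, |h w| < ρ
  mem_iff : ∀ w ∈ Metric.ball (0 : Hyperplane n) δ, ∀ s : ℝ, |s| < ρ →
    (y + (w : Space d) + s • n ∈ Ω ↔ h w < s)
  mem_frontier_iff : ∀ w ∈ Metric.ball (0 : Hyperplane n) δ, ∀ s : ℝ, |s| < ρ →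
    (y + (w : Space d) + s • n ∈ frontier Ω ↔ s = h w)

theorem IsLocalGraph.exists_isGraphOn {Ω : Set (Space d)} (hΩ : IsOpen Ω) {y n : Space d}
    {h : Hyperplane n → ℝ} (hg : IsLocalGraph Ω y n h) : ∃ δ > 0, ∃ ρ > 0, IsGraphOn Ω y n h δ ρ := by
  obtain ⟨ρ, hρ, δ, hδ, h1, h2, h3⟩ := hg.exists_radius hΩ
  exact ⟨δ, hδ, ρ, hρ, hΩ, hg.norm_eq, h1, h2, fun w hw s hs ↦ (h3 w hw s hs).1,
    fun w hw s hs ↦ (h3 w hw s hs).2⟩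

namespace IsGraphOn

variable {Ω : Set (Space d)} {y n : Space d} {h : Hyperplane n → ℝ} {δ ρ : ℝ}

theorem mono (hg : IsGraphOn Ω y n h δ ρ) {δ' : ℝ} (hδ : δ' ≤ δ) : IsGraphOn Ω y n h δ' ρ :=
  have hs := Metric.ball_subset_ball (x := (0 : Hyperplane n)) hδ
  ⟨hg.isOpen, hg.norm_eq, hg.contDiffOn.mono hs, fun w hw ↦ hg.abs_lt w (hs hw),
    fun w hw ↦ hg.mem_iff w (hs hw), fun w hw ↦ hg.mem_frontier_iff w (hs hw)⟩

theorem contDiffAt (hg : IsGraphOn Ω y n h δ ρ) {w : Hyperplane n} (hw : w ∈ Metric.ball 0 δ) :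
    ContDiffAt ℝ 2 h w :=
  hg.contDiffOn.contDiffAt (Metric.isOpen_ball.mem_nhds hw)

theorem graphPoint_mem (hg : IsGraphOn Ω y n h δ ρ) {w : Hyperplane n}
    (hw : w ∈ Metric.ball 0 δ) : graphPoint y n h w ∈ frontier Ω :=
  (hg.mem_frontier_iff w hw _ (hg.abs_lt w hw)).2 rfl

theorem isInwardNormal (hg : IsGraphOn Ω y n h δ ρ) {w : Hyperplane n}
    (hw : w ∈ Metric.ball 0 δ) : IsInwardNormal Ω (graphPoint y n h w) (graphNormal n h w) := by
  refine isInwardNormal_graphNormal hg.norm_eq ((hg.contDiffAt hw).differentiableAt (by norm_num)) ?_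
  have e1 : ∀ᶠ p : Hyperplane n × ℝ in 𝓝 (w, h w), p.1 ∈ Metric.ball (0 : Hyperplane n) δ :=
    continuousAt_fst.eventually (Metric.isOpen_ball.mem_nhds hw)
  have e2 : ∀ᶠ p : Hyperplane n × ℝ in 𝓝 (w, h w), |p.2| < ρ :=
    continuousAt_snd.abs.eventually (gt_mem_nhds (hg.abs_lt w hw))
  filter_upwards [e1, e2] with p h1 h2
  exact hg.mem_iff _ h1 _ h2

theorem proj_graphPoint (hg : IsGraphOn Ω y n h δ ρ) (w : Hyperplane n) :
    (graphCoord n hg.norm_eq).symm (graphPoint y n h w - y) = (w, h w) := by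
  rw [ContinuousLinearEquiv.symm_apply_eq, graphCoord_apply, graphPoint]
  simp only
  abel

theorem injective_graphPoint (hg : IsGraphOn Ω y n h δ ρ) :
    Function.Injective (graphPoint y n h) := fun w w' hww ↦ by
  have := hg.proj_graphPoint w
  rw [hww, hg.proj_graphPoint w'] at this
  exact (congrArg Prod.fst this).symm

/-- Boundary points near a point of the graph lie on the graph. -/
theorem eventually_mem_image (hg : IsGraphOn Ω y n h δ ρ) {w : Hyperplane n}
    (hw : w ∈ Metric.ball 0 δ) : ∀ᶠ q in 𝓝 (graphPoint y n h w), q ∈ frontier Ω →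
      (Hyperplane n).orthogonalProjectionOnto (q - y) ∈ Metric.ball (0 : Hyperplane n) δ ∧
      q = graphPoint y n h ((Hyperplane n).orthogonalProjectionOnto (q - y)) := by
  have hc : Continuous fun q ↦ (graphCoord n hg.norm_eq).symm (q - y) := by fun_prop
  have h0 := hc.tendsto (graphPoint y n h w)
  rw [hg.proj_graphPoint] at h0
  have e1 : ∀ᶠ p : Hyperplane n × ℝ in 𝓝 (w, h w), p.1 ∈ Metric.ball (0 : Hyperplane n) δ :=
    continuousAt_fst.eventually (Metric.isOpen_ball.mem_nhds hw)
  have e2 : ∀ᶠ p : Hyperplane n × ℝ in 𝓝 (w, h w), |p.2| < ρ :=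
    continuousAt_snd.abs.eventually (gt_mem_nhds (hg.abs_lt w hw))
  filter_upwards [h0.eventually (e1.and e2)] with q hq hqf
  have hqe : q = y + ((graphCoord n hg.norm_eq).symm (q - y)).1 +
      ((graphCoord n hg.norm_eq).symm (q - y)).2 • n := by
    have := (graphCoord n hg.norm_eq).apply_symm_apply (q - y)
    rw [graphCoord_apply] at this
    rw [add_assoc, this]; abel
  rw [graphCoord_symm_apply] at hq hqe
  refine ⟨hq.1, ?_⟩
  rw [hqe] at hqf
  have := (hg.mem_frontier_iff _ hq.1 _ hq.2).1 hqf
  rw [graphPoint, ← this]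
  exact hqe

/-- The Weingarten equation: the differential of the unit normal is expressed through the Hessian of
any other graph representation centred at the point. -/
theorem hasFDerivAt_graphNormal (hg : IsGraphOn Ω y n h δ ρ) {w : Hyperplane n}
    (hw : w ∈ Metric.ball 0 δ) {n' : Space d} {h' : Hyperplane n' → ℝ}
    (hg' : IsLocalGraph Ω (graphPoint y n h w) n' h') :
    HasFDerivAt (graphNormal n h) (-(((Hyperplane n').subtypeL.comp
      ((hessianMap h').comp (Hyperplane n').orthogonalProjectionOnto)).comp
        (fderiv ℝ (graphPoint y n h) w))) w := by
  obtain ⟨δ', hδ', ρ', hρ', hG'⟩ := hg'.exists_isGraphOn hg.isOpen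
  have hdφ : DifferentiableAt ℝ (graphPoint y n h) w :=
    (contDiffAt_graphPoint (hg.contDiffAt hw)).differentiableAt (by norm_num)
  set q := graphPoint y n h w with hq
  have hq0 : graphPoint q n' h' 0 = q := by simp [graphPoint, hg'.zero]
  -- near `q` the unit normal is a function of the boundary point, computable in the chart at `q`
  have hθ : HasFDerivAt (fun w' ↦ (Hyperplane n').orthogonalProjectionOnto
      (graphPoint y n h w' - q))
      ((Hyperplane n').orthogonalProjectionOnto.comp (fderiv ℝ (graphPoint y n h) w)) w :=
    (Hyperplane n').orthogonalProjectionOnto.hasFDerivAt.comp w (hdφ.hasFDerivAt.sub_const q)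
  have hν' := hasFDerivAt_graphNormal_zero hg'.contDiffAt hg'.fderiv_zero
  have h0 : (Hyperplane n').orthogonalProjectionOnto (graphPoint y n h w - q) = 0 := by
    rw [← hq, sub_self, map_zero]
  rw [← h0] at hν'
  have hcomp := hν'.comp w hθ
  refine (hcomp.congr_of_eventuallyEq ?_).congr_fderiv (by ext v; simp)
  have hev := hG'.eventually_mem_image (Metric.mem_ball_self hδ')
  rw [hq0] at hev
  filter_upwards [hdφ.continuousAt.eventually hev, Metric.isOpen_ball.mem_nhds hw] with w' h1 h2
  obtain ⟨h3, h4⟩ := h1 (hg.graphPoint_mem h2)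
  have h5 := hG'.isInwardNormal h3
  rw [← h4] at h5
  exact h5.eq (hg.isInwardNormal h2)

/-- The Jacobian of the normal coordinates at height `s` is the Jacobian at height `0` multiplied by
`∏ (1 - κ_i s)`. -/
theorem chartJac_eq (hg : IsGraphOn Ω y n h δ ρ) {w : Hyperplane n} (hw : w ∈ Metric.ball 0 δ)
    {k : Fin (d - 1) → ℝ} (hk : IsPrincipalCurvatures Ω (graphPoint y n h w) k) (s : ℝ) :
    chartJac n hg.norm_eq h (w, s) = chartJac n hg.norm_eq h (w, 0) * ∏ i, (1 - k i * s) := by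
  obtain ⟨n', h', hg', b, hb⟩ := isPrincipalCurvatures_iff.1 hk
  have hC := hg.contDiffAt hw
  set S := (Hyperplane n').subtypeL.comp
      ((hessianMap h').comp (Hyperplane n').orthogonalProjectionOnto) with hS
  have hdν := (hg.hasFDerivAt_graphNormal hw hg').fderiv
  rw [← hS] at hdν
  have hnn : graphNormal n h w = n' := hg'.isInwardNormal.eq (hg.isInwardNormal hw)
  have hSn : S n' = 0 := by
    have : (Hyperplane n').orthogonalProjectionOnto n' = 0 := by
      rw [Submodule.orthogonalProjectionOnto_eq_zero_iff]
      exact Submodule.le_orthogonal_orthogonal _ (Submodule.mem_span_singleton_self n')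
    simp [hS, this]
  -- the differential at height `s` is the one at height `0` followed by `1 - s S`
  have hfac : fderiv ℝ (normalChart 0 n h) (w, s) =
      (ContinuousLinearMap.id ℝ (Space d) - s • S).comp (fderiv ℝ (normalChart 0 n h) (w, 0)) := by
    rw [← fderiv_normalChart_eq y, ← fderiv_normalChart_eq y]
    refine ContinuousLinearMap.ext fun v ↦ ?_
    rw [ContinuousLinearMap.comp_apply, fderiv_normalChart_apply (p := (w, s)) hC,
      fderiv_normalChart_apply (p := (w, 0)) hC]
    simp only [hdν, hnn, sub_apply, smul_apply, neg_apply, ContinuousLinearMap.id_apply,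
      ContinuousLinearMap.comp_apply, map_add, map_smul, zero_smul, add_zero, hSn, smul_zero]
    module
  have hdet := det_id_sub_smul_hessian hg'.norm_eq b hb s
  rw [← hS] at hdet
  set G := graphCoord n hg.norm_eq
  rw [chartJac, chartJac, hfac, ← hdet]
  have e : (G.symm : Space d →L[ℝ] Hyperplane n × ℝ).comp
      ((ContinuousLinearMap.id ℝ (Space d) - s • S).comp (fderiv ℝ (normalChart 0 n h) (w, 0))) =
      ((G.symm : Space d →L[ℝ] Hyperplane n × ℝ).comp
        ((ContinuousLinearMap.id ℝ (Space d) - s • S).comp (G : _ →L[ℝ] Space d))).comp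
        ((G.symm : Space d →L[ℝ] Hyperplane n × ℝ).comp (fderiv ℝ (normalChart 0 n h) (w, 0))) := by
    exact ContinuousLinearMap.ext fun v ↦ by simp [-graphCoord_symm_apply, -graphCoord_apply]
  rw [e, ContinuousLinearMap.det, ContinuousLinearMap.det, ContinuousLinearMap.det,
    ContinuousLinearMap.toLinearMap_comp, LinearMap.det_comp, mul_comm]
  congr 1
  exact LinearMap.det_conj (ContinuousLinearMap.id ℝ (Space d) - s • S).toLinearMap
    G.symm.toLinearEquiv

end IsGraphOn

end CurvedTrace

end

noncomputable section

namespace CurvedTrace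

variable {d : ℕ}

/-! ### Normal coordinates on the boundary layer -/

/-- A graph representation of the boundary of a uniformly `C²` set whose layer of width `R` has
unique nearest boundary points, on a ball so small that the area element of the graph does not
vanish (with the sign convention of `chartJac`). -/
structure IsNormalChart (Ω : Set (Space d)) (R : ℝ) (y n : Space d) (h : Hyperplane n → ℝ)
    (δ ρ : ℝ) : Prop extends IsGraphOn Ω y n h δ ρ where
  smooth : IsUniformlyC2 Ω
  unique : HasUniqueProj Ω R
  jac_pos : ∀ w ∈ Metric.ball (0 : Hyperplane n) δ, 0 < chartJac n norm_eq h (w, 0)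

namespace IsNormalChart

variable {Ω : Set (Space d)} {R : ℝ} {y n : Space d} {h : Hyperplane n → ℝ} {δ ρ : ℝ}

theorem mono (hc : IsNormalChart Ω R y n h δ ρ) {δ' : ℝ} (hδ : δ' ≤ δ) :
    IsNormalChart Ω R y n h δ' ρ :=
  ⟨hc.toIsGraphOn.mono hδ, hc.smooth, hc.unique,
    fun w hw ↦ hc.jac_pos w (Metric.ball_subset_ball hδ hw)⟩

theorem mem_and_bdryDist (hc : IsNormalChart Ω R y n h δ ρ) {p : Hyperplane n × ℝ}
    (hp : p ∈ Metric.ball (0 : Hyperplane n) δ ×ˢ Ioo 0 R) :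
    normalChart y n h p ∈ Ω ∧ bdryDist Ω (normalChart y n h p) = p.2 :=
  hc.unique.bdryDist_normal hc.smooth (hc.graphPoint_mem hp.1) (hc.isInwardNormal hp.1)
    hp.2.1 hp.2.2

theorem bdryProj_normalChart (hc : IsNormalChart Ω R y n h δ ρ) {p : Hyperplane n × ℝ}
    (hp : p ∈ Metric.ball (0 : Hyperplane n) δ ×ˢ Ioo 0 R) :
    bdryProj Ω (normalChart y n h p) = graphPoint y n h p.1 :=
  hc.unique.bdryProj_normal hc.smooth (hc.graphPoint_mem hp.1) (hc.isInwardNormal hp.1)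
    hp.2.1 hp.2.2

/-- A point determines its coordinates: its nearest boundary point and its distance to the
boundary. -/
theorem injOn (hc : IsNormalChart Ω R y n h δ ρ) :
    InjOn (normalChart y n h) (Metric.ball (0 : Hyperplane n) δ ×ˢ Ioo 0 R) := by
  intro p hp q hq hpq
  have h1 := hc.bdryProj_normalChart hp
  have h2 := (hc.mem_and_bdryDist hp).2
  rw [hpq, hc.bdryProj_normalChart hq] at h1
  rw [hpq, (hc.mem_and_bdryDist hq).2] at h2
  exact Prod.ext (hc.injective_graphPoint h1.symm) h2.symm

/-- The normal coordinates parametrize the part of the layer lying over a piece of the boundary. -/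
theorem image_eq (hc : IsNormalChart Ω R y n h δ ρ) {A : Set (Hyperplane n)}
    (hA : A ⊆ Metric.ball 0 δ) {t : ℝ} (ht : t ≤ R) :
    normalChart y n h '' (A ×ˢ Ioo 0 t) =
      {x ∈ layer Ω t | bdryProj Ω x ∈ graphPoint y n h '' A} := by
  ext x
  constructor
  · rintro ⟨p, ⟨hp1, hp2⟩, rfl⟩
    have hp : p ∈ Metric.ball (0 : Hyperplane n) δ ×ˢ Ioo 0 R :=
      ⟨hA hp1, hp2.1, hp2.2.trans_le ht⟩
    have h1 := hc.mem_and_bdryDist hp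
    refine ⟨⟨h1.1, h1.2.trans_lt hp2.2⟩, ?_⟩
    rw [hc.bdryProj_normalChart hp]
    exact mem_image_of_mem _ hp1
  · rintro ⟨⟨hxΩ, hxt⟩, w, hw, hwx⟩
    have hxR : x ∈ layer Ω R := ⟨hxΩ, hxt.trans_le ht⟩
    have hpr := hc.unique.bdryProj_spec hxR
    rw [← hwx] at hpr
    have hx := eq_add_smul_normal hc.isOpen hxΩ hpr (hc.isInwardNormal (hA hw))
    exact ⟨(w, bdryDist Ω x), ⟨hw, bdryDist_pos hc.isOpen ⟨_, hpr.1⟩ hxΩ, hxt⟩, hx.symm⟩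

theorem isPrincipalCurvatures (hc : IsNormalChart Ω R y n h δ ρ) {w : Hyperplane n}
    (hw : w ∈ Metric.ball 0 δ) : IsPrincipalCurvatures Ω (graphPoint y n h w)
      (principalCurvatures Ω (graphPoint y n h w)) :=
  Classical.epsilon_spec (hc.smooth.exists_isPrincipalCurvatures (hc.graphPoint_mem hw))

theorem chartJac_pos (hc : IsNormalChart Ω R y n h δ ρ) {p : Hyperplane n × ℝ}
    (hp : p ∈ Metric.ball (0 : Hyperplane n) δ ×ˢ Ico 0 R) : 0 < chartJac n hc.norm_eq h p := by
  have hk := hc.isPrincipalCurvatures hp.1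
  rw [← Prod.mk.eta (p := p), hc.chartJac_eq hp.1 hk]
  refine mul_pos (hc.jac_pos _ hp.1) (Finset.prod_pos fun i _ ↦ ?_)
  linarith [hc.unique.curvature_mul_lt_one hc.smooth hk hp.2.1 hp.2.2 i]

/-- The weight of the trace inequality is a quotient of Jacobians. -/
theorem weight_normalChart (hc : IsNormalChart Ω R y n h δ ρ) {p : Hyperplane n × ℝ}
    (hp : p ∈ Metric.ball (0 : Hyperplane n) δ ×ˢ Ioo 0 R) : weight Ω (normalChart y n h p) =
      chartJac n hc.norm_eq h (p.1, 0) / chartJac n hc.norm_eq h p := by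
  have hk := hc.isPrincipalCurvatures hp.1
  have h0 := hc.jac_pos _ hp.1
  have h1 := hc.chartJac_eq hp.1 hk p.2
  rw [weight, hc.bdryProj_normalChart hp, (hc.mem_and_bdryDist hp).2, Finset.prod_div_distrib,
    Finset.prod_const_one, ← Prod.mk.eta (p := p), h1, div_mul_eq_div_div, div_self h0.ne']

theorem contDiffAt_normalChart (hc : IsNormalChart Ω R y n h δ ρ) {p : Hyperplane n × ℝ}
    (hp : p.1 ∈ Metric.ball (0 : Hyperplane n) δ) : ContDiffAt ℝ 1 (normalChart y n h) p :=
  CurvedTrace.contDiffAt_normalChart (hc.contDiffAt hp)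

theorem exists_hasStrictFDerivAt (hc : IsNormalChart Ω R y n h δ ρ) {p : Hyperplane n × ℝ}
    (hp : p ∈ Metric.ball (0 : Hyperplane n) δ ×ˢ Ioo 0 R) :
    ∃ L : (Hyperplane n × ℝ) ≃L[ℝ] Space d,
      HasStrictFDerivAt (normalChart y n h) (L : (Hyperplane n × ℝ) →L[ℝ] Space d) p := by
  have hJ := hc.chartJac_pos (p := p) ⟨hp.1, hp.2.1.le, hp.2.2⟩
  have h1 := (hc.contDiffAt_normalChart hp.1).hasStrictFDerivAt (by norm_num)
  set L := (ContinuousLinearMap.toContinuousLinearEquivOfDetNeZero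
    (((graphCoord n hc.norm_eq).symm : Space d →L[ℝ] Hyperplane n × ℝ).comp
      (fderiv ℝ (normalChart 0 n h) p)) hJ.ne').trans (graphCoord n hc.norm_eq)
  have hL : (L : (Hyperplane n × ℝ) →L[ℝ] Space d) = fderiv ℝ (normalChart y n h) p := by
    refine ContinuousLinearMap.ext fun v ↦ ?_
    rw [fderiv_normalChart_eq]
    change graphCoord n hc.norm_eq ((graphCoord n hc.norm_eq).symm
      (fderiv ℝ (normalChart 0 n h) p v)) = _
    rw [ContinuousLinearEquiv.apply_symm_apply]
  exact ⟨L, hL ▸ h1⟩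

theorem map_nhds (hc : IsNormalChart Ω R y n h δ ρ) {p : Hyperplane n × ℝ}
    (hp : p ∈ Metric.ball (0 : Hyperplane n) δ ×ˢ Ioo 0 R) :
    map (normalChart y n h) (𝓝 p) = 𝓝 (normalChart y n h p) := by
  obtain ⟨L, hL⟩ := hc.exists_hasStrictFDerivAt hp
  exact hL.map_nhds_eq_of_equiv

theorem isOpen_source (δ R : ℝ) : IsOpen (Metric.ball (0 : Hyperplane n) δ ×ˢ Ioo 0 R) :=
  Metric.isOpen_ball.prod isOpen_Ioo

theorem isOpen_image (hc : IsNormalChart Ω R y n h δ ρ) {s : Set (Hyperplane n × ℝ)} (hs : IsOpen s)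
    (hsub : s ⊆ Metric.ball (0 : Hyperplane n) δ ×ˢ Ioo 0 R) : IsOpen (normalChart y n h '' s) := by
  rw [isOpen_iff_mem_nhds]
  rintro _ ⟨p, hp, rfl⟩
  rw [← hc.map_nhds (hsub hp)]
  exact image_mem_map (hs.mem_nhds hp)

/-- The normal coordinates as a homeomorphism onto an open part of the layer. -/
def homeo (hc : IsNormalChart Ω R y n h δ ρ) : OpenPartialHomeomorph (Hyperplane n × ℝ) (Space d) :=
  OpenPartialHomeomorph.ofContinuousOpenRestrict (hc.injOn.toPartialEquiv _ _)
    (fun _ hp ↦ (hc.contDiffAt_normalChart hp.1).continuousAt.continuousWithinAt)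
    (fun s hs ↦ by
      have h1 : IsOpen ((↑) '' s : Set (Hyperplane n × ℝ)) := by
        exact (isOpen_source δ R).isOpenMap_subtype_val s hs
      have h2 := hc.isOpen_image h1 (by rintro _ ⟨p, -, rfl⟩; exact p.2)
      rw [image_image] at h2
      exact h2)
    (isOpen_source δ R)

theorem homeo_apply (hc : IsNormalChart Ω R y n h δ ρ) (p : Hyperplane n × ℝ) :
    hc.homeo p = normalChart y n h p := rfl

theorem homeo_symm_normalChart (hc : IsNormalChart Ω R y n h δ ρ) {p : Hyperplane n × ℝ}
    (hp : p ∈ Metric.ball (0 : Hyperplane n) δ ×ˢ Ioo 0 R) :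
    hc.homeo.symm (normalChart y n h p) = p :=
  hc.homeo.left_inv hp

/-- In normal coordinates the gradient of the distance to the boundary is the unit normal. -/
theorem gradient_bdryDist (hc : IsNormalChart Ω R y n h δ ρ) {p : Hyperplane n × ℝ}
    (hp : p ∈ Metric.ball (0 : Hyperplane n) δ ×ˢ Ioo 0 R) :
    ∇ (bdryDist Ω) (normalChart y n h p) = graphNormal n h p.1 := by
  obtain ⟨L, hL⟩ := hc.exists_hasStrictFDerivAt hp
  have hnear := (isOpen_source δ R).mem_nhds hp
  -- the distance is the last coordinate of the inverse map
  have hdiff : DifferentiableAt ℝ (bdryDist Ω) (normalChart y n h p) := by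
    have h1 := hL.to_localInverse.hasFDerivAt
    have h2 : DifferentiableAt ℝ (fun x ↦ (hL.localInverse _ _ _ x).2) (normalChart y n h p) :=
      differentiableAt_snd.comp _ h1.differentiableAt
    refine h2.congr_of_eventuallyEq ?_
    have h3 := hL.localInverse_continuousAt.eventually (by
      rw [hL.localInverse_apply_image]; exact hnear)
    filter_upwards [h3, hL.eventually_right_inverse] with x hx hx'
    rw [← (hc.mem_and_bdryDist hx).2, hx']
  have hν1 : ‖graphNormal n h p.1‖ = 1 := (hc.isInwardNormal hp.1).norm_eq
  have hline : HasDerivAt (fun s : ℝ ↦ graphPoint y n h p.1 + s • graphNormal n h p.1)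
      (graphNormal n h p.1) p.2 := by
    simpa using ((hasDerivAt_id p.2).smul_const (graphNormal n h p.1)).const_add
      (graphPoint y n h p.1)
  have hder : fderiv ℝ (bdryDist Ω) (normalChart y n h p) (graphNormal n h p.1) = 1 := by
    have h1 := hdiff.hasFDerivAt.comp_hasDerivAt p.2 hline
    have h2 : HasDerivAt (fun s : ℝ ↦ s) 1 p.2 := hasDerivAt_id _
    refine h1.unique (h2.congr_of_eventuallyEq ?_)
    filter_upwards [isOpen_Ioo.mem_nhds hp.2] with s hs
    exact (hc.mem_and_bdryDist (p := (p.1, s)) ⟨hp.1, hs⟩).2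
  -- a vector of norm at most one whose product with a unit vector is one
  have hle := norm_gradient_bdryDist_le Ω (normalChart y n h p)
  have hin : ⟪graphNormal n h p.1, ∇ (bdryDist Ω) (normalChart y n h p)⟫ = 1 := by
    rw [inner_gradient_right_eq_fderiv, hder]
  have h0 : ‖∇ (bdryDist Ω) (normalChart y n h p) - graphNormal n h p.1‖ ^ 2 ≤ 0 := by
    rw [norm_sub_sq_real, hν1, real_inner_comm, hin]
    nlinarith [norm_nonneg (∇ (bdryDist Ω) (normalChart y n h p))]
  exact sub_eq_zero.1 (norm_eq_zero.1 (pow_eq_zero_iff two_ne_zero |>.1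
    (le_antisymm h0 (sq_nonneg _))))

/-! ### Change of variables -/

section ChangeOfVariables

variable {S : Set (Hyperplane n × ℝ)}

theorem image_graphCoord (hn : ‖n‖ = 1) : normalChart y n h '' S = graphCoord n hn ''
    ((fun p ↦ (graphCoord n hn).symm (normalChart y n h p)) '' S) := by
  rw [image_image]
  simp only [ContinuousLinearEquiv.apply_symm_apply]

theorem hasFDerivWithinAt_coord (hc : IsNormalChart Ω R y n h δ ρ) {p : Hyperplane n × ℝ}
    (hp : p ∈ Metric.ball (0 : Hyperplane n) δ ×ˢ Ioo 0 R) :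
    HasFDerivWithinAt (fun p ↦ (graphCoord n hc.norm_eq).symm (normalChart y n h p))
      (((graphCoord n hc.norm_eq).symm : Space d →L[ℝ] Hyperplane n × ℝ).comp
        (fderiv ℝ (normalChart 0 n h) p)) S p := by
  rw [← fderiv_normalChart_eq y]
  exact ((graphCoord n hc.norm_eq).symm.hasFDerivAt.comp p
    ((hc.contDiffAt_normalChart hp.1).differentiableAt (by norm_num)).hasFDerivAt).hasFDerivWithinAt

theorem injOn_coord (hc : IsNormalChart Ω R y n h δ ρ)
    (hS : S ⊆ Metric.ball (0 : Hyperplane n) δ ×ˢ Ioo 0 R) :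
    InjOn (fun p ↦ (graphCoord n hc.norm_eq).symm (normalChart y n h p)) S :=
  fun _ hp _ hq hpq ↦ hc.injOn (hS hp) (hS hq) ((graphCoord n hc.norm_eq).symm.injective hpq)

theorem lintegral_image (hc : IsNormalChart Ω R y n h δ ρ) (hSm : MeasurableSet S)
    (hS : S ⊆ Metric.ball (0 : Hyperplane n) δ ×ˢ Ioo 0 R) (G : Space d → ℝ≥0∞) :
    ∫⁻ x in normalChart y n h '' S, G x = ∫⁻ p in S,
      ENNReal.ofReal (chartJac n hc.norm_eq h p) * G (normalChart y n h p)
        ∂(volume.prod volume) := by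
  have hemb := (graphCoord n hc.norm_eq).toHomeomorph.measurableEmbedding
  rw [image_graphCoord hc.norm_eq]
  have h1 := (measurePreserving_graphCoord n hc.norm_eq).setLIntegral_comp_emb hemb G
    ((fun p ↦ (graphCoord n hc.norm_eq).symm (normalChart y n h p)) '' S)
  refine h1.symm.trans ?_
  rw [lintegral_image_eq_lintegral_abs_det_fderiv_mul _ hSm
    (fun p hp ↦ hc.hasFDerivWithinAt_coord (hS hp)) (hc.injOn_coord hS)]
  refine setLIntegral_congr_fun hSm fun p hp ↦ ?_
  have hJ := hc.chartJac_pos (p := p) ⟨(hS hp).1, (hS hp).2.1.le, (hS hp).2.2⟩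
  simp only [ContinuousLinearEquiv.apply_symm_apply]
  congr 2
  exact abs_of_pos hJ

theorem integral_image (hc : IsNormalChart Ω R y n h δ ρ) (hSm : MeasurableSet S)
    (hS : S ⊆ Metric.ball (0 : Hyperplane n) δ ×ˢ Ioo 0 R) (G : Space d → ℝ) :
    ∫ x in normalChart y n h '' S, G x = ∫ p in S,
      chartJac n hc.norm_eq h p * G (normalChart y n h p) ∂(volume.prod volume) := by
  have hemb := (graphCoord n hc.norm_eq).toHomeomorph.measurableEmbedding
  rw [image_graphCoord hc.norm_eq]
  have h1 := (measurePreserving_graphCoord n hc.norm_eq).setIntegral_image_emb hemb G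
    ((fun p ↦ (graphCoord n hc.norm_eq).symm (normalChart y n h p)) '' S)
  refine h1.trans ?_
  rw [integral_image_eq_integral_abs_det_fderiv_smul _ hSm
    (fun p hp ↦ hc.hasFDerivWithinAt_coord (hS hp)) (hc.injOn_coord hS)]
  refine setIntegral_congr_fun hSm fun p hp ↦ ?_
  have hJ := hc.chartJac_pos (p := p) ⟨(hS hp).1, (hS hp).2.1.le, (hS hp).2.2⟩
  simp only [ContinuousLinearEquiv.apply_symm_apply, smul_eq_mul]
  congr 1
  exact abs_of_pos hJ

theorem integrableOn_comp (hc : IsNormalChart Ω R y n h δ ρ) (hSm : MeasurableSet S)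
    (hS : S ⊆ Metric.ball (0 : Hyperplane n) δ ×ˢ Ioo 0 R) {G : Space d → ℝ}
    (hG : IntegrableOn G (normalChart y n h '' S)) :
    IntegrableOn (fun p ↦ chartJac n hc.norm_eq h p * G (normalChart y n h p)) S
      (volume.prod volume) := by
  have hemb := (graphCoord n hc.norm_eq).toHomeomorph.measurableEmbedding
  rw [image_graphCoord hc.norm_eq] at hG
  have h1 := ((measurePreserving_graphCoord n hc.norm_eq).integrableOn_image hemb).1 hG
  rw [integrableOn_image_iff_integrableOn_abs_det_fderiv_smul _ hSm
    (fun p hp ↦ hc.hasFDerivWithinAt_coord (hS hp)) (hc.injOn_coord hS)] at h1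
  refine h1.congr_fun (fun p hp ↦ ?_) hSm
  have hJ := hc.chartJac_pos (p := p) ⟨(hS hp).1, (hS hp).2.1.le, (hS hp).2.2⟩
  simp only [Function.comp_apply, ContinuousLinearEquiv.apply_symm_apply, smul_eq_mul]
  congr 1
  exact abs_of_pos hJ

end ChangeOfVariables

theorem continuousOn_chartJac (hc : IsNormalChart Ω R y n h δ ρ) :
    ContinuousOn (chartJac n hc.norm_eq h) (Metric.ball (0 : Hyperplane n) δ ×ˢ univ) :=
  fun _ hp ↦ (continuousAt_chartJac hc.norm_eq (hc.contDiffAt hp.1)).continuousWithinAt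

end IsNormalChart

theorem measurable_chartJac (n : Space d) (hn : ‖n‖ = 1) (h : Hyperplane n → ℝ) :
    Measurable (chartJac n hn h) := by
  have h1 : Continuous fun L : (Hyperplane n × ℝ) →L[ℝ] Space d ↦
      (((graphCoord n hn).symm : Space d →L[ℝ] Hyperplane n × ℝ).comp L).det :=
    ContinuousLinearMap.continuous_det.comp (continuous_const.clm_comp continuous_id)
  exact h1.measurable.comp (measurable_fderiv ℝ (normalChart 0 n h))

end CurvedTrace

end

noncomputable section

namespace CurvedTrace

variable {d : ℕ}

/-! ### The normal derivative in normal coordinates -/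

section Transplant

variable {X Z E : Type*} [TopologicalSpace X] [TopologicalSpace Z] [Zero E]
  {e : OpenPartialHomeomorph X Z} {k : X → E} {K : Set X}

/-- The function `k ∘ e⁻¹`, extended by zero. -/
def transplant (e : OpenPartialHomeomorph X Z) (k : X → E) : Z → E :=
  e.target.indicator fun z ↦ k (e.symm z)

theorem transplant_apply {p : X} (hp : p ∈ e.source) : transplant e k (e p) = k p := by
  rw [transplant, indicator_of_mem (e.map_source hp), e.left_inv hp]

theorem transplant_eq_zero (h0 : ∀ p ∉ K, k p = 0) {z : Z} (hz : z ∉ e '' K) :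
    transplant e k z = 0 := by
  by_cases h : z ∈ e.target
  · rw [transplant, indicator_of_mem h]
    exact h0 _ fun h' ↦ hz ⟨_, h', e.right_inv h⟩
  · rw [transplant, indicator_of_notMem h]

theorem isCompact_image_homeo (hK : IsCompact K) (hKs : K ⊆ e.source) : IsCompact (e '' K) :=
  hK.image_of_continuousOn (e.continuousOn.mono hKs)

theorem continuous_transplant [T2Space Z] [TopologicalSpace E] (hk : ContinuousOn k e.source)
    (hK : IsCompact K) (hKs : K ⊆ e.source) (h0 : ∀ p ∉ K, k p = 0) : Continuous (transplant e k) := by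
  rw [continuous_iff_continuousAt]
  intro z
  by_cases hz : z ∈ e.target
  · have h1 : ContinuousAt (fun z ↦ k (e.symm z)) z :=
      (hk.continuousAt (e.open_source.mem_nhds (e.map_target hz))).comp (e.continuousAt_symm hz)
    refine h1.congr ?_
    filter_upwards [e.open_target.mem_nhds hz] with z' hz'
    rw [transplant, indicator_of_mem hz']
  · have hz' : z ∈ (e '' K)ᶜ := fun ⟨p, hp, hpz⟩ ↦ hz (hpz ▸ e.map_source (hKs hp))
    refine continuousAt_const.congr (f := fun _ ↦ (0 : E)) ?_
    filter_upwards [(isCompact_image_homeo hK hKs).isClosed.isOpen_compl.mem_nhds hz'] with z' h'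
    exact (transplant_eq_zero h0 h').symm

end Transplant

namespace IsNormalChart

variable {Ω : Set (Space d)} {R : ℝ} {y n : Space d} {h : Hyperplane n → ℝ} {δ ρ : ℝ}

theorem continuousOn_div_chartJac (hc : IsNormalChart Ω R y n h δ ρ) {η : Hyperplane n × ℝ → ℝ}
    (hη : Continuous η) : ContinuousOn (fun p ↦ η p / chartJac n hc.norm_eq h p)
      hc.homeo.source :=
  hη.continuousOn.div (hc.continuousOn_chartJac.mono fun _ hp ↦ ⟨hp.1, mem_univ _⟩)
    fun _ hp ↦ (hc.chartJac_pos ⟨hp.1, hp.2.1.le, hp.2.2⟩).ne'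

theorem continuousOn_graphNormal (hc : IsNormalChart Ω R y n h δ ρ) :
    ContinuousOn (fun p : Hyperplane n × ℝ ↦ graphNormal n h p.1) hc.homeo.source := fun _ hp ↦
  (ContinuousAt.comp (f := Prod.fst) (contDiffAt_graphNormal (hc.contDiffAt hp.1)).continuousAt
    continuousAt_fst).continuousWithinAt

theorem hasDerivAt_comp_normalChart {ζ : Space d → ℝ} (hζ : ContDiff ℝ 1 ζ) (w : Hyperplane n)
    (s : ℝ) : HasDerivAt (fun s ↦ ζ (normalChart y n h (w, s)))
      (fderiv ℝ ζ (normalChart y n h (w, s)) (graphNormal n h w)) s := by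
  have hline : HasDerivAt (fun s : ℝ ↦ normalChart y n h (w, s)) (graphNormal n h w) s := by
    simpa [normalChart] using ((hasDerivAt_id s).smul_const (graphNormal n h w)).const_add
      (graphPoint y n h w)
  exact (hζ.differentiable (by norm_num) _).hasFDerivAt.comp_hasDerivAt s hline

/-- Integration by parts along the normals, in normal coordinates. -/
theorem integral_vertical_parts (hc : IsNormalChart Ω R y n h δ ρ) {η g : Hyperplane n × ℝ → ℝ}
    (hη : Continuous η) (hg : Continuous g)
    (hder : ∀ w s, HasDerivAt (fun u ↦ η (w, u)) (g (w, s)) s) {K : Set (Hyperplane n × ℝ)}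
    (hK : IsCompact K) (hKs : K ⊆ hc.homeo.source) (hη0 : ∀ p ∉ K, η p = 0)
    (hg0 : ∀ p ∉ K, g p = 0) {ζ : Space d → ℝ} (hζ : ContDiff ℝ 1 ζ) :
    ∫ p, η p * fderiv ℝ ζ (normalChart y n h p) (graphNormal n h p.1) ∂(volume.prod volume) =
      - ∫ p, g p * ζ (normalChart y n h p) ∂(volume.prod volume) := by
  have hΨ : ContinuousOn (normalChart y n h) hc.homeo.source := hc.homeo.continuousOn
  have hint : ∀ (a b : Hyperplane n × ℝ → ℝ), Continuous a → ContinuousOn b hc.homeo.source →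
      (∀ p ∉ K, a p = 0) → Integrable (fun p ↦ a p * b p) (volume.prod volume) := by
    intro a b ha hb ha0
    refine (integrableOn_iff_integrable_of_support_subset (s := K) fun p hp ↦ ?_).1
      ((ha.continuousOn.mul (hb.mono hKs)).integrableOn_compact hK)
    by_contra h'
    exact hp (by simp [ha0 p h'])
  have hD : ContinuousOn (fun p : Hyperplane n × ℝ ↦
      fderiv ℝ ζ (normalChart y n h p) (graphNormal n h p.1)) hc.homeo.source :=
    ((hζ.continuous_fderiv (by norm_num)).comp_continuousOn hΨ).clm_apply hc.continuousOn_graphNormal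
  rw [integral_prod _ (hint _ _ hη hD hη0),
    integral_prod (fun p ↦ g p * ζ (normalChart y n h p))
      (hint _ _ hg (hζ.continuous.comp_continuousOn hΨ) hg0), ← integral_neg]
  refine integral_congr_ae (Eventually.of_forall fun w ↦ ?_)
  have hline : Continuous fun s : ℝ ↦ normalChart y n h (w, s) := by
    simp only [normalChart]; fun_prop
  have hint1 : ∀ (a b : ℝ → ℝ), Continuous a → Continuous b → (∀ s, (w, s) ∉ K → a s = 0) →
      Integrable (a * b) := by
    intro a b ha hb ha0
    refine (ha.mul hb).integrable_of_hasCompactSupport ?_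
    refine HasCompactSupport.intro (hK.image continuous_snd) fun s hs ↦ ?_
    simp [ha0 s fun h' ↦ hs ⟨_, h', rfl⟩]
  have hηc : Continuous fun s ↦ η (w, s) := by fun_prop
  have hgc : Continuous fun s ↦ g (w, s) := by fun_prop
  have hζc : Continuous fun s ↦ ζ (normalChart y n h (w, s)) := hζ.continuous.comp hline
  have hζ' : Continuous fun s ↦
      fderiv ℝ ζ (normalChart y n h (w, s)) (graphNormal n h w) :=
    ((hζ.continuous_fderiv (by norm_num)).comp hline).clm_apply continuous_const
  exact integral_mul_deriv_eq_deriv_mul_of_integrable (fun s _ ↦ hder w s)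
    (fun s _ ↦ hasDerivAt_comp_normalChart hζ w s)
    (hint1 _ _ hηc hζ' fun s hs ↦ hη0 _ hs) (hint1 _ _ hgc hζc fun s hs ↦ hg0 _ hs)
    (hint1 _ _ hηc hζc fun s hs ↦ hη0 _ hs)

/-- The vector field `(η / J) ν` has divergence `(∂_s η) / J`. -/
theorem integral_inner_gradient_transplant (hc : IsNormalChart Ω R y n h δ ρ)
    {η g : Hyperplane n × ℝ → ℝ} (hη : Continuous η) (hg : Continuous g)
    (hder : ∀ w s, HasDerivAt (fun u ↦ η (w, u)) (g (w, s)) s) {K : Set (Hyperplane n × ℝ)}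
    (hK : IsCompact K) (hKs : K ⊆ hc.homeo.source) (hη0 : ∀ p ∉ K, η p = 0)
    (hg0 : ∀ p ∉ K, g p = 0) {ζ : Space d → ℝ} (hζ : ContDiff ℝ 1 ζ) :
    ∫ x, ⟪transplant hc.homeo
        (fun p ↦ (η p / chartJac n hc.norm_eq h p) • graphNormal n h p.1) x, ∇ ζ x⟫ =
      - ∫ x, transplant hc.homeo (fun p ↦ g p / chartJac n hc.norm_eq h p) x * ζ x := by
  -- change of variables for functions supported in the image of `K`
  have hpull : ∀ (G : Space d → ℝ) (k : Hyperplane n × ℝ → ℝ), (∀ x ∉ hc.homeo '' K, G x = 0) →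
      (∀ p ∈ hc.homeo.source, chartJac n hc.norm_eq h p * G (normalChart y n h p) = k p) →
      (∀ p ∉ K, k p = 0) → ∫ x, G x = ∫ p, k p ∂(volume.prod volume) := by
    intro G k hG hk hk0
    have h1 : ∀ x ∉ normalChart y n h '' hc.homeo.source, G x = 0 := fun x hx ↦
      hG x fun ⟨p, hp, hpx⟩ ↦ hx ⟨p, hKs hp, hpx⟩
    rw [← setIntegral_eq_integral_of_forall_compl_eq_zero h1,
      hc.integral_image hc.homeo.open_source.measurableSet subset_rfl,
      setIntegral_congr_fun hc.homeo.open_source.measurableSet hk,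
      setIntegral_eq_integral_of_forall_compl_eq_zero fun p hp ↦ hk0 p fun h' ↦ hp (hKs h')]
  have hJ : ∀ p ∈ hc.homeo.source, chartJac n hc.norm_eq h p ≠ 0 := fun p hp ↦
    (hc.chartJac_pos ⟨hp.1, hp.2.1.le, hp.2.2⟩).ne'
  rw [hpull _ (fun p ↦ η p * fderiv ℝ ζ (normalChart y n h p) (graphNormal n h p.1)),
    hpull (fun x ↦ transplant hc.homeo (fun p ↦ g p / chartJac n hc.norm_eq h p) x * ζ x)
      (fun p ↦ g p * ζ (normalChart y n h p))]
  · exact hc.integral_vertical_parts hη hg hder hK hKs hη0 hg0 hζ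
  · intro x hx
    rw [transplant_eq_zero (fun p hp ↦ by rw [hg0 p hp, zero_div]) hx, zero_mul]
  · intro p hp
    have hJp := hJ p hp
    rw [← hc.homeo_apply, transplant_apply hp]
    field_simp
  · intro p hp; rw [hg0 p hp, zero_mul]
  · intro x hx
    rw [transplant_eq_zero (fun p hp ↦ by rw [hη0 p hp, zero_div, zero_smul]) hx, inner_zero_left]
  · intro p hp
    have hJp := hJ p hp
    rw [← hc.homeo_apply, transplant_apply hp, real_inner_smul_left,
      inner_gradient_right_eq_fderiv]
    field_simp
  · intro p hp; rw [hη0 p hp, zero_mul]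

/-- The total variation of the normal derivative in normal coordinates, divided by the Jacobian. -/
def verticalMeasure (hc : IsNormalChart Ω R y n h δ ρ) (f : Space d → ℝ) (t : ℝ) :
    Measure (Hyperplane n × ℝ) :=
  (Measure.map hc.homeo.symm ((normalDeriv Ω f t).variation.restrict hc.homeo.target)).withDensity
    fun p ↦ (ENNReal.ofReal (chartJac n hc.norm_eq h p))⁻¹

theorem lintegral_verticalMeasure (hc : IsNormalChart Ω R y n h δ ρ) (f : Space d → ℝ) (t : ℝ)
    {S : Set (Hyperplane n × ℝ)} (hS : MeasurableSet S) (hSs : S ⊆ hc.homeo.source)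
    {k : Hyperplane n × ℝ → ℝ≥0∞} (hk : Measurable k) :
    ∫⁻ p in S, k p ∂(hc.verticalMeasure f t) = ∫⁻ x in normalChart y n h '' S,
      (ENNReal.ofReal (chartJac n hc.norm_eq h (hc.homeo.symm x)))⁻¹ * k (hc.homeo.symm x)
        ∂(normalDeriv Ω f t).variation := by
  have hJm : Measurable fun p ↦ (ENNReal.ofReal (chartJac n hc.norm_eq h p))⁻¹ :=
    (measurable_chartJac n hc.norm_eq h).ennreal_ofReal.inv
  have hae : AEMeasurable hc.homeo.symm
      ((normalDeriv Ω f t).variation.restrict hc.homeo.target) :=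
    hc.homeo.continuousOn_symm.aemeasurable hc.homeo.open_target.measurableSet
  rw [verticalMeasure, setLIntegral_withDensity_eq_setLIntegral_mul _ hJm hk hS,
    Measure.restrict_map_of_aemeasurable hae hS, lintegral_map' (hJm.mul hk).aemeasurable
      (hae.mono_measure Measure.restrict_le_self)]
  have hset : hc.homeo.symm ⁻¹' S ∩ hc.homeo.target = normalChart y n h '' S := by
    ext x
    constructor
    · rintro ⟨h1, h2⟩
      exact ⟨_, h1, hc.homeo.right_inv h2⟩
    · rintro ⟨p, hp, rfl⟩
      refine ⟨?_, hc.homeo.map_source (hSs hp)⟩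
      rw [mem_preimage, hc.homeo_symm_normalChart (hSs hp)]
      exact hp
  rw [Measure.restrict_restrict' hc.homeo.open_target.measurableSet, hset]
  rfl

/-- In normal coordinates, the vertical derivative of a function of bounded variation is controlled
by its normal derivative. -/
theorem verticalDerivBound (hc : IsNormalChart Ω R y n h δ ρ) {f : Space d → ℝ} (hf : MemBV Ω f)
    {t : ℝ} (ht : t ≤ R) : VerticalDerivBound volume (Metric.ball (0 : Hyperplane n) δ ×ˢ Ioo 0 t)
      (fun p ↦ f (normalChart y n h p)) (hc.verticalMeasure f t) := by
  intro η g hη hg hder hcs hsub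
  set U := Metric.ball (0 : Hyperplane n) δ ×ˢ Ioo 0 t with hU
  have hUm : MeasurableSet U := (isOpen_source δ t).measurableSet
  have hUs : U ⊆ hc.homeo.source := prod_mono_right (Ioo_subset_Ioo_right ht)
  set K := tsupport η with hKdef
  have hK : IsCompact K := hcs
  have hKs : K ⊆ hc.homeo.source := hsub.trans hUs
  have hη0 : ∀ p ∉ K, η p = 0 := fun p hp ↦ image_eq_zero_of_notMem_tsupport hp
  have hg0 : ∀ p ∉ K, g p = 0 := by
    rintro ⟨w, s⟩ hp
    have hev : (fun u ↦ η (w, u)) =ᶠ[𝓝 s] fun _ ↦ 0 := by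
      have h1 : ContinuousAt (fun u : ℝ ↦ (w, u)) s := by fun_prop
      filter_upwards [h1.eventually ((isClosed_tsupport η).isOpen_compl.mem_nhds hp)] with u hu
      exact hη0 _ hu
    exact (hder w s).unique ((hasDerivAt_const s (0 : ℝ)).congr_of_eventuallyEq hev)
  set J := chartJac n hc.norm_eq h with hJdef
  -- the field `Y = θ ∇d` has divergence `b`, and pairing it with the gradient measure only involves
  -- the normal derivative
  set θ := transplant hc.homeo fun p ↦ η p / J p with hθ
  set b := transplant hc.homeo fun p ↦ g p / J p with hb
  set Y := transplant hc.homeo fun p ↦ (η p / J p) • graphNormal n h p.1 with hY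
  have hKc := isCompact_image_homeo hK hKs
  have hθ0 : ∀ x ∉ hc.homeo '' K, θ x = 0 := fun x hx ↦
    transplant_eq_zero (fun p hp ↦ by rw [hη0 p hp, zero_div]) hx
  have hb0 : ∀ x ∉ hc.homeo '' K, b x = 0 := fun x hx ↦
    transplant_eq_zero (fun p hp ↦ by rw [hg0 p hp, zero_div]) hx
  have hY0 : ∀ x ∉ hc.homeo '' K, Y x = 0 := fun x hx ↦
    transplant_eq_zero (fun p hp ↦ by rw [hη0 p hp, zero_div, zero_smul]) hx
  have hθc : Continuous θ := continuous_transplant (hc.continuousOn_div_chartJac hη) hK hKs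
    fun p hp ↦ by rw [hη0 p hp, zero_div]
  have hbc : Continuous b := continuous_transplant (hc.continuousOn_div_chartJac hg) hK hKs
    fun p hp ↦ by rw [hg0 p hp, zero_div]
  have hYc : Continuous Y := continuous_transplant
    ((hc.continuousOn_div_chartJac hη).smul hc.continuousOn_graphNormal) hK hKs
    fun p hp ↦ by rw [hη0 p hp, zero_div, zero_smul]
  have hKlayer : hc.homeo '' K ⊆ layer Ω t := by
    rintro _ ⟨p, hp, rfl⟩
    have := hc.mem_and_bdryDist (hKs hp)
    exact ⟨this.1, this.2.trans_lt (hsub hp).2.2⟩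
  have hKΩ : hc.homeo '' K ⊆ Ω := fun x hx ↦ (hKlayer hx).1
  have hKU : hc.homeo '' K ⊆ normalChart y n h '' U := image_mono hsub
  obtain ⟨hYcs, hYΩ⟩ := compactSupport_of_eq_zero_off hKc hKΩ hY0
  obtain ⟨hbcs, -⟩ := compactSupport_of_eq_zero_off hKc hKΩ hb0
  obtain ⟨hθcs, -⟩ := compactSupport_of_eq_zero_off hKc hKΩ hθ0
  have hgrad : IsBVGradient Ω f (bvGradient Ω f) := Classical.epsilon_spec hf.2
  have h1 := integral_mul_weakDivergence hc.isOpen hf.1 hgrad hYc hYcs hYΩ hbc hbcs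
    fun ζ hζ _ ↦ hc.integral_inner_gradient_transplant hη hg hder hK hKs hη0 hg0 hζ
  have hJ : ∀ p ∈ hc.homeo.source, 0 < J p := fun p hp ↦
    hc.chartJac_pos ⟨hp.1, hp.2.1.le, hp.2.2⟩
  have h2 : ∫ p in U, f (normalChart y n h p) * g p ∂(volume.prod volume) =
      ∫ x in Ω, f x * b x := by
    rw [← setIntegral_eq_integral_of_forall_compl_eq_zero (s := normalChart y n h '' U)
      (f := fun x ↦ f x * b x) (μ := volume.restrict Ω) (fun x hx ↦ by
        rw [hb0 x fun h' ↦ hx (hKU h'), mul_zero]),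
      Measure.restrict_restrict (hc.isOpen_image (isOpen_source δ t) hUs).measurableSet,
      inter_eq_left.2 (show normalChart y n h '' U ⊆ Ω by
        rintro _ ⟨p, hp, rfl⟩; exact (hc.mem_and_bdryDist (hUs hp)).1),
      hc.integral_image hUm hUs]
    refine setIntegral_congr_fun hUm fun p hp ↦ ?_
    have hJp := (hJ p (hUs hp)).ne'
    rw [hb, ← hc.homeo_apply, transplant_apply (hUs hp), ← hJdef]
    field_simp
  have := isFiniteMeasure_variation (bvGradient Ω f)
  rw [h2, h1, enorm_neg]
  refine (enorm_integral_innerBilin_le hc.isOpen f t θ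
    (hθc.integrable_of_hasCompactSupport hθcs) Y (fun x hx ↦ hY0 x fun h' ↦ hx (hKlayer h'))
    fun x _ ↦ ?_).trans_eq ?_
  · by_cases hx : x ∈ hc.homeo '' K
    · obtain ⟨p, hp, rfl⟩ := hx
      rw [hY, hθ, transplant_apply (hKs hp), transplant_apply (hKs hp), hc.homeo_apply,
        hc.gradient_bdryDist (hKs hp)]
    · rw [hY0 x hx, hθ0 x hx, zero_smul]
  · rw [hc.lintegral_verticalMeasure f t hUm hUs hη.measurable.enorm,
      ← setLIntegral_eq_of_support_subset (s := normalChart y n h '' U)]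
    · refine setLIntegral_congr_fun
        (hc.isOpen_image (isOpen_source δ t) hUs).measurableSet ?_
      rintro _ ⟨p, hp, rfl⟩
      have hJp := hJ p (hUs hp)
      simp only
      rw [hc.homeo_symm_normalChart (hUs hp), hθ, ← hc.homeo_apply, transplant_apply (hUs hp),
        div_eq_inv_mul, enorm_mul, enorm_inv hJp.ne', Real.enorm_of_nonneg hJp.le]
    · intro x hx
      by_contra h'
      exact hx (by simp [hθ0 x fun h'' ↦ h' (hKU h'')])

end IsNormalChart

end CurvedTrace

end

noncomputable section

namespace CurvedTrace

variable {d : ℕ}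

/-! ### Traces in a normal chart -/

set_option linter.unusedSectionVars false in
/-- Two functions on a slab: the `L¹` distance of their traces is controlled by the masses of their
vertical derivatives and by the mean over the height of their `L¹` distance. -/
theorem lintegral_trace_sub_trace_le {V : Type*} [NormedAddCommGroup V] [NormedSpace ℝ V]
    [FiniteDimensional ℝ V] [MeasurableSpace V] [BorelSpace V] {l : Measure V} [l.IsAddHaarMeasure]
    {B A : Set V} {t : ℝ} {F G : V × ℝ → ℝ} {m m' : Measure (V × ℝ)} {T T' : V → ℝ} (ht : 0 < t)
    (hF : IntegrableOn F (B ×ˢ Ioo 0 t) (l.prod volume))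
    (hG : IntegrableOn G (B ×ˢ Ioo 0 t) (l.prod volume)) (hT : Measurable T) (hT' : Measurable T')
    (hAB : A ⊆ B)
    (h : ∫⁻ p in A ×ˢ Ioo 0 t, ‖F p - T p.1‖ₑ ∂(l.prod volume) ≤
      ENNReal.ofReal t * m (A ×ˢ Ioo 0 t))
    (h' : ∫⁻ p in A ×ˢ Ioo 0 t, ‖G p - T' p.1‖ₑ ∂(l.prod volume) ≤
      ENNReal.ofReal t * m' (A ×ˢ Ioo 0 t)) :
    ∫⁻ w in A, ‖T w - T' w‖ₑ ∂l ≤ m (A ×ˢ Ioo 0 t) + m' (A ×ˢ Ioo 0 t) +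
      ENNReal.ofReal (1 / t) * ∫⁻ p in A ×ˢ Ioo 0 t, ‖F p - G p‖ₑ ∂(l.prod volume) := by
  have h0 : ENNReal.ofReal t ≠ 0 := by simpa using ht
  have h1 : ∫⁻ p in A ×ˢ Ioo 0 t, ‖T p.1 - T' p.1‖ₑ ∂(l.prod volume) =
      ENNReal.ofReal t * ∫⁻ w in A, ‖T w - T' w‖ₑ ∂l := by
    rw [← Measure.prod_restrict, lintegral_prod _ (by fun_prop)]
    simp only [lintegral_const, Measure.restrict_apply_univ, Real.volume_Ioo, sub_zero]
    rw [lintegral_mul_const _ (by fun_prop), mul_comm]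
  have hFm : AEMeasurable F ((l.prod volume).restrict (A ×ˢ Ioo 0 t)) :=
    (hF.mono_set (prod_mono_left hAB)).aemeasurable
  have hGm : AEMeasurable G ((l.prod volume).restrict (A ×ˢ Ioo 0 t)) :=
    (hG.mono_set (prod_mono_left hAB)).aemeasurable
  have h2 : ENNReal.ofReal t * ∫⁻ w in A, ‖T w - T' w‖ₑ ∂l ≤
      ENNReal.ofReal t * m (A ×ˢ Ioo 0 t) + ENNReal.ofReal t * m' (A ×ˢ Ioo 0 t) +
        ∫⁻ p in A ×ˢ Ioo 0 t, ‖F p - G p‖ₑ ∂(l.prod volume) := by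
    rw [← h1]
    -- triangle inequality through `F` and `G` at every height
    calc _ ≤ ∫⁻ p in A ×ˢ Ioo 0 t, (‖F p - T p.1‖ₑ + (‖F p - G p‖ₑ + ‖G p - T' p.1‖ₑ))
          ∂(l.prod volume) := by
          refine lintegral_mono fun p ↦ ?_
          have e1 : T p.1 - T' p.1 = -(F p - T p.1) + ((F p - G p) + (G p - T' p.1)) := by ring
          rw [e1]
          refine (enorm_add_le _ _).trans ?_
          rw [enorm_neg]
          gcongr
          exact enorm_add_le _ _
      _ ≤ ∫⁻ p in A ×ˢ Ioo 0 t, ‖F p - T p.1‖ₑ ∂(l.prod volume) +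
          (∫⁻ p in A ×ˢ Ioo 0 t, ‖F p - G p‖ₑ ∂(l.prod volume) +
            ∫⁻ p in A ×ˢ Ioo 0 t, ‖G p - T' p.1‖ₑ ∂(l.prod volume)) := by
          rw [lintegral_add_left' (by fun_prop), lintegral_add_left' (by fun_prop)]
      _ ≤ _ := by
          refine (add_le_add h (add_le_add_right h' _)).trans_eq ?_
          ring
  have h3 : ENNReal.ofReal (1 / t) * ENNReal.ofReal t = 1 := by
    rw [← ENNReal.ofReal_mul (by positivity), one_div_mul_cancel ht.ne', ENNReal.ofReal_one]
  rw [← one_mul (∫⁻ w in A, ‖T w - T' w‖ₑ ∂l), ← h3, mul_assoc]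
  refine (mul_le_mul_right h2 _).trans_eq ?_
  rw [mul_add, mul_add, ← mul_assoc, ← mul_assoc, h3, one_mul, one_mul]

theorem ofReal_setAverage_abs_eq {X : Type*} [MeasurableSpace X] {μ : Measure X} {s : Set X}
    {g : X → ℝ} (hg : IntegrableOn g s μ) (hs0 : μ s ≠ 0) :
    ENNReal.ofReal (⨍ x in s, |g x| ∂μ) = (∫⁻ x in s, ‖g x‖ₑ ∂μ) / μ s := by
  have h1 : ∫ x in s, |g x| ∂μ = (∫⁻ x in s, ‖g x‖ₑ ∂μ).toReal :=
    integral_norm_eq_lintegral_enorm hg.aestronglyMeasurable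
  have h2 : ∫⁻ x in s, ‖g x‖ₑ ∂μ ≠ ∞ := hg.2.ne
  rw [setAverage_eq, h1, smul_eq_mul, measureReal_def, ← ENNReal.toReal_inv, ← ENNReal.toReal_mul,
    ENNReal.ofReal_toReal (ENNReal.mul_ne_top (ENNReal.inv_ne_top.2 hs0) h2), mul_comm,
    div_eq_mul_inv]

/-- If the mean oscillation of `f` around the number `c` tends to zero at a boundary point, then `c`
is the boundary trace of `f` there. -/
theorem bvTrace_eq_of_tendsto {Ω : Set (Space d)} (hΩ : IsOpen Ω) {f : Space d → ℝ}
    (hf : IntegrableOn f Ω) {y : Space d} (hy : y ∈ frontier Ω) {c : ℝ}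
    (h : Tendsto (fun r : ℝ ↦ ⨍ x in Ω ∩ Metric.ball y r, |f x - c|) (𝓝[>] 0) (𝓝 0)) :
    bvTrace Ω f y = c := by
  refine Tendsto.limUnder_eq ?_
  rw [tendsto_iff_norm_sub_tendsto_zero]
  refine squeeze_zero' (Eventually.of_forall fun r ↦ norm_nonneg _) ?_ h
  filter_upwards [self_mem_nhdsWithin] with r hr
  have hr : 0 < r := hr
  have hv0 : volume (Ω ∩ Metric.ball y r) ≠ 0 := by
    refine ((hΩ.inter Metric.isOpen_ball).measure_pos volume ?_).ne'
    have := mem_closure_iff_nhds.1 hy.1 _ (Metric.ball_mem_nhds y hr)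
    rwa [inter_comm] at this
  have hvt : volume (Ω ∩ Metric.ball y r) ≠ ∞ :=
    (measure_mono inter_subset_right).trans_lt measure_ball_lt_top |>.ne
  have hfi : IntegrableOn f (Ω ∩ Metric.ball y r) := hf.mono_set inter_subset_left
  have hci : IntegrableOn (fun _ : Space d ↦ c) (Ω ∩ Metric.ball y r) :=
    integrableOn_const hvt
  have hpos : 0 < volume.real (Ω ∩ Metric.ball y r) := ENNReal.toReal_pos hv0 hvt
  have e1 : ⨍ x in Ω ∩ Metric.ball y r, f x - c = (⨍ x in Ω ∩ Metric.ball y r, f x) - c := by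
    rw [setAverage_eq, setAverage_eq, integral_sub hfi hci, setIntegral_const, smul_sub, smul_smul,
      inv_mul_cancel₀ hpos.ne', one_smul]
  rw [← e1, setAverage_eq, setAverage_eq, norm_smul, smul_eq_mul, norm_inv,
    Real.norm_of_nonneg hpos.le]
  gcongr
  exact norm_integral_le_integral_norm _

theorem finrank_hyperplane_add_one {n : Space d} (hn : ‖n‖ = 1) :
    Module.finrank ℝ (Hyperplane n) + 1 = d := by
  have hd : d ≠ 0 := by
    rintro rfl
    rw [Subsingleton.elim n 0, norm_zero] at hn
    exact zero_ne_one hn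
  rw [finrank_hyperplane hn]
  omega

/-- Cylinders and balls of comparable size have comparable volumes. -/
theorem exists_cylinder_le_ball {n : Space d} (hn : ‖n‖ = 1) : ∃ K : ℝ≥0∞, K ≠ ∞ ∧
    ∀ (w : Hyperplane n) (z : Space d) (r : ℝ), 0 < r →
      ENNReal.ofReal (2 * r) * volume (Metric.closedBall w (2 * r)) ≤
        K * volume (Metric.ball z (r / 2)) := by
  have h1 : volume (Metric.ball (0 : Space d) 1) ≠ 0 :=
    (Metric.measure_ball_pos volume _ one_pos).ne'
  have h2 : volume (Metric.ball (0 : Space d) 1) ≠ ∞ := measure_ball_lt_top.ne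
  refine ⟨ENNReal.ofReal (4 ^ d) * volume (Metric.ball (0 : Hyperplane n) 1) /
    volume (Metric.ball (0 : Space d) 1), ENNReal.div_ne_top (ENNReal.mul_ne_top
      ENNReal.ofReal_ne_top measure_ball_lt_top.ne) h1, fun w z r hr ↦ ?_⟩
  rw [Measure.addHaar_closedBall _ _ (by positivity),
    Measure.addHaar_ball_of_pos volume z (half_pos hr),
    finrank_euclideanSpace_fin, ← mul_assoc, ← ENNReal.ofReal_mul (by positivity), ← pow_succ',
    finrank_hyperplane_add_one hn]
  have e1 : (2 * r) ^ d = 4 ^ d * (r / 2) ^ d := by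
    rw [← mul_pow]; congr 1; ring
  rw [e1, ENNReal.ofReal_mul (by positivity)]
  refine le_of_eq ?_
  set a := ENNReal.ofReal (4 ^ d)
  set b := ENNReal.ofReal ((r / 2) ^ d)
  set u := volume (Metric.ball (0 : Hyperplane n) 1)
  set v := volume (Metric.ball (0 : Space d) 1)
  calc a * b * u = a * u * b * (v * v⁻¹) := by rw [ENNReal.mul_inv_cancel h1 h2]; ring
    _ = a * u / v * (b * v) := by rw [div_eq_mul_inv]; ring

/-- The measure of the graph is at most the measure of the base times a power of the Lipschitz
constant. -/
theorem hausdorff_graph_image_le {n : Space d} (hn : ‖n‖ = 1) {φ : Hyperplane n → Space d}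
    {K : NNReal} {A : Set (Hyperplane n)} (hφ : LipschitzOnWith K φ A) :
    (μHE[d - 1] : Measure (Space d)) (φ '' A) ≤ (K : ℝ≥0∞) ^ (d - 1) * volume A := by
  rw [← InnerProductSpace.euclideanHausdorffMeasure_eq_volume (V := Hyperplane n),
    finrank_hyperplane hn, Measure.euclideanHausdorffMeasure_def,
    Measure.euclideanHausdorffMeasure_def, Measure.smul_apply, Measure.smul_apply]
  have := hφ.hausdorffMeasure_image_le (d := ((d - 1 : ℕ) : ℝ)) (by positivity)
  rw [ENNReal.rpow_natCast] at this
  simp only [ENNReal.smul_def, smul_eq_mul]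
  rw [mul_left_comm]
  gcongr

/-- Integrals over a graph are at most the integrals over the base times a power of the Lipschitz
constant; `P` is the projection to the base. -/
theorem lintegral_hausdorff_graph_le {n : Space d} (hn : ‖n‖ = 1) {φ : Hyperplane n → Space d}
    {P : Space d → Hyperplane n} {K : NNReal} {A : Set (Hyperplane n)}
    (hφ : LipschitzOnWith K φ A) (hφm : MeasurableSet (φ '' A)) (hP : Measurable P)
    (hPφ : ∀ w ∈ A, P (φ w) = w) {H : Space d → ℝ≥0∞} {k : Hyperplane n → ℝ≥0∞} (hk : Measurable k)
    (hHk : ∀ᵐ w, w ∈ A → H (φ w) = k w) :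
    ∫⁻ x in φ '' A, H x ∂μHE[d - 1] ≤ (K : ℝ≥0∞) ^ (d - 1) * ∫⁻ w in A, k w := by
  have hnull : (μHE[d - 1] : Measure (Space d)) (φ '' {w ∈ A | H (φ w) ≠ k w}) = 0 := by
    refine le_antisymm ((hausdorff_graph_image_le hn (hφ.mono fun w hw ↦ hw.1)).trans_eq ?_) bot_le
    have : volume {w ∈ A | H (φ w) ≠ k w} = 0 := by
      rw [← nonpos_iff_eq_zero, ← ae_iff.1 hHk]
      exact measure_mono fun w hw hw' ↦ hw.2 (hw' hw.1)
    rw [this, mul_zero]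
  have h1 : ∫⁻ x in φ '' A, H x ∂μHE[d - 1] = ∫⁻ x in φ '' A, k (P x) ∂μHE[d - 1] := by
    refine setLIntegral_congr_fun_ae hφm ?_
    have := measure_eq_zero_iff_ae_notMem.1 hnull
    filter_upwards [this] with x hx
    rintro ⟨w, hw, rfl⟩
    rw [hPφ w hw]
    by_contra hne
    exact hx ⟨w, ⟨hw, hne⟩, rfl⟩
  have h2 : Measure.map P ((μHE[d - 1] : Measure (Space d)).restrict (φ '' A)) ≤
      ((K : ℝ≥0∞) ^ (d - 1)) • (volume.restrict A) := by
    refine Measure.le_iff.2 fun E hE ↦ ?_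
    rw [Measure.map_apply hP hE, Measure.restrict_apply (hP hE), Measure.smul_apply,
      Measure.restrict_apply hE, smul_eq_mul]
    refine (measure_mono ?_).trans (hausdorff_graph_image_le hn (hφ.mono inter_subset_right))
    rintro _ ⟨h3, w, hw, rfl⟩
    rw [mem_preimage, hPφ w hw] at h3
    exact ⟨w, ⟨h3, hw⟩, rfl⟩
  calc _ = ∫⁻ w, k w ∂(Measure.map P ((μHE[d - 1] : Measure (Space d)).restrict (φ '' A))) := by
        rw [h1, lintegral_map hk hP]
    _ ≤ ∫⁻ w, k w ∂(((K : ℝ≥0∞) ^ (d - 1)) • (volume.restrict A)) := lintegral_mono' h2 le_rfl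
    _ = _ := by rw [lintegral_smul_measure, smul_eq_mul]

namespace IsNormalChart

variable {Ω : Set (Space d)} {R : ℝ} {y n : Space d} {h : Hyperplane n → ℝ} {δ ρ : ℝ}

/-- Half balls at the boundary are covered by cylinders in normal coordinates. -/
theorem eventually_subset_image (hc : IsNormalChart Ω R y n h δ ρ) (hR : 0 < R) {w : Hyperplane n}
    (hw : w ∈ Metric.ball 0 δ) : ∀ᶠ r in 𝓝[>] (0 : ℝ),
      Metric.closedBall w (2 * r) ⊆ Metric.ball 0 δ ∧ 2 * r ≤ R ∧
      Ω ∩ Metric.ball (graphPoint y n h w) r ⊆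
        normalChart y n h '' (Metric.closedBall w (2 * r) ×ˢ Ioo 0 (2 * r)) := by
  obtain ⟨r₀, hr₀, hnear⟩ := Metric.eventually_nhds_iff_ball.1 (hc.eventually_mem_image hw)
  obtain ⟨r₁, hr₁, hball⟩ := Metric.isOpen_iff.1 Metric.isOpen_ball w hw
  have hsm : ∀ᶠ r in 𝓝[>] (0 : ℝ), 2 * r < min (min r₀ r₁) R := by
    have hcont : Continuous fun r : ℝ ↦ 2 * r := by fun_prop
    exact ((hcont.tendsto 0).eventually (gt_mem_nhds (by rw [mul_zero]; positivity))).filter_mono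
      nhdsWithin_le_nhds
  filter_upwards [hsm, self_mem_nhdsWithin] with r hr hr0
  have hr0 : 0 < r := hr0
  have e1 : 2 * r < r₀ := hr.trans_le ((min_le_left _ _).trans (min_le_left _ _))
  have e2 : 2 * r < r₁ := hr.trans_le ((min_le_left _ _).trans (min_le_right _ _))
  have e3 : 2 * r < R := hr.trans_le (min_le_right _ _)
  have hcb : Metric.closedBall w (2 * r) ⊆ Metric.ball 0 δ :=
    (Metric.closedBall_subset_ball e2).trans hball
  refine ⟨hcb, e3.le, ?_⟩
  rintro x ⟨hxΩ, hxy⟩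
  rw [hc.image_eq hcb e3.le]
  set q₀ := graphPoint y n h w with hq₀
  have hdx : bdryDist Ω x < r := (bdryDist_le_dist (hc.graphPoint_mem hw)).trans_lt hxy
  have hxR : x ∈ layer Ω R := ⟨hxΩ, by linarith⟩
  have hpr := hc.unique.bdryProj_spec hxR
  refine ⟨⟨hxΩ, by linarith⟩, ?_⟩
  set q := bdryProj Ω x
  have hqq : dist q q₀ ≤ 2 * r := by
    have := dist_triangle_left q q₀ x
    rw [hpr.2] at this
    linarith [Metric.mem_ball.1 hxy]
  obtain ⟨-, hq⟩ := hnear q (Metric.mem_ball.2 (hqq.trans_lt e1)) hpr.1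
  refine ⟨_, ?_, hq.symm⟩
  have hw' : w = (Hyperplane n).orthogonalProjectionOnto (q₀ - y) := by
    have := congrArg Prod.fst (hc.proj_graphPoint w)
    rw [graphCoord_symm_apply] at this
    exact this.symm
  rw [Metric.mem_closedBall, dist_eq_norm]
  rw [hw', ← map_sub, sub_sub_sub_cancel_right]
  refine (Submodule.norm_orthogonalProjectionOnto_apply_le _ _).trans ?_
  rwa [← dist_eq_norm]

/-- Convergence of averages over cylinders in normal coordinates yields convergence of averages over
half balls. -/
theorem tendsto_setAverage (hc : IsNormalChart Ω R y n h δ ρ) (hR : 0 < R) {f : Space d → ℝ}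
    (hf : IntegrableOn f Ω) {C : ℝ}
    (hJC : ∀ p ∈ Metric.ball (0 : Hyperplane n) δ ×ˢ Ioo 0 R, chartJac n hc.norm_eq h p ≤ C)
    {w : Hyperplane n} (hw : w ∈ Metric.ball 0 δ) {c : ℝ}
    (hlim : Tendsto (fun r ↦ (∫⁻ p in Metric.closedBall w r ×ˢ Ioo 0 r,
      ‖f (normalChart y n h p) - c‖ₑ ∂(volume.prod volume)) /
        (ENNReal.ofReal r * volume (Metric.closedBall w r))) (𝓝[>] 0) (𝓝 0)) :
    Tendsto (fun r : ℝ ↦ ⨍ x in Ω ∩ Metric.ball (graphPoint y n h w) r, |f x - c|)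
      (𝓝[>] 0) (𝓝 0) := by
  obtain ⟨K, hK, hcyl⟩ := exists_cylinder_le_ball hc.norm_eq
  set E : ℝ → ℝ≥0∞ := fun r ↦ (∫⁻ p in Metric.closedBall w r ×ˢ Ioo 0 r,
      ‖f (normalChart y n h p) - c‖ₑ ∂(volume.prod volume)) /
        (ENNReal.ofReal r * volume (Metric.closedBall w r)) with hE
  set q := graphPoint y n h w with hq
  have hqf := hc.graphPoint_mem hw
  have hdouble : Tendsto (fun r : ℝ ↦ 2 * r) (𝓝[>] 0) (𝓝[>] 0) := by
    refine tendsto_nhdsWithin_iff.2 ⟨?_, ?_⟩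
    · have hcont : Continuous fun r : ℝ ↦ 2 * r := by fun_prop
      simpa using (hcont.tendsto 0).mono_left nhdsWithin_le_nhds
    · filter_upwards [self_mem_nhdsWithin] with r hr
      have hr : 0 < r := hr
      exact mem_Ioi.2 (by linarith)
  have hE2 := hlim.comp hdouble
  have hbound : Tendsto (fun r ↦ ENNReal.ofReal C * K * E (2 * r)) (𝓝[>] 0) (𝓝 0) := by
    have := ENNReal.Tendsto.const_mul (a := ENNReal.ofReal C * K) hE2
      (Or.inr (ENNReal.mul_ne_top ENNReal.ofReal_ne_top hK))
    rwa [mul_zero] at this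
  have hmain : ∀ᶠ r in 𝓝[>] (0 : ℝ), ENNReal.ofReal (⨍ x in Ω ∩ Metric.ball q r, |f x - c|) ≤
      ENNReal.ofReal C * K * E (2 * r) := by
    filter_upwards [hc.eventually_subset_image hR hw, self_mem_nhdsWithin] with r hr hr0
    obtain ⟨hcb, hrR, hsub⟩ := hr
    have hr0 : 0 < r := hr0
    have hν := hc.isInwardNormal hw
    have hrR' : r / 2 < R := by linarith
    have hint := hc.unique.bdryDist_normal hc.smooth hqf hν (half_pos hr0) hrR'
    -- an interior ball bounds the volume of the half ball from below
    have hlow : Metric.ball (q + (r / 2) • graphNormal n h w) (r / 2) ⊆ Ω ∩ Metric.ball q r := by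
      intro x hx
      refine ⟨ball_bdryDist_subset hint.1 (by rw [hint.2]; exact hx), ?_⟩
      have h1 : dist (q + (r / 2) • graphNormal n h w) q = r / 2 := by
        rw [dist_self_add_left, norm_smul, hν.norm_eq, Real.norm_of_nonneg (by linarith), mul_one]
      have := dist_triangle x (q + (r / 2) • graphNormal n h w) q
      rw [Metric.mem_ball] at hx ⊢
      linarith
    have hv0 : volume (Ω ∩ Metric.ball q r) ≠ 0 :=
      ((Metric.measure_ball_pos volume _ (half_pos hr0)).trans_le (measure_mono hlow)).ne'
    have hvt : volume (Ω ∩ Metric.ball q r) ≠ ∞ :=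
      (measure_mono inter_subset_right).trans_lt measure_ball_lt_top |>.ne
    rw [ofReal_setAverage_abs_eq (g := fun x ↦ f x - c)
      ((hf.mono_set inter_subset_left).sub (integrableOn_const hvt)) hv0]
    refine ENNReal.div_le_of_le_mul ?_
    have hSs : Metric.closedBall w (2 * r) ×ˢ Ioo 0 (2 * r) ⊆
        Metric.ball (0 : Hyperplane n) δ ×ˢ Ioo 0 R :=
      prod_mono hcb (Ioo_subset_Ioo_right hrR)
    have hSm : MeasurableSet (Metric.closedBall w (2 * r) ×ˢ Ioo (0 : ℝ) (2 * r)) :=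
      Metric.isClosed_closedBall.measurableSet.prod measurableSet_Ioo
    have hX0 : ENNReal.ofReal (2 * r) * volume (Metric.closedBall w (2 * r)) ≠ 0 :=
      mul_ne_zero (by simpa using hr0) (Metric.measure_closedBall_pos volume _ (by linarith)).ne'
    have hXt : ENNReal.ofReal (2 * r) * volume (Metric.closedBall w (2 * r)) ≠ ∞ :=
      ENNReal.mul_ne_top ENNReal.ofReal_ne_top measure_closedBall_lt_top.ne
    calc ∫⁻ x in Ω ∩ Metric.ball q r, ‖f x - c‖ₑ
        ≤ ∫⁻ x in normalChart y n h '' (Metric.closedBall w (2 * r) ×ˢ Ioo 0 (2 * r)),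
            ‖f x - c‖ₑ := lintegral_mono_set hsub
      _ = ∫⁻ p in Metric.closedBall w (2 * r) ×ˢ Ioo 0 (2 * r),
            ENNReal.ofReal (chartJac n hc.norm_eq h p) * ‖f (normalChart y n h p) - c‖ₑ
              ∂(volume.prod volume) := hc.lintegral_image hSm hSs _
      _ ≤ ∫⁻ p in Metric.closedBall w (2 * r) ×ˢ Ioo 0 (2 * r),
            ENNReal.ofReal C * ‖f (normalChart y n h p) - c‖ₑ ∂(volume.prod volume) := by
          refine setLIntegral_mono' hSm fun p hp ↦ ?_
          gcongr
          exact hJC p (hSs hp)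
      _ = ENNReal.ofReal C * (E (2 * r) *
            (ENNReal.ofReal (2 * r) * volume (Metric.closedBall w (2 * r)))) := by
          rw [lintegral_const_mul' _ _ ENNReal.ofReal_ne_top, hE]
          simp only
          rw [ENNReal.div_mul_cancel hX0 hXt]
      _ ≤ ENNReal.ofReal C * (E (2 * r) * (K * volume (Ω ∩ Metric.ball q r))) := by
          have := (hcyl w (q + (r / 2) • graphNormal n h w) r hr0).trans
            (mul_le_mul_right (measure_mono hlow) K)
          exact mul_le_mul_right (mul_le_mul_right this _) _
      _ = _ := by ring
  have hlim0 := tendsto_of_tendsto_of_tendsto_of_le_of_le' tendsto_const_nhds hbound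
    (Eventually.of_forall fun r ↦ bot_le) hmain
  have := (ENNReal.tendsto_toReal ENNReal.zero_ne_top).comp hlim0
  rw [ENNReal.toReal_zero] at this
  refine this.congr fun r ↦ ?_
  simp only [Function.comp_apply]
  refine ENNReal.toReal_ofReal ?_
  rw [setAverage_eq]
  exact smul_nonneg (inv_nonneg.2 measureReal_nonneg) (integral_nonneg fun x ↦ abs_nonneg _)

end IsNormalChart

end CurvedTrace

end

noncomputable section

namespace CurvedTrace

variable {d : ℕ}

/-! ### The local inequality -/

theorem HasUniqueProj.mono {Ω : Set (Space d)} {R t : ℝ} (h : HasUniqueProj Ω R) (ht : t ≤ R) :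
    HasUniqueProj Ω t := fun x hx ↦ h x ⟨hx.1, hx.2.trans_le ht⟩

/-- A normal chart of height `t`, so small that its Jacobian is bounded and bounded away from zero
and that the graph is parametrized with distortion at most `1 + ε`. -/
structure IsFineChart (Ω : Set (Space d)) (t : ℝ) (y n : Space d) (h : Hyperplane n → ℝ)
    (δ ρ ε : ℝ) : Prop extends IsNormalChart Ω t y n h δ ρ where
  t_pos : 0 < t
  δ_pos : 0 < δ
  zero : h 0 = 0
  exists_lower : ∃ c > 0, ∀ p ∈ Metric.ball (0 : Hyperplane n) δ ×ˢ Ioo 0 t,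
    c ≤ chartJac n norm_eq h p
  exists_upper : ∃ C, ∀ p ∈ Metric.ball (0 : Hyperplane n) δ ×ˢ Ioo 0 t,
    chartJac n norm_eq h p ≤ C
  one_le : ∀ w ∈ Metric.ball (0 : Hyperplane n) δ, 1 ≤ (1 + ε) * chartJac n norm_eq h (w, 0)
  lipschitz : LipschitzOnWith (1 + ε).toNNReal (graphPoint y n h) (Metric.ball 0 δ)

/-- At the centre of a local graph the Jacobian is `1` and the parametrization is isometric to first
order, so both properties hold up to `1 + ε` on a small ball; on a compact piece of it the Jacobian
is bounded away from zero because `t` is smaller than the reach. -/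
theorem exists_isFineChart {Ω : Set (Space d)} (hΩ : IsUniformlyC2 Ω) {R t : ℝ}
    (hu : HasUniqueProj Ω R) (ht : 0 < t) (htR : t < R) {ε : ℝ} (hε : 0 < ε) {y : Space d}
    (hy : y ∈ frontier Ω) : ∃ n h δ ρ, IsFineChart (d := d) Ω t y n h δ ρ ε := by
  obtain ⟨n, h, hg⟩ := hΩ.exists_isLocalGraph hy
  obtain ⟨δ₀, hδ₀, ρ, hρ, hG⟩ := hg.exists_isGraphOn hΩ.1
  have hn := hg.norm_eq
  have hJ0 : ContinuousAt (fun w ↦ chartJac n hn h (w, 0)) 0 :=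
    ContinuousAt.comp (f := fun w : Hyperplane n ↦ (w, (0 : ℝ)))
      (continuousAt_chartJac hn hg.contDiffAt) (by fun_prop)
  have h1ε : (1 + ε)⁻¹ < 1 := inv_lt_one_of_one_lt₀ (by linarith)
  have e1 : ∀ᶠ w in 𝓝 (0 : Hyperplane n), (1 + ε)⁻¹ < chartJac n hn h (w, 0) :=
    hJ0.eventually (lt_mem_nhds (by
      have := chartJac_zero hn hg.contDiffAt hg.fderiv_zero
      rw [← Prod.mk_zero_zero] at this
      change (1 + ε)⁻¹ < chartJac n hn h (0, 0)
      rw [this]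
      exact h1ε))
  obtain ⟨s, hs, hsL⟩ : ∃ s ∈ 𝓝 (0 : Hyperplane n),
      LipschitzOnWith (1 + ε).toNNReal (graphPoint y n h) s := by
    have hd := (contDiffAt_graphPoint (y := y) (m := 2) hg.contDiffAt).hasStrictFDerivAt
      (by norm_num)
    refine hd.exists_lipschitzOnWith_of_nnnorm_lt _ ?_
    rw [(hasFDerivAt_graphPoint (hg.contDiffAt.differentiableAt (by norm_num))).fderiv,
      hg.fderiv_zero]
    have h0 : (0 : Hyperplane n →L[ℝ] ℝ).smulRight n = 0 := by
      refine ContinuousLinearMap.ext fun v ↦ ?_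
      simp
    rw [h0, add_zero, ← NNReal.coe_lt_coe, Real.coe_toNNReal _ (by positivity), coe_nnnorm]
    exact (Submodule.norm_subtypeL_le _).trans_lt (by linarith)
  obtain ⟨δ₁, hδ₁, hsub⟩ := Metric.mem_nhds_iff.1
    (inter_mem (inter_mem e1 hs) (Metric.ball_mem_nhds _ hδ₀))
  have hc : IsNormalChart Ω R y n h (min δ₀ δ₁) ρ :=
    ⟨hG.mono (min_le_left _ _), hΩ, hu, fun w hw ↦ lt_trans (by positivity)
      (hsub (Metric.ball_subset_ball (min_le_right _ _) hw)).1.1⟩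
  set δ₂ := min δ₀ δ₁
  have hδ₂ : 0 < δ₂ := lt_min hδ₀ hδ₁
  have hcpt : IsCompact (Metric.closedBall (0 : Hyperplane n) (δ₂ / 2) ×ˢ Icc (0 : ℝ) t) :=
    (isCompact_closedBall _ _).prod isCompact_Icc
  have hne : (Metric.closedBall (0 : Hyperplane n) (δ₂ / 2) ×ˢ Icc (0 : ℝ) t).Nonempty :=
    ⟨(0, 0), Metric.mem_closedBall_self (by positivity), left_mem_Icc.2 ht.le⟩
  have hcb : Metric.closedBall (0 : Hyperplane n) (δ₂ / 2) ⊆ Metric.ball 0 δ₂ :=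
    Metric.closedBall_subset_ball (by linarith)
  have hcont : ContinuousOn (chartJac n hn h)
      (Metric.closedBall (0 : Hyperplane n) (δ₂ / 2) ×ˢ Icc (0 : ℝ) t) :=
    hc.continuousOn_chartJac.mono fun p hp ↦ ⟨hcb hp.1, mem_univ _⟩
  obtain ⟨p₀, hp₀, hmin⟩ := hcpt.exists_isMinOn hne hcont
  obtain ⟨p₁, -, hmax⟩ := hcpt.exists_isMaxOn hne hcont
  have hsl : Metric.ball (0 : Hyperplane n) (δ₂ / 2) ×ˢ Ioo 0 t ⊆
      Metric.closedBall (0 : Hyperplane n) (δ₂ / 2) ×ˢ Icc (0 : ℝ) t :=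
    prod_mono Metric.ball_subset_closedBall Ioo_subset_Icc_self
  have hb1 : Metric.ball (0 : Hyperplane n) (δ₂ / 2) ⊆ Metric.ball 0 δ₁ :=
    Metric.ball_subset_ball (by linarith [min_le_right δ₀ δ₁])
  have hc' := hc.mono (δ' := δ₂ / 2) (by linarith)
  refine ⟨n, h, δ₂ / 2, ρ, ⟨hc'.toIsGraphOn, hΩ, hu.mono htR.le, hc'.jac_pos⟩, ht, by positivity,
    hg.zero, ⟨_, hc.chartJac_pos (p := p₀) ⟨hcb hp₀.1, hp₀.2.1, hp₀.2.2.trans_lt htR⟩,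
      fun p hp ↦ hmin (hsl hp)⟩, ⟨_, fun p hp ↦ hmax (hsl hp)⟩, fun w hw ↦ ?_,
    hsL.mono fun w hw ↦ (hsub (hb1 hw)).1.2⟩
  have : (1 + ε)⁻¹ < chartJac n hn h (w, 0) := (hsub (hb1 hw)).1.1
  rw [inv_lt_iff_one_lt_mul₀ (by positivity)] at this
  linarith

namespace IsFineChart

variable {Ω : Set (Space d)} {t : ℝ} {y n : Space d} {h : Hyperplane n → ℝ} {δ ρ ε : ℝ}

theorem isFiniteMeasure_verticalMeasure (hc : IsFineChart Ω t y n h δ ρ ε) (f : Space d → ℝ) :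
    IsFiniteMeasure (hc.toIsNormalChart.verticalMeasure f t) := by
  have hfin := isFiniteMeasure_variation_normalDeriv Ω f t
  obtain ⟨c, hc0, hcJ⟩ := hc.exists_lower
  set H := hc.toIsNormalChart.homeo with hH
  have hae : AEMeasurable H.symm ((normalDeriv Ω f t).variation.restrict H.target) :=
    H.continuousOn_symm.aemeasurable H.open_target.measurableSet
  have hJm : Measurable fun p ↦ (ENNReal.ofReal (chartJac n hc.norm_eq h p))⁻¹ :=
    (measurable_chartJac n hc.norm_eq h).ennreal_ofReal.inv
  refine ⟨?_⟩
  rw [IsNormalChart.verticalMeasure, withDensity_apply _ MeasurableSet.univ,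
    Measure.restrict_univ, lintegral_map' hJm.aemeasurable hae]
  calc _ ≤ ∫⁻ x in H.target, (ENNReal.ofReal c)⁻¹ ∂(normalDeriv Ω f t).variation := by
        refine setLIntegral_mono' H.open_target.measurableSet fun x hx ↦ ?_
        rw [ENNReal.inv_le_inv]
        exact ENNReal.ofReal_le_ofReal (hcJ _ (H.map_target hx))
    _ = (ENNReal.ofReal c)⁻¹ * (normalDeriv Ω f t).variation H.target := setLIntegral_const _ _
    _ < ∞ := ENNReal.mul_lt_top (by simpa using hc0) (measure_lt_top _ _)

theorem integrableOn_comp_normalChart (hc : IsFineChart Ω t y n h δ ρ ε) {f : Space d → ℝ}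
    (hf : IntegrableOn f Ω) : IntegrableOn (fun p ↦ f (normalChart y n h p))
      (Metric.ball (0 : Hyperplane n) δ ×ˢ Ioo 0 t) (volume.prod volume) := by
  obtain ⟨c, hc0, hcJ⟩ := hc.exists_lower
  have hm : MeasurableSet (Metric.ball (0 : Hyperplane n) δ ×ˢ Ioo 0 t) :=
    (IsNormalChart.isOpen_source δ t).measurableSet
  have h1 := hc.toIsNormalChart.integrableOn_comp hm subset_rfl (hf.mono_set (by
    rintro _ ⟨p, hp, rfl⟩
    exact (hc.toIsNormalChart.mem_and_bdryDist hp).1))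
  have h2 : IntegrableOn (fun p ↦ (chartJac n hc.norm_eq h p)⁻¹ *
      (chartJac n hc.norm_eq h p * f (normalChart y n h p)))
      (Metric.ball (0 : Hyperplane n) δ ×ˢ Ioo 0 t) (volume.prod volume) := by
    refine h1.bdd_mul (c := c⁻¹) (measurable_chartJac n hc.norm_eq h).inv.aestronglyMeasurable ?_
    refine (ae_restrict_iff' hm).2 (Eventually.of_forall fun p hp ↦ ?_)
    have hJ : 0 < chartJac n hc.norm_eq h p := hc0.trans_le (hcJ p hp)
    rw [norm_inv, Real.norm_of_nonneg hJ.le]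
    exact inv_anti₀ hc0 (hcJ p hp)
  refine h2.congr_fun (fun p hp ↦ ?_) hm
  have hJ : chartJac n hc.norm_eq h p ≠ 0 := (hc0.trans_le (hcJ p hp)).ne'
  simp only
  rw [inv_mul_cancel_left₀ hJ]

/-- The trace in normal coordinates. -/
theorem exists_trace (hc : IsFineChart Ω t y n h δ ρ ε) {f : Space d → ℝ} (hf : MemBV Ω f) :
    ∃ T : Hyperplane n → ℝ, Measurable T ∧
      (∀ A, MeasurableSet A → A ⊆ Metric.ball 0 δ →
        ∫⁻ p in A ×ˢ Ioo 0 t, ‖f (normalChart y n h p) - T p.1‖ₑ ∂(volume.prod volume) ≤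
          ENNReal.ofReal t * hc.toIsNormalChart.verticalMeasure f t (A ×ˢ Ioo 0 t)) ∧
      ∀ᵐ w, w ∈ Metric.ball (0 : Hyperplane n) δ → bvTrace Ω f (graphPoint y n h w) = T w ∧
        Tendsto (fun r : ℝ ↦ ⨍ x in Ω ∩ Metric.ball (graphPoint y n h w) r,
          |f x - bvTrace Ω f (graphPoint y n h w)|) (𝓝[>] 0) (𝓝 0) := by
  have := hc.isFiniteMeasure_verticalMeasure f
  obtain ⟨C, hC⟩ := hc.exists_upper
  have hint := hc.integrableOn_comp_normalChart hf.1
  have hvd := hc.toIsNormalChart.verticalDerivBound hf le_rfl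
  obtain ⟨T, hTm, hTi, hT⟩ := exists_isSlabTrace Metric.isOpen_ball hc.t_pos hint hvd
  refine ⟨T, hTm, fun A hA hAB ↦ lintegral_sub_trace_le Metric.isOpen_ball hint hvd hTi hT
    hc.t_pos le_rfl hA hAB, ?_⟩
  filter_upwards [ae_tendsto_average_sub_trace Metric.isOpen_ball hc.t_pos hint hvd hTm hTi hT]
    with w hw hwB
  have h1 := hc.toIsNormalChart.tendsto_setAverage hc.t_pos hf.1 hC hwB (hw hwB)
  have h2 := bvTrace_eq_of_tendsto hc.isOpen hf.1 (hc.graphPoint_mem hwB) h1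
  refine ⟨h2, ?_⟩
  rw [h2]
  exact h1

/-- The product of Jacobian and weight is the area element of the graph, which is nearly one. -/
theorem one_le_mul_weight (hc : IsFineChart Ω t y n h δ ρ ε) {p : Hyperplane n × ℝ}
    (hp : p ∈ Metric.ball (0 : Hyperplane n) δ ×ˢ Ioo 0 t) :
    1 ≤ (1 + ε) * (chartJac n hc.norm_eq h p * weight Ω (normalChart y n h p)) := by
  have hJ := hc.chartJac_pos (p := p) ⟨hp.1, hp.2.1.le, hp.2.2⟩
  rw [hc.weight_normalChart hp, mul_div_cancel₀ _ hJ.ne']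
  exact hc.one_le _ hp.1

theorem verticalMeasure_le (hc : IsFineChart Ω t y n h δ ρ ε) (hε : 0 < ε) (f : Space d → ℝ)
    {A : Set (Hyperplane n)} (hA : MeasurableSet A) (hAB : A ⊆ Metric.ball 0 δ) :
    hc.toIsNormalChart.verticalMeasure f t (A ×ˢ Ioo 0 t) ≤ ENNReal.ofReal (1 + ε) *
      ∫⁻ x in normalChart y n h '' (A ×ˢ Ioo 0 t), ENNReal.ofReal (weight Ω x)
        ∂(normalDeriv Ω f t).variation := by
  have hS : A ×ˢ Ioo 0 t ⊆ Metric.ball (0 : Hyperplane n) δ ×ˢ Ioo 0 t := prod_mono_left hAB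
  have hSm : MeasurableSet (A ×ˢ Ioo 0 t) := hA.prod measurableSet_Ioo
  have h1 := hc.toIsNormalChart.lintegral_verticalMeasure f t hSm hS (k := fun _ ↦ 1)
    measurable_const
  have hm : MeasurableSet (normalChart y n h '' (A ×ˢ Ioo 0 t)) :=
    hSm.image_of_continuousOn_injOn (hc.toIsNormalChart.homeo.continuousOn.mono hS)
      (hc.toIsNormalChart.injOn.mono hS)
  rw [setLIntegral_one] at h1
  rw [h1, ← lintegral_const_mul' _ _ ENNReal.ofReal_ne_top]
  refine setLIntegral_mono' hm ?_
  rintro _ ⟨p, hp, rfl⟩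
  have hJ := hc.chartJac_pos (p := p) ⟨(hS hp).1, (hS hp).2.1.le, (hS hp).2.2⟩
  rw [hc.toIsNormalChart.homeo_symm_normalChart (hS hp), mul_one, ← ENNReal.ofReal_inv_of_pos hJ,
    ← ENNReal.ofReal_mul (by positivity)]
  refine ENNReal.ofReal_le_ofReal ?_
  rw [inv_le_iff_one_le_mul₀ hJ]
  linarith [hc.one_le_mul_weight (hS hp)]

theorem lintegral_sub_le (hc : IsFineChart Ω t y n h δ ρ ε) (hε : 0 < ε) (f g : Space d → ℝ)
    {A : Set (Hyperplane n)} (hA : MeasurableSet A) (hAB : A ⊆ Metric.ball 0 δ) :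
    ∫⁻ p in A ×ˢ Ioo 0 t, ‖f (normalChart y n h p) - g (normalChart y n h p)‖ₑ
        ∂(volume.prod volume) ≤ ENNReal.ofReal (1 + ε) *
      ∫⁻ x in normalChart y n h '' (A ×ˢ Ioo 0 t), ENNReal.ofReal (weight Ω x * |f x - g x|) := by
  have hS : A ×ˢ Ioo 0 t ⊆ Metric.ball (0 : Hyperplane n) δ ×ˢ Ioo 0 t := prod_mono_left hAB
  have hSm : MeasurableSet (A ×ˢ Ioo 0 t) := hA.prod measurableSet_Ioo
  rw [hc.toIsNormalChart.lintegral_image hSm hS, ← lintegral_const_mul' _ _ ENNReal.ofReal_ne_top]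
  refine setLIntegral_mono' hSm fun p hp ↦ ?_
  have hJ := hc.chartJac_pos (p := p) ⟨(hS hp).1, (hS hp).2.1.le, (hS hp).2.2⟩
  rw [← ENNReal.ofReal_mul hJ.le, ← ENNReal.ofReal_mul (by positivity), Real.enorm_eq_ofReal_abs]
  refine ENNReal.ofReal_le_ofReal ?_
  have := mul_le_mul_of_nonneg_right (hc.one_le_mul_weight (hS hp))
    (abs_nonneg (f (normalChart y n h p) - g (normalChart y n h p)))
  linarith

end IsFineChart

/-- The right-hand side of the trace inequality, restricted to a part `S` of the layer. -/
def layerBound (Ω : Set (Space d)) (f g : Space d → ℝ) (t : ℝ) (S : Set (Space d)) : ℝ≥0∞ :=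
  ∫⁻ x in S, ENNReal.ofReal (weight Ω x) ∂(normalDeriv Ω f t).variation +
    ∫⁻ x in S, ENNReal.ofReal (weight Ω x) ∂(normalDeriv Ω g t).variation +
    ENNReal.ofReal (1 / t) * ∫⁻ x in S, ENNReal.ofReal (weight Ω x * |f x - g x|)

/-- The mean oscillation of `f` around its boundary trace tends to zero at `y`. -/
def HasBVTraceAt (Ω : Set (Space d)) (f : Space d → ℝ) (y : Space d) : Prop :=
  Tendsto (fun r : ℝ ↦ ⨍ x in Ω ∩ Metric.ball y r, |f x - bvTrace Ω f y|) (𝓝[>] 0) (𝓝 0)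

/-- `N` is a measurable part of the boundary on which traces exist and the trace inequality holds up
to the factor `(1 + ε) ^ d`. -/
structure IsTracePatch (Ω : Set (Space d)) (f g : Space d → ℝ) (t ε : ℝ) (N : Set (Space d)) :
    Prop where
  subset : N ⊆ frontier Ω
  measurableSet : MeasurableSet N
  hasTrace : ∀ᵐ x ∂(μHE[d - 1] : Measure (Space d)).restrict N,
    HasBVTraceAt Ω f x ∧ HasBVTraceAt Ω g x
  measurableSet_fiber : ∀ C ⊆ N, MeasurableSet C →
    MeasurableSet {x ∈ layer Ω t | bdryProj Ω x ∈ C}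
  lintegral_le : ∀ C ⊆ N, MeasurableSet C →
    ∫⁻ x in C, ENNReal.ofReal |bvTrace Ω f x - bvTrace Ω g x| ∂μHE[d - 1] ≤
      ENNReal.ofReal (1 + ε) ^ d * layerBound Ω f g t {x ∈ layer Ω t | bdryProj Ω x ∈ C}

/-- In a fine chart the trace inequality holds up to one factor `1 + ε` from the area element and
`d - 1` factors from the Lipschitz constant of the parametrization. -/
theorem IsFineChart.isTracePatch {Ω : Set (Space d)} {t : ℝ} {y n : Space d}
    {h : Hyperplane n → ℝ} {δ ρ ε : ℝ} (hc : IsFineChart Ω t y n h δ ρ ε) (hε : 0 < ε)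
    {f g : Space d → ℝ} (hf : MemBV Ω f) (hg : MemBV Ω g) :
    IsTracePatch Ω f g t ε (graphPoint y n h '' Metric.ball 0 δ) := by
  have hn := hc.norm_eq
  have hinj := hc.injective_graphPoint
  have himg : ∀ A, MeasurableSet A → A ⊆ Metric.ball 0 δ → MeasurableSet (graphPoint y n h '' A) :=
    fun A hA hAB ↦ hA.image_of_continuousOn_injOn (hc.lipschitz.continuousOn.mono hAB) hinj.injOn
  have hfib : ∀ A, MeasurableSet A → A ⊆ Metric.ball 0 δ →
      MeasurableSet (normalChart y n h '' (A ×ˢ Ioo 0 t)) := fun A hA hAB ↦ by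
    have hS : A ×ˢ Ioo 0 t ⊆ Metric.ball (0 : Hyperplane n) δ ×ˢ Ioo 0 t := prod_mono_left hAB
    exact (hA.prod measurableSet_Ioo).image_of_continuousOn_injOn
      (hc.toIsNormalChart.homeo.continuousOn.mono hS) (hc.toIsNormalChart.injOn.mono hS)
  -- measurable parts of the patch come from measurable parts of the base
  have hbase : ∀ C ⊆ graphPoint y n h '' Metric.ball 0 δ, MeasurableSet C →
      ∃ A, MeasurableSet A ∧ A ⊆ Metric.ball 0 δ ∧ graphPoint y n h '' A = C := by
    intro C hC hCm
    refine ⟨Metric.ball 0 δ ∩ graphPoint y n h ⁻¹' C, ?_, inter_subset_left, ?_⟩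
    · have h1 : Measurable ((Metric.ball (0 : Hyperplane n) δ).domRestrict (graphPoint y n h)) :=
        (continuousOn_iff_continuous_domRestrict.1 hc.lipschitz.continuousOn).measurable
      have h2 := Metric.isOpen_ball.measurableSet.subtype_image (h1 hCm)
      convert h2 using 1
      ext w
      simp [and_comm]
    · rw [image_inter_preimage, inter_eq_right.2 hC]
  obtain ⟨T, hTm, hT1, hT2⟩ := hc.exists_trace hf
  obtain ⟨T', hTm', hT1', hT2'⟩ := hc.exists_trace hg
  have hK : (((1 + ε).toNNReal : NNReal) : ℝ≥0∞) = ENNReal.ofReal (1 + ε) := rfl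
  refine ⟨?_, himg _ Metric.isOpen_ball.measurableSet subset_rfl, ?_, ?_, ?_⟩
  · rintro _ ⟨w, hw, rfl⟩
    exact hc.graphPoint_mem hw
  · rw [ae_restrict_iff' (himg _ Metric.isOpen_ball.measurableSet subset_rfl)]
    have hnull : (μHE[d - 1] : Measure (Space d)) (graphPoint y n h '' {w ∈ Metric.ball 0 δ |
        ¬ (HasBVTraceAt Ω f (graphPoint y n h w) ∧ HasBVTraceAt Ω g (graphPoint y n h w))}) = 0 := by
      refine le_antisymm ((hausdorff_graph_image_le hn
        (hc.lipschitz.mono fun w hw ↦ hw.1)).trans_eq ?_) bot_le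
      have : ∀ᵐ w, w ∉ {w ∈ Metric.ball (0 : Hyperplane n) δ |
          ¬ (HasBVTraceAt Ω f (graphPoint y n h w) ∧
            HasBVTraceAt Ω g (graphPoint y n h w))} := by
        filter_upwards [hT2, hT2'] with w h1 h2 h3
        exact h3.2 ⟨(h1 h3.1).2, (h2 h3.1).2⟩
      rw [measure_eq_zero_iff_ae_notMem.2 this, mul_zero]
    filter_upwards [measure_eq_zero_iff_ae_notMem.1 hnull] with x hx
    rintro ⟨w, hw, rfl⟩
    by_contra hne
    exact hx ⟨w, ⟨hw, hne⟩, rfl⟩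
  · intro C hC hCm
    obtain ⟨A, hA, hAB, rfl⟩ := hbase C hC hCm
    rw [← hc.toIsNormalChart.image_eq hAB le_rfl]
    exact hfib A hA hAB
  · intro C hC hCm
    obtain ⟨A, hA, hAB, rfl⟩ := hbase C hC hCm
    rw [← hc.toIsNormalChart.image_eq hAB le_rfl]
    have h1 : ∫⁻ x in graphPoint y n h '' A, ENNReal.ofReal |bvTrace Ω f x - bvTrace Ω g x|
        ∂μHE[d - 1] ≤ ENNReal.ofReal (1 + ε) ^ (d - 1) * ∫⁻ w in A, ‖T w - T' w‖ₑ := by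
      rw [← hK]
      refine lintegral_hausdorff_graph_le hn (hc.lipschitz.mono hAB) (himg A hA hAB)
        (P := fun x ↦ (Hyperplane n).orthogonalProjectionOnto (x - y)) (by fun_prop)
        (fun w _ ↦ ?_) (by fun_prop) ?_
      · have := congrArg Prod.fst (hc.proj_graphPoint w)
        rwa [graphCoord_symm_apply] at this
      · filter_upwards [hT2, hT2'] with w h2 h3 hw
        rw [(h2 (hAB hw)).1, (h3 (hAB hw)).1, Real.enorm_eq_ofReal_abs]
    have h2 := lintegral_trace_sub_trace_le hc.t_pos (hc.integrableOn_comp_normalChart hf.1)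
      (hc.integrableOn_comp_normalChart hg.1) hTm hTm' hAB (hT1 A hA hAB) (hT1' A hA hAB)
    have h3 : ∫⁻ w in A, ‖T w - T' w‖ₑ ≤ ENNReal.ofReal (1 + ε) *
        layerBound Ω f g t (normalChart y n h '' (A ×ˢ Ioo 0 t)) := by
      refine h2.trans ((add_le_add (add_le_add (hc.verticalMeasure_le hε f hA hAB)
        (hc.verticalMeasure_le hε g hA hAB))
        (mul_le_mul_right (hc.lintegral_sub_le hε f g hA hAB) _)).trans_eq ?_)
      rw [layerBound]
      ring
    refine (h1.trans (mul_le_mul_right h3 _)).trans_eq ?_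
    have hd : d - 1 + 1 = d := by
      have := finrank_hyperplane_add_one hn
      omega
    rw [← mul_assoc, ← pow_succ, hd]

/-! ### Covering the boundary -/

theorem layerBound_iUnion_le {Ω : Set (Space d)} {f g : Space d → ℝ} {t : ℝ} {S : ℕ → Set (Space d)}
    (hS : ∀ k, MeasurableSet (S k)) (hd : Pairwise (Function.onFun Disjoint S))
    (hsub : ∀ k, S k ⊆ layer Ω t) :
    ∑' k, layerBound Ω f g t (S k) ≤ layerBound Ω f g t (layer Ω t) := by
  simp only [layerBound]
  rw [ENNReal.tsum_add, ENNReal.tsum_add, ENNReal.tsum_mul_left, ← lintegral_iUnion hS hd,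
    ← lintegral_iUnion hS hd, ← lintegral_iUnion hS hd]
  have h := iUnion_subset hsub
  gcongr

/-- Patches around all boundary points yield the trace inequality up to a factor. -/
theorem lintegral_frontier_le {Ω : Set (Space d)} {f g : Space d → ℝ} {t ε : ℝ}
    (hpatch : ∀ y ∈ frontier Ω, ∃ N ∈ 𝓝[frontier Ω] y, IsTracePatch Ω f g t ε N) :
    HasBVTrace Ω f ∧ HasBVTrace Ω g ∧
    ∫⁻ x in frontier Ω, ENNReal.ofReal |bvTrace Ω f x - bvTrace Ω g x| ∂μHE[d - 1] ≤
      ENNReal.ofReal (1 + ε) ^ d * layerBound Ω f g t (layer Ω t) := by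
  rcases (frontier Ω).eq_empty_or_nonempty with hemp | hne
  · simp [HasBVTrace, hemp]
  choose! N hN hNp using hpatch
  obtain ⟨Y, hYsub, hYc, hYcov⟩ := TopologicalSpace.countable_cover_nhdsWithin hN
  have hYne : Y.Nonempty := by
    by_contra hY
    rw [not_nonempty_iff_eq_empty] at hY
    obtain ⟨y, hy⟩ := hne
    simpa [hY] using hYcov hy
  obtain ⟨u, hu⟩ := hYc.exists_eq_range hYne
  have hp : ∀ k, IsTracePatch Ω f g t ε (N (u k)) := fun k ↦ hNp _ (hYsub (hu ▸ mem_range_self k))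
  -- disjoint measurable pieces, so that their fibres under the projection are disjoint
  set C : ℕ → Set (Space d) := disjointed fun k ↦ N (u k) with hC
  have hCsub : ∀ k, C k ⊆ N (u k) := fun k ↦ disjointed_subset _ k
  have hCm : ∀ k, MeasurableSet (C k) := MeasurableSet.disjointed fun k ↦ (hp k).measurableSet
  have hCd : Pairwise (Function.onFun Disjoint C) := disjoint_disjointed _
  have hcov : ⋃ k, C k = frontier Ω := by
    rw [hC, iUnion_disjointed]
    refine Subset.antisymm (iUnion_subset fun k ↦ (hp k).subset) (hYcov.trans ?_)
    rw [hu]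
    simp
  have htr : ∀ᵐ x ∂(μHE[d - 1] : Measure (Space d)).restrict (frontier Ω),
      HasBVTraceAt Ω f x ∧ HasBVTraceAt Ω g x := by
    rw [← hcov, ae_restrict_iUnion_iff]
    exact fun k ↦ ae_restrict_of_ae_restrict_of_subset (hCsub k) (hp k).hasTrace
  refine ⟨htr.mono fun _ hx ↦ hx.1, htr.mono fun _ hx ↦ hx.2, ?_⟩
  calc ∫⁻ x in frontier Ω, ENNReal.ofReal |bvTrace Ω f x - bvTrace Ω g x| ∂μHE[d - 1]
      = ∑' k, ∫⁻ x in C k, ENNReal.ofReal |bvTrace Ω f x - bvTrace Ω g x| ∂μHE[d - 1] := by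
        rw [← hcov, lintegral_iUnion hCm hCd]
    _ ≤ ∑' k, ENNReal.ofReal (1 + ε) ^ d *
          layerBound Ω f g t {x ∈ layer Ω t | bdryProj Ω x ∈ C k} :=
        ENNReal.tsum_le_tsum fun k ↦ (hp k).lintegral_le _ (hCsub k) (hCm k)
    _ = ENNReal.ofReal (1 + ε) ^ d *
          ∑' k, layerBound Ω f g t {x ∈ layer Ω t | bdryProj Ω x ∈ C k} := ENNReal.tsum_mul_left
    _ ≤ _ := by
        refine mul_le_mul_right (layerBound_iUnion_le
          (fun k ↦ (hp k).measurableSet_fiber _ (hCsub k) (hCm k)) (fun i j hij ↦ ?_)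
          fun k x hx ↦ hx.1) _
        exact disjoint_left.2 fun x hx hx' ↦ disjoint_left.1 (hCd hij) hx.2 hx'.2

theorem exists_isTracePatch {Ω : Set (Space d)} (hΩ : IsUniformlyC2 Ω) {R t : ℝ}
    (hu : HasUniqueProj Ω R) (ht : 0 < t) (htR : t < R) {ε : ℝ} (hε : 0 < ε) {f g : Space d → ℝ}
    (hf : MemBV Ω f) (hg : MemBV Ω g) {y : Space d} (hy : y ∈ frontier Ω) :
    ∃ N ∈ 𝓝[frontier Ω] y, IsTracePatch Ω f g t ε N := by
  obtain ⟨n, h, δ, ρ, hc⟩ := exists_isFineChart hΩ hu ht htR hε hy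
  refine ⟨_, ?_, hc.isTracePatch hε hf hg⟩
  have h0 : graphPoint y n h 0 = y := by simp [graphPoint, hc.zero]
  have := hc.eventually_mem_image (Metric.mem_ball_self hc.δ_pos)
  rw [h0] at this
  rw [mem_nhdsWithin_iff_eventually]
  filter_upwards [this] with q hq hqf
  exact ⟨_, (hq hqf).1, (hq hqf).2.symm⟩

end CurvedTrace

end

/-! ### The trace inequality -/

theorem mainTheorem4 (d : ℕ) (Ω : Set (CurvedTrace.Space d)) (hΩ : CurvedTrace.IsUniformlyC2 Ω)
    (f g : CurvedTrace.Space d → ℝ) (hf : CurvedTrace.MemBV Ω f) (hg : CurvedTrace.MemBV Ω g)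
    (t : ℝ) (ht : 0 < t) (htR : ENNReal.ofReal t < CurvedTrace.reach Ω) :
    CurvedTrace.HasBVTrace Ω f ∧ CurvedTrace.HasBVTrace Ω g ∧
    ∫⁻ y in frontier Ω, ENNReal.ofReal |CurvedTrace.bvTrace Ω f y - CurvedTrace.bvTrace Ω g y|
        ∂μHE[d - 1] ≤
      ∫⁻ x in CurvedTrace.layer Ω t, ENNReal.ofReal (CurvedTrace.weight Ω x)
          ∂(CurvedTrace.normalDeriv Ω f t).variation +
      ∫⁻ x in CurvedTrace.layer Ω t, ENNReal.ofReal (CurvedTrace.weight Ω x)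
          ∂(CurvedTrace.normalDeriv Ω g t).variation +
      ENNReal.ofReal (1 / t) *
        ∫⁻ x in CurvedTrace.layer Ω t, ENNReal.ofReal (CurvedTrace.weight Ω x * |f x - g x|) := by
  obtain ⟨R, htR', hu⟩ := CurvedTrace.exists_hasUniqueProj ht htR
  have key : ∀ ε : ℝ, 0 < ε → _ := fun ε hε ↦ CurvedTrace.lintegral_frontier_le
    (fun y hy ↦ CurvedTrace.exists_isTracePatch hΩ hu ht htR' hε hf hg hy)
  refine ⟨(key 1 one_pos).1, (key 1 one_pos).2.1, ?_⟩
  change _ ≤ CurvedTrace.layerBound Ω f g t (CurvedTrace.layer Ω t)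
  have hlim : Tendsto (fun ε : ℝ ↦ ENNReal.ofReal (1 + ε) ^ d *
      CurvedTrace.layerBound Ω f g t (CurvedTrace.layer Ω t)) (𝓝[>] 0)
      (𝓝 (CurvedTrace.layerBound Ω f g t (CurvedTrace.layer Ω t))) := by
    have h1 : Continuous fun ε : ℝ ↦ ENNReal.ofReal (1 + ε) ^ d :=
      (ENNReal.continuous_pow d).comp (ENNReal.continuous_ofReal.comp (by fun_prop))
    have h2 := (h1.tendsto 0).mono_left (nhdsWithin_le_nhds (s := Ioi 0))
    simp only [add_zero, ENNReal.ofReal_one, one_pow] at h2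
    simpa using ENNReal.Tendsto.mul_const h2 (Or.inl one_ne_zero)
  refine ge_of_tendsto hlim ?_
  filter_upwards [self_mem_nhdsWithin] with ε hε
  exact (key ε hε).2.2
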